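/- For a smooth hypersurface $\Sigma^n\subset\mathbb R^{n+1}$ with unit normal $\nu$, let $H$ be its mean curvature with respect to $\nu$, i.e. the sum of the principal curvatures (the eigenvalues of $-d\nu$), so that spheres have positive mean curvature with respect to the inward normal. $\Sigma$ is a $\lambda$-hypersurface if $H+\langle X,\nu\rangle=\lambda$ at every point, where $X$ is the position vector and $\nu$ is the inward unit normal; for a rotationally symmetric hypersurface disjoint from its axis, inward means pointing into the connected component of $\mathbb R^{n+1}\setminus\Sigma$ that contains the axis. $\Sigma$ is convex if its second fundamental form is semidefinite with the same sign at all points. **Theorem 1.1.** For each integer $n\ge 2$ there is a constant $c_1(n)>0$, depending only on $n$, such that for every $\lambda$ with $0<\lambda<c_1(n)$ there exists a complete, embedded, non-convex $\lambda$-hypersurface $\Sigma^n\subset\mathbb R^{n+1}$ which is diffeomorphic to $\mathbb R\times S^{n-1}$, is rotationally symmetric about a coordinate axis of $\mathbb R^{n+1}$ and disjoint from that axis, and is not isometric (as a Riemannian manifold with the induced metric) to a round cylinder $\mathbb R\times S^{n-1}(\rho)$ of any radius $\rho>0$. -/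

import Mathlib

open Set Filter Topology
open scoped Manifold ContDiff ENNReal

noncomputable section

section Hypersurface

variable {E H M : Type*} [NormedAddCommGroup E] [NormedSpace ℝ E] [TopologicalSpace H]
  (I : ModelWithCorners ℝ E H) [TopologicalSpace M] [ChartedSpace H M]
  {V : Type*} [NormedAddCommGroup V] [InnerProductSpace ℝ V]

/-- `F : M → V` is a smooth embedding of the manifold `M`: a smooth immersion (injective differential
at every point) which is a homeomorphism onto its image. -/
def IsEmbeddedSubmanifold (F : M → V) : Prop :=
  ContMDiff I 𝓘(ℝ, V) ∞ F ∧ (∀ p, Function.Injective (mvfderiv I F p)) ∧ IsEmbedding F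

/-- `N` is a smooth unit normal vector field along `F`. -/
def IsUnitNormalField (F N : M → V) : Prop :=
  ContMDiff I 𝓘(ℝ, V) ∞ N ∧ (∀ p, ‖N p‖ = 1) ∧
    ∀ p (v : TangentSpace I p), inner ℝ (N p) (mvfderiv I F p v) = 0

/-- `A` is the shape operator of the hypersurface `F` at `p` with respect to the unit normal `N`:
`dF ∘ A = - dN`. Its eigenvalues are the principal curvatures and its trace is the mean curvature;
with this sign the unit sphere with the inward normal has `A = id`. -/
def IsShapeOperatorAt (F N : M → V) (p : M)
    (A : TangentSpace I p →ₗ[ℝ] TangentSpace I p) : Prop :=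
  ∀ v, mvfderiv I F p (A v) = - mvfderiv I N p v

/-- The equation `H + ⟨X, ν⟩ = lam`, where `X = F` is the position vector, `ν = N` is the
unit normal and `H` (the trace of the shape operator) is the mean curvature. -/
def IsLambdaHypersurface (F N : M → V) (lam : ℝ) : Prop :=
  ∀ p, ∃ A : TangentSpace I p →ₗ[ℝ] TangentSpace I p, IsShapeOperatorAt I F N p A ∧
    LinearMap.trace ℝ (TangentSpace I p) A + inner ℝ (F p) (N p) = lam

/-- The second fundamental form with respect to the unit normal `N`. -/
def secondFundamentalForm (F N : M → V) (p : M) (v w : TangentSpace I p) : ℝ :=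
  - inner ℝ (mvfderiv I N p v) (mvfderiv I F p w)

/-- A hypersurface is convex if, for one of the two choices of the unit normal, all its principal
curvatures are nonnegative, i.e. its second fundamental form is semidefinite of constant sign. -/
def IsConvexHypersurface (F N : M → V) : Prop :=
  (∀ p (v : TangentSpace I p), 0 ≤ secondFundamentalForm I F N p v v) ∨
    (∀ p (v : TangentSpace I p), secondFundamentalForm I F N p v v ≤ 0)

/-- The distance on `M` of the Riemannian metric induced by `F` (the infimum of the lengths of
`C^1` paths), where a tangent vector `v` has length `‖dF v‖`. -/
def inducedEDist (F : M → V) (p q : M) : ℝ≥0∞ :=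
  @Manifold.riemannianEDist E _ _ H _ I M _ _ (fun x => ⟨fun v => ‖mvfderiv I F x v‖ₑ⟩) p q

/-- The Riemannian metric induced by `F` is complete: Cauchy sequences for its distance converge. -/
def IsCompleteHypersurface (F : M → V) : Prop :=
  ∀ u : ℕ → M,
    (∀ ε : ℝ≥0∞, 0 < ε → ∃ k, ∀ i ≥ k, ∀ j ≥ k, inducedEDist I F (u i) (u j) < ε) →
      ∃ p, Tendsto (fun i => inducedEDist I F (u i) p) atTop (𝓝 0)

/-- `F` and `F'` are isometric: some diffeomorphism of the underlying manifolds is an isometry of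
the induced Riemannian metrics. -/
def AreIsometric {E' H' M' V' : Type*} [NormedAddCommGroup E'] [NormedSpace ℝ E']
    [TopologicalSpace H'] (I' : ModelWithCorners ℝ E' H') [TopologicalSpace M'] [ChartedSpace H' M']
    [NormedAddCommGroup V'] [InnerProductSpace ℝ V'] (F : M → V) (F' : M' → V') : Prop :=
  ∃ Φ : M ≃ₘ^∞⟮I, I'⟯ M', ∀ p (v w : TangentSpace I p),
    inner ℝ (mvfderiv I' F' (Φ p) (mfderiv I I' Φ p v))
        (mvfderiv I' F' (Φ p) (mfderiv I I' Φ p w)) =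
      inner ℝ (mvfderiv I F p v) (mvfderiv I F p w)

end Hypersurface

section Rotation

variable {n : ℕ}

/-- The unit vector `(1, 0, …, 0)` spanning the axis of rotation. -/
def axisVector (n : ℕ) : EuclideanSpace ℝ (Fin (n + 1)) := EuclideanSpace.single 0 1

/-- `S ⊆ ℝⁿ⁺¹` is invariant under all linear isometries fixing the `x₀`-axis pointwise. -/
def IsRotationallySymmetric (S : Set (EuclideanSpace ℝ (Fin (n + 1)))) : Prop :=
  ∀ R : EuclideanSpace ℝ (Fin (n + 1)) ≃ₗᵢ[ℝ] EuclideanSpace ℝ (Fin (n + 1)),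
    R (axisVector n) = axisVector n → R '' S = S

/-- The hypersurface `F` does not meet the `x₀`-axis, and at each of its points `N` points into the
component of the complement that contains the axis, while `-N` points out of it. -/
def IsInwardNormal {M : Type*} (F N : M → EuclideanSpace ℝ (Fin (n + 1))) : Prop :=
  (∀ x : ℝ, x • axisVector n ∉ range F) ∧
    ∀ p, ∃ ε : ℝ, 0 < ε ∧ ∀ t : ℝ, 0 < t → t < ε →
      F p + t • N p ∈ connectedComponentIn (range F)ᶜ 0 ∧
      F p - t • N p ∉ connectedComponentIn (range F)ᶜ 0

end Rotation

section Cylinder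

/-- The dimension fact from which Mathlib builds the smooth structure of `S^{n-1} ⊆ ℝⁿ`. -/
instance finrank_euclideanSpace_fact (n : ℕ) [NeZero n] :
    Fact (Module.finrank ℝ (EuclideanSpace ℝ (Fin n)) = (n - 1) + 1) :=
  ⟨by rw [finrank_euclideanSpace_fin, Nat.sub_add_cancel (NeZero.one_le)]⟩

/-- The manifold `ℝ × S^{n-1}`. -/
abbrev Cylinder (n : ℕ) : Type := ℝ × Metric.sphere (0 : EuclideanSpace ℝ (Fin n)) 1

/-- The model with corners of `ℝ × S^{n-1}`. -/
abbrev cylinderModel (n : ℕ) : ModelWithCorners ℝ (ℝ × EuclideanSpace ℝ (Fin (n - 1)))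
    (ModelProd ℝ (EuclideanSpace ℝ (Fin (n - 1)))) :=
  𝓘(ℝ, ℝ).prod (𝓡 (n - 1))

/-- The round cylinder of radius `ρ` around the `x₀`-axis, `(x, α) ↦ (x, ρ α)`. -/
def roundCylinder (n : ℕ) (ρ : ℝ) : Cylinder n → EuclideanSpace ℝ (Fin (n + 1)) :=
  fun p => WithLp.toLp 2 (Fin.cons p.1 (fun i => ρ * (p.2 : EuclideanSpace ℝ (Fin n)) i))

end Cylinder

end

noncomputable section

/-! ### Global existence, uniqueness and continuous dependence for fields of linear growth. -/

section ODE

open Metric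
open scoped NNReal

variable {E : Type*} [NormedAddCommGroup E] [NormedSpace ℝ E]

/-! Put k = n - 1. A rotational λ-hypersurface is generated by an arc length curve (x, r) whose
tangent angle solves θ' = k cos θ / r + x sin θ - r cos θ - λ. The curve is found by shooting
horizontally from (0, r₀), with r₀ between 1/2 and the radius R of the cylinder solution, the
positive root of R² + λR = k. For r₀ < R the angle enters (0, π/2) at once. It can leave only
through 0 or π/2, and it does so transversally: a tangential contact would make the curve a cylinder
or a plane by uniqueness. Hence leaving through 0 and leaving through π/2 are disjoint open
conditions on r₀.

Both conditions occur. Near R (`exists_mem_fallingSet`), the linearization at the cylinder is u'' -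
s u' + (k/R²) u = 0 with k/R² = 1 + λ/R > 1, and Sturm comparison with s - δs³ forces θ to vanish at
a positive time. This needs λ > 0: for coefficient 1 the solution u = s has no positive zero. At r₀
= 1/2 and λ = 0 (`half_zero_mem_risingSet`), the pinching cos θ / r ≥ 4H persists as long as H > 0
and θ' ≥ 0. It keeps θ' positive and excludes that θ stays in (0, π/2) forever, so θ crosses π/2.
Openness in (r₀, λ) extends this to small λ, and this determines c₁. As [1/2, R) is connected, some
r₀ has neither property, and its angle stays in (0, π/2) for all positive times
(`exists_complete_profile`).

For such a curve, monotonicity of H exp(-|X|²/2) and then of r^(k+1) exp(-|X|²/2) θ' gives H ≥ 0 and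
θ' ≥ 0, hence r and x tend to infinity. Reflection in x = 0 makes it a positive graph over the whole
axis, so its rotation is closed and embedded. At the neck the principal curvatures -θ' < 0 and cos θ
/ r > 0 have opposite signs, so convexity fails. Since r is unbounded, large spheres of latitude
carry four points whose mutual distances are comparable within π/√2. On a cylinder of fixed radius,
which is a line at large scale, this is impossible. -/

theorem ode_eqOn_Ioo {v : E → E} (hv : ∀ B : ℝ, ∃ K : ℝ≥0, LipschitzOnWith K v (closedBall 0 B))
    {f g : ℝ → E} {T : ℝ} (hf : ∀ t ∈ Ioo (-T) T, HasDerivAt f (v (f t)) t)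
    (hg : ∀ t ∈ Ioo (-T) T, HasDerivAt g (v (g t)) t) (h0 : f 0 = g 0) : EqOn f g (Ioo (-T) T) := by
  intro t ht
  have hT : |t| < T := abs_lt.2 ht
  obtain ⟨S, hS1, hS2⟩ := exists_between hT
  have hsub : Icc (-S) S ⊆ Ioo (-T) T := fun u hu => ⟨by linarith [hu.1], by linarith [hu.2]⟩
  have bdd : ∀ k : ℝ → E, (∀ t ∈ Ioo (-T) T, HasDerivAt k (v (k t)) t) →
      ∃ B, ∀ u ∈ Icc (-S) S, ‖k u‖ ≤ B := fun k hk =>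
    isCompact_Icc.exists_bound_of_continuousOn
      (fun u hu => (hk u (hsub hu)).continuousAt.continuousWithinAt)
  obtain ⟨B₁, hB₁⟩ := bdd f hf
  obtain ⟨B₂, hB₂⟩ := bdd g hg
  obtain ⟨K, hK⟩ := hv (max B₁ B₂)
  have hS0 : 0 < S := (abs_nonneg t).trans_lt hS1
  refine ODE_solution_unique_of_mem_Ioo (v := fun _ => v) (s := fun _ => closedBall 0 (max B₁ B₂))
    (a := -S) (b := S) (t₀ := 0) (fun _ _ => hK) ⟨by linarith, hS0⟩ (fun u hu => ⟨hf u ?_, ?_⟩)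
    (fun u hu => ⟨hg u ?_, ?_⟩) h0 (abs_lt.1 hS1)
  · exact hsub (Ioo_subset_Icc_self hu)
  · simpa using Or.inl (hB₁ u (Ioo_subset_Icc_self hu))
  · exact hsub (Ioo_subset_Icc_self hu)
  · simpa using Or.inr (hB₂ u (Ioo_subset_Icc_self hu))

theorem ode_eq {v : E → E} (hv : ∀ B : ℝ, ∃ K : ℝ≥0, LipschitzOnWith K v (closedBall 0 B))
    {f g : ℝ → E} (hf : ∀ t, HasDerivAt f (v (f t)) t)
    (hg : ∀ t, HasDerivAt g (v (g t)) t) {t₀ : ℝ} (h0 : f t₀ = g t₀) : f = g := by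
  have key : (fun t => f (t + t₀)) = fun t => g (t + t₀) := by
    ext t
    refine ode_eqOn_Ioo hv (T := |t| + 1) (f := fun t => f (t + t₀)) (g := fun t => g (t + t₀))
      (fun u _ => ?_) (fun u _ => ?_) (by simpa using h0) (abs_lt.1 (by linarith))
    · exact (hf (u + t₀)).comp_add_const u t₀
    · exact (hg (u + t₀)).comp_add_const u t₀
  ext t
  simpa using congrFun key (t - t₀)

/-- An a priori bound for solutions of a differential equation of linear growth. -/
theorem norm_le_of_linear_growth {f f' : ℝ → E} {C T : ℝ}
    (hf : ∀ t ∈ Icc (-T) T, HasDerivWithinAt f (f' t) (Icc (-T) T) t)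
    (hC : ∀ t ∈ Icc (-T) T, ‖f' t‖ ≤ C * ‖f t‖ + C) (hC0 : 0 ≤ C) :
    ∀ t ∈ Icc (-T) T, ‖f t‖ ≤ gronwallBound ‖f 0‖ C C T := by
  have one : ∀ g g' : ℝ → E, (∀ t ∈ Icc (-T) T, HasDerivWithinAt g (g' t) (Icc (-T) T) t) →
      (∀ t ∈ Icc (-T) T, ‖g' t‖ ≤ C * ‖g t‖ + C) → ∀ t ∈ Icc 0 T,
      ‖g t‖ ≤ gronwallBound ‖g 0‖ C C T := by
    intro g g' hg hg' t ht
    have hsub : Icc 0 T ⊆ Icc (-T) T := fun u hu => ⟨by linarith [hu.1, hu.2], hu.2⟩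
    have := norm_le_gronwallBound_of_norm_deriv_right_le (f := g) (f' := g') (a := 0) (b := T)
      (δ := ‖g 0‖) (K := C) (ε := C)
      (fun u hu => ((hg u (hsub hu)).continuousWithinAt).mono hsub)
      (fun u hu => (hg u (hsub (Ico_subset_Icc_self hu))).mono_of_mem_nhdsWithin
        (mem_of_superset (Icc_mem_nhdsGE hu.2)
          (fun w hw => ⟨by linarith [hw.1, hu.1, hu.2], hw.2⟩)))
      le_rfl (fun u hu => hg' u (hsub (Ico_subset_Icc_self hu))) t ht
    refine this.trans ?_
    rw [sub_zero]
    exact gronwallBound_mono (norm_nonneg _) hC0 hC0 ht.2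
  intro t ht
  rcases le_total 0 t with h | h
  · exact one f f' hf hC t ⟨h, ht.2⟩
  · have := one (fun u => f (-u)) (fun u => - f' (-u)) (fun u hu => ?_) (fun u hu => ?_) (-t)
      ⟨by linarith, by linarith [ht.1]⟩
    · simpa using this
    · have hmem : -u ∈ Icc (-T) T := ⟨by linarith [hu.2], by linarith [hu.1]⟩
      have := (hf (-u) hmem).scomp u (hasDerivAt_neg u).hasDerivWithinAt
        (s := Icc (-T) T) (fun w hw => ⟨by linarith [hw.2], by linarith [hw.1]⟩)
      simpa [Function.comp_def] using this
    · have hmem : -u ∈ Icc (-T) T := ⟨by linarith [hu.2], by linarith [hu.1]⟩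
      simpa using hC (-u) hmem

/-- Global existence for vector fields of linear growth which are Lipschitz on bounded sets. The
maps `P B` are Lipschitz retractions onto the balls. -/
theorem ode_exists_global [CompleteSpace E] {v : E → E} {P : ℝ → E → E} {C : ℝ}
    (hv : ∀ B : ℝ, ∃ K : ℝ≥0, LipschitzOnWith K v (closedBall 0 B))
    (hP : ∀ B, 0 ≤ B → LipschitzWith 1 (P B)) (hPB : ∀ B y, 0 ≤ B → ‖P B y‖ ≤ B)
    (hPy : ∀ B y, ‖P B y‖ ≤ ‖y‖) (hPid : ∀ B y, ‖y‖ ≤ B → P B y = y)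
    (hC : ∀ y, ‖v y‖ ≤ C * ‖y‖ + C) (hC0 : 0 ≤ C) (y : E) :
    ∃ f : ℝ → E, f 0 = y ∧ ∀ t, HasDerivAt f (v (f t)) t := by
  have loc : ∀ T : ℝ, 0 < T → ∃ f : ℝ → E, f 0 = y ∧
      ∀ t ∈ Ioo (-T) T, HasDerivAt f (v (f t)) t := by
    intro T hT
    -- `B` is the Grönwall bound on [-T, T]. The truncated field `v ∘ P B` has the same linear
    -- growth, so its solution stays in the ball where `P B` is the identity and hence solves the
    -- original equation.
    set B := gronwallBound ‖y‖ C C T with hB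
    have hB0 : 0 ≤ B := (norm_nonneg y).trans (by
      have := gronwallBound_mono (norm_nonneg y) hC0 hC0 hT.le
      simpa [gronwallBound_x0] using this)
    obtain ⟨K, hK⟩ := hv B
    have hlip : LipschitzWith K (v ∘ P B) := by
      have := hK.comp ((hP B hB0).lipschitzOnWith (s := univ))
        (fun z _ => by simpa using hPB B z hB0)
      simpa using lipschitzOnWith_univ.1 this
    have hbd : ∀ z, ‖(v ∘ P B) z‖ ≤ C * B + C := fun z =>
      (hC _).trans (by have := hPB B z hB0; gcongr)
    have hL0 : 0 ≤ C * B + C := by positivity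
    have hpl : IsPicardLindelof (fun _ => v ∘ P B) (tmin := -T) (tmax := T)
        ⟨0, by constructor <;> linarith⟩ y ⟨(C * B + C) * T, by positivity⟩ 0
        ⟨C * B + C, hL0⟩ K := by
      refine IsPicardLindelof.of_time_independent (fun z _ => hbd z) hlip.lipschitzOnWith ?_
      simp only [sub_zero, zero_sub, neg_neg, max_self, NNReal.coe_zero]
      exact le_rfl
    obtain ⟨f, hf0, hf⟩ := hpl.exists_eq_forall_mem_Icc_hasDerivWithinAt₀
    simp only at hf0
    have hbound := norm_le_of_linear_growth (f := f) hf (C := C) (fun t _ => ?_) hC0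
    · refine ⟨f, hf0, fun t ht => ?_⟩
      have h1 := (hf t (Ioo_subset_Icc_self ht)).hasDerivAt (Icc_mem_nhds ht.1 ht.2)
      have h2 := hbound t (Ioo_subset_Icc_self ht)
      rw [hf0] at h2
      simpa [hPid B (f t) h2] using h1
    · refine (hC _).trans ?_
      have := hPy B (f t)
      gcongr
  choose! F hF0 hF using loc
  have hagree : ∀ S T : ℝ, 0 < S → S ≤ T → EqOn (F S) (F T) (Ioo (-S) S) := fun S T hS hST =>
    ode_eqOn_Ioo hv (hF S hS)
      (fun t ht => hF T (hS.trans_le hST) t ⟨by linarith [ht.1], by linarith [ht.2]⟩)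
      ((hF0 S hS).trans (hF0 T (hS.trans_le hST)).symm)
  -- Glues the local solutions, which agree on common intervals. Near `t` the glued function equals
  -- the single solution `F (|t| + 2)`.
  refine ⟨fun t => F (|t| + 1) t, ?_, fun t => ?_⟩
  · simpa using hF0 1 one_pos
  · have ht : t ∈ Ioo (-(|t| + 2)) (|t| + 2) := abs_lt.1 (by linarith)
    have h := hF (|t| + 2) (by positivity) t ht
    have e : (fun u => F (|u| + 1) u) =ᶠ[𝓝 t] F (|t| + 2) := by
      have : Iio (|t| + 1) ∈ 𝓝 |t| := Iio_mem_nhds (by linarith)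
      filter_upwards [continuous_abs.continuousAt.preimage_mem_nhds this] with u hu
      have hu : |u| < |t| + 1 := hu
      exact hagree (|u| + 1) (|t| + 2) (by positivity) (by linarith) (abs_lt.1 (by linarith))
    have e' : F (|t| + 1) t = F (|t| + 2) t := e.self_of_nhds
    simp only [e']
    exact h.congr_of_eventuallyEq e

/-- Continuous dependence on the initial value, jointly with time. -/
theorem ode_continuous_flow {v : E → E} {C : ℝ}
    (hv : ∀ B : ℝ, ∃ K : ℝ≥0, LipschitzOnWith K v (closedBall 0 B))
    (hC : ∀ y, ‖v y‖ ≤ C * ‖y‖ + C) (hC0 : 0 ≤ C) {Φ : E → ℝ → E} (h0 : ∀ y, Φ y 0 = y)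
    (hΦ : ∀ y t, HasDerivAt (Φ y) (v (Φ y t)) t) :
    ContinuousOn (fun p : E × ℝ => Φ p.1 p.2) (univ ×ˢ Ici 0) := by
  -- Up to time `T` all solutions starting in the ball of radius `R` stay in one Grönwall ball, so a
  -- single Lipschitz constant of `v` serves them all.
  have hfix : ∀ (R T : ℝ), 0 ≤ T → ∃ K : ℝ, ∀ y z : E, ‖y‖ ≤ R → ‖z‖ ≤ R → ∀ t ∈ Icc 0 T,
      dist (Φ y t) (Φ z t) ≤ dist y z * K := by
    intro R T hT
    obtain ⟨K, hK⟩ := hv (gronwallBound R C C T)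
    refine ⟨Real.exp (K * T), fun y z hy hz t ht => ?_⟩
    have bd : ∀ y, ‖y‖ ≤ R → ∀ t ∈ Icc 0 T, Φ y t ∈ closedBall 0 (gronwallBound R C C T) := by
      intro y hy t ht
      rw [mem_closedBall_zero_iff]
      have := norm_le_of_linear_growth (f := Φ y) (T := T) (fun t _ => (hΦ y t).hasDerivWithinAt)
        (fun t _ => hC _) hC0 t ⟨by linarith [ht.1], ht.2⟩
      refine this.trans ?_
      rw [h0, gronwallBound, gronwallBound]
      split_ifs <;> gcongr
    have := dist_le_of_trajectories_ODE_of_mem (v := fun _ => v) (f := Φ y) (g := Φ z)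
      (a := 0) (b := T) (s := fun _ => closedBall 0 (gronwallBound R C C T)) (K := K)
      (δ := dist y z) (fun _ _ => hK)
      (fun u _ => (hΦ y u).continuousAt.continuousWithinAt)
      (fun u _ => (hΦ y u).hasDerivWithinAt) (fun u hu => bd y hy u (Ico_subset_Icc_self hu))
      (fun u _ => (hΦ z u).continuousAt.continuousWithinAt)
      (fun u _ => (hΦ z u).hasDerivWithinAt) (fun u hu => bd z hz u (Ico_subset_Icc_self hu))
      (by rw [h0, h0]) t ht
    refine this.trans ?_
    have : t - 0 ≤ T := by linarith [ht.2]
    gcongr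
  rintro ⟨y, t⟩ ⟨-, ht⟩
  have ht : 0 ≤ t := ht
  obtain ⟨K, hK⟩ := hfix (‖y‖ + 1) (t + 1) (by linarith)
  rw [ContinuousWithinAt, tendsto_iff_dist_tendsto_zero]
  have hcont : Tendsto (fun p : E × ℝ => dist p.1 y * K + dist (Φ y p.2) (Φ y t))
      (𝓝[univ ×ˢ Ici 0] (y, t)) (𝓝 0) := by
    have c : Continuous (Φ y) := continuous_iff_continuousAt.2 fun s => (hΦ y s).continuousAt
    have : Continuous (fun p : E × ℝ => dist p.1 y * K + dist (Φ y p.2) (Φ y t)) := by fun_prop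
    simpa using (this.tendsto (y, t)).mono_left nhdsWithin_le_nhds
  refine squeeze_zero' (Eventually.of_forall fun _ => dist_nonneg) ?_ hcont
  have h1 : ∀ᶠ p : E × ℝ in 𝓝[univ ×ˢ Ici 0] (y, t), dist p (y, t) < 1 :=
    nhdsWithin_le_nhds (ball_mem_nhds _ one_pos)
  filter_upwards [h1, self_mem_nhdsWithin] with p hp hp0
  have hp2 : (0:ℝ) ≤ p.2 := hp0.2
  rw [Prod.dist_eq, max_lt_iff, Real.dist_eq, abs_lt] at hp
  refine (dist_triangle _ (Φ y p.2) _).trans ?_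
  gcongr
  refine hK p.1 y ?_ (by linarith) p.2 ⟨hp2, by linarith [hp.2.2]⟩
  have := norm_le_norm_add_norm_sub' p.1 y
  rw [← dist_eq_norm] at this
  linarith [hp.1]

end ODE

/-! ### The profile equation, its cutoff and its flow. -/

section Profile

open Metric
open scoped NNReal

/-- The vector field of the profile curve equation in the variables `(x, r, θ, lam)`; the
singularity at the axis `r = 0` is cut off. -/
def profileField (k : ℕ) (y : ℝ × ℝ × ℝ × ℝ) : ℝ × ℝ × ℝ × ℝ :=
  (Real.cos y.2.2.1, Real.sin y.2.2.1, k * Real.cos y.2.2.1 * (max y.2.1 (1 / 4))⁻¹ +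
    y.1 * Real.sin y.2.2.1 - y.2.1 * Real.cos y.2.2.1 - y.2.2.2, 0)

theorem abs_cos_sub_cos_le (a b : ℝ) : |Real.cos a - Real.cos b| ≤ |a - b| := by
  simpa [Real.dist_eq] using Real.lipschitzWith_cos.dist_le_mul a b

theorem abs_sin_sub_sin_le (a b : ℝ) : |Real.sin a - Real.sin b| ≤ |a - b| := by
  simpa [Real.dist_eq] using Real.lipschitzWith_sin.dist_le_mul a b

theorem inv_max_le_four (a : ℝ) : (max a (1 / 4))⁻¹ ≤ 4 := by
  rw [inv_le_comm₀ (lt_max_of_lt_right (by norm_num)) (by norm_num)]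
  exact (by norm_num : (4:ℝ)⁻¹ = 1 / 4) ▸ le_max_right _ _

theorem abs_inv_max_sub_inv_max_le (a b : ℝ) :
    |(max a (1 / 4))⁻¹ - (max b (1 / 4))⁻¹| ≤ 16 * |a - b| := by
  have ha : 0 < max a (1 / 4) := lt_max_of_lt_right (by norm_num)
  have hb : 0 < max b (1 / 4) := lt_max_of_lt_right (by norm_num)
  have h4a := inv_max_le_four a
  have h4b := inv_max_le_four b
  rw [inv_sub_inv ha.ne' hb.ne', abs_div, abs_of_pos (mul_pos ha hb), div_eq_mul_inv, mul_inv]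
  have h := abs_max_sub_max_le_abs b a (1 / 4)
  rw [abs_sub_comm b a] at h
  calc _ ≤ |a - b| * (4 * 4) := by gcongr
    _ = _ := by ring

theorem abs_mul_sub_mul_le {a b c d : ℝ} : |a * b - c * d| ≤ |a| * |b - d| + |d| * |a - c| := by
  have : a * b - c * d = a * (b - d) + d * (a - c) := by ring
  rw [this, ← abs_mul, ← abs_mul]
  exact abs_add_le _ _

/-- The cutoff at 1/4 bounds the inverse by 4 and makes it 16-Lipschitz. It is harmless because the
relevant curves keep r ≥ 1/2. Since `lam` is a constant fourth coordinate, dependence on initial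
values includes dependence on `lam`. -/
theorem profileField_lipschitzOnWith (k : ℕ) (B : ℝ) :
    ∃ K : ℝ≥0, LipschitzOnWith K (profileField k) (closedBall 0 B) := by
  refine ⟨Real.toNNReal (20 * k + 2 * |B| + 3), LipschitzOnWith.of_dist_le_mul ?_⟩
  rintro ⟨x, r, θ, l⟩ hy ⟨x', r', θ', l'⟩ -
  rw [Real.coe_toNNReal _ (by positivity)]
  rw [mem_closedBall_zero_iff] at hy
  set d := dist ((x, r, θ, l) : ℝ × ℝ × ℝ × ℝ) (x', r', θ', l') with hd
  have hd0 : 0 ≤ d := dist_nonneg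
  simp only [Prod.norm_def, max_le_iff, Real.norm_eq_abs] at hy
  obtain ⟨hx, hr, -, -⟩ := hy
  have hB : B ≤ |B| := le_abs_self B
  have hB0 : 0 ≤ |B| := abs_nonneg B
  have hdd : |x - x'| ≤ d ∧ |r - r'| ≤ d ∧ |θ - θ'| ≤ d ∧ |l - l'| ≤ d := by
    rw [hd]; simp [Prod.dist_eq, Real.dist_eq]
  obtain ⟨dx, dr, dθ, dl⟩ := hdd
  have hc := (abs_cos_sub_cos_le θ θ').trans dθ
  have hs := (abs_sin_sub_sin_le θ θ').trans dθ
  have hk : (0:ℝ) ≤ k := k.cast_nonneg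
  have hm := (abs_inv_max_sub_inv_max_le r r')
  have h4 := inv_max_le_four r'
  have h40 : 0 ≤ (max r' (1 / 4))⁻¹ := by positivity
  have e1 : |Real.cos θ * (max r (1 / 4))⁻¹ - Real.cos θ' * (max r' (1 / 4))⁻¹| ≤ 20 * d := by
    refine abs_mul_sub_mul_le.trans ?_
    have := Real.abs_cos_le_one θ
    rw [abs_of_nonneg h40]
    calc _ ≤ 1 * (16 * d) + 4 * d := by gcongr; exact hm.trans (by gcongr)
      _ = 20 * d := by ring
  have e2 : |x * Real.sin θ - x' * Real.sin θ'| ≤ |B| * d + 1 * d := by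
    refine abs_mul_sub_mul_le.trans ?_
    have := Real.abs_sin_le_one θ'
    have := hx.trans hB
    gcongr
  have e3 : |r * Real.cos θ - r' * Real.cos θ'| ≤ |B| * d + 1 * d := by
    refine abs_mul_sub_mul_le.trans ?_
    have := Real.abs_cos_le_one θ'
    have := hr.trans hB
    gcongr
  have hbig : d ≤ (20 * k + 2 * |B| + 3) * d := by nlinarith [mul_nonneg hk hd0, mul_nonneg hB0 hd0]
  simp only [profileField, Prod.dist_eq, Real.dist_eq, max_le_iff, sub_self, abs_zero]
  refine ⟨hc.trans hbig, hs.trans hbig, ?_, by positivity⟩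
  have : k * Real.cos θ * (max r (1 / 4))⁻¹ + x * Real.sin θ - r * Real.cos θ - l -
      (k * Real.cos θ' * (max r' (1 / 4))⁻¹ + x' * Real.sin θ' - r' * Real.cos θ' - l') =
      k * (Real.cos θ * (max r (1 / 4))⁻¹ - Real.cos θ' * (max r' (1 / 4))⁻¹) +
      (x * Real.sin θ - x' * Real.sin θ') - (r * Real.cos θ - r' * Real.cos θ') - (l - l') := by
    ring
  rw [this]
  calc _ ≤ k * (20 * d) + (|B| * d + 1 * d) + (|B| * d + 1 * d) + d := by
        refine (abs_sub _ _).trans (add_le_add ((abs_sub _ _).trans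
          (add_le_add ((abs_add_le _ _).trans (add_le_add ?_ e2)) e3)) dl)
        rw [abs_mul, abs_of_nonneg hk]
        gcongr
    _ = _ := by ring

theorem profileField_norm_le (k : ℕ) (y : ℝ × ℝ × ℝ × ℝ) :
    ‖profileField k y‖ ≤ (4 * k + 3) * ‖y‖ + (4 * k + 3) := by
  obtain ⟨x, r, θ, l⟩ := y
  set N := ‖((x, r, θ, l) : ℝ × ℝ × ℝ × ℝ)‖ with hN
  have hN0 : 0 ≤ N := norm_nonneg _
  have hdd : |x| ≤ N ∧ |r| ≤ N ∧ |θ| ≤ N ∧ |l| ≤ N := by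
    rw [hN]; simp [Prod.norm_def, Real.norm_eq_abs]
  obtain ⟨dx, dr, dθ, dl⟩ := hdd
  have hk : (0:ℝ) ≤ k := k.cast_nonneg
  have hc := Real.abs_cos_le_one θ
  have hs := Real.abs_sin_le_one θ
  have h4 := inv_max_le_four r
  have h40 : 0 ≤ (max r (1 / 4))⁻¹ := by positivity
  have hkN := mul_nonneg hk hN0
  simp only [profileField, Prod.norm_def, Real.norm_eq_abs, max_le_iff, abs_zero]
  refine ⟨by nlinarith, by nlinarith, ?_, by positivity⟩
  calc _ ≤ k * 1 * 4 + N * 1 + N * 1 + N := by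
        refine (abs_sub _ _).trans (add_le_add ((abs_sub _ _).trans
          (add_le_add ((abs_add_le _ _).trans (add_le_add ?_ ?_)) ?_)) dl)
        · rw [abs_mul, abs_mul, abs_of_nonneg hk, abs_of_nonneg h40]; gcongr
        · rw [abs_mul]; gcongr
        · rw [abs_mul]; gcongr
    _ ≤ _ := by nlinarith

/-- Truncation of a real number to `[-B, B]`. -/
def truncate (B x : ℝ) : ℝ := max (-B) (min B x)

theorem truncate_lipschitz (B : ℝ) : LipschitzWith 1 (truncate B) := by
  unfold truncate
  simpa using ((LipschitzWith.id (α := ℝ)).const_min B).const_max (-B)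

theorem abs_truncate_le {B : ℝ} (hB : 0 ≤ B) (x : ℝ) : |truncate B x| ≤ B := by
  unfold truncate; grind

theorem abs_truncate_le_abs (B x : ℝ) (hB : 0 ≤ B) : |truncate B x| ≤ |x| := by
  unfold truncate; grind

theorem truncate_eq_self {B x : ℝ} (h : |x| ≤ B) : truncate B x = x := by
  unfold truncate; grind

theorem exists_profileFlow (k : ℕ) (y : ℝ × ℝ × ℝ × ℝ) :
    ∃ f : ℝ → ℝ × ℝ × ℝ × ℝ, f 0 = y ∧ ∀ t, HasDerivAt f (profileField k (f t)) t := by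
  -- Coordinatewise truncation is 1-Lipschitz for the sup norm of the product. `|B|` is used because
  -- two of the required properties of `P B` carry no sign condition on `B`.
  refine ode_exists_global (P := fun B y => (truncate |B| y.1, truncate |B| y.2.1,
    truncate |B| y.2.2.1, truncate |B| y.2.2.2)) (C := 4 * k + 3) (profileField_lipschitzOnWith k)
    (fun B _ => ?_) (fun B y hB => ?_) (fun B y => ?_) (fun B y hy => ?_) (profileField_norm_le k)
    (by positivity) y
  · have h := truncate_lipschitz |B|
    refine LipschitzWith.of_dist_le_mul fun y z => ?_
    have h' : ∀ a b, dist (truncate |B| a) (truncate |B| b) ≤ dist a b := fun a b => by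
      simpa using h.dist_le_mul a b
    simp only [Prod.dist_eq, NNReal.coe_one, one_mul]
    gcongr <;> exact h' _ _
  · have := abs_nonneg B
    simp only [Prod.norm_def, Real.norm_eq_abs, max_le_iff]
    have h : ∀ a, |truncate |B| a| ≤ B := fun a =>
      (abs_truncate_le (abs_nonneg B) a).trans_eq (abs_of_nonneg hB)
    exact ⟨h _, h _, h _, h _⟩
  · simp only [Prod.norm_def, Real.norm_eq_abs]
    have h := fun a => abs_truncate_le_abs |B| a (abs_nonneg B)
    exact max_le_max (h _) (max_le_max (h _) (max_le_max (h _) (h _)))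
  · simp only [Prod.norm_def, Real.norm_eq_abs, max_le_iff] at hy
    have h : B ≤ |B| := le_abs_self B
    rw [truncate_eq_self (hy.1.trans h), truncate_eq_self (hy.2.1.trans h),
      truncate_eq_self (hy.2.2.1.trans h), truncate_eq_self (hy.2.2.2.trans h)]

/-- `(x, r)` is the arc length parametrized profile curve, with tangent angle `θ`, of a
rotational `lam`-hypersurface of dimension `k + 1`, as long as it has distance at least `1 / 4` from
the axis. -/
structure IsProfile (k : ℕ) (lam : ℝ) (x r θ : ℝ → ℝ) : Prop where
  hasDerivAt_x : ∀ s, HasDerivAt x (Real.cos (θ s)) s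
  hasDerivAt_r : ∀ s, HasDerivAt r (Real.sin (θ s)) s
  hasDerivAt_θ : ∀ s, HasDerivAt θ (k * Real.cos (θ s) * (max (r s) (1 / 4))⁻¹ +
    x s * Real.sin (θ s) - r s * Real.cos (θ s) - lam) s

theorem IsProfile.hasDerivAt_field {k : ℕ} {lam : ℝ} {x r θ : ℝ → ℝ} (h : IsProfile k lam x r θ)
    (s : ℝ) : HasDerivAt (fun s => (x s, r s, θ s, lam))
      (profileField k (x s, r s, θ s, lam)) s :=
  (h.hasDerivAt_x s).prodMk ((h.hasDerivAt_r s).prodMk ((h.hasDerivAt_θ s).prodMk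
    (hasDerivAt_const s lam)))

theorem IsProfile.unique {k : ℕ} {lam : ℝ} {x r θ x' r' θ' : ℝ → ℝ} (h : IsProfile k lam x r θ)
    (h' : IsProfile k lam x' r' θ') {s₀ : ℝ} (hx : x s₀ = x' s₀) (hr : r s₀ = r' s₀)
    (hθ : θ s₀ = θ' s₀) : x = x' ∧ r = r' ∧ θ = θ' := by
  have := ode_eq (profileField_lipschitzOnWith k) h.hasDerivAt_field h'.hasDerivAt_field (t₀ := s₀)
    (by simp [hx, hr, hθ])
  refine ⟨?_, ?_, ?_⟩ <;> ext s
  · exact congrArg (fun p => p.1) (congrFun this s)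
  · exact congrArg (fun p => p.2.1) (congrFun this s)
  · exact congrArg (fun p => p.2.2.1) (congrFun this s)

/-- The flow of the profile curve equation. -/
def profileFlow (k : ℕ) (y : ℝ × ℝ × ℝ × ℝ) : ℝ → ℝ × ℝ × ℝ × ℝ :=
  (exists_profileFlow k y).choose

/-- The axial coordinate along the solution starting orthogonally to `x = 0` at height `p.1` with
`lam = p.2`. -/
def xSol (k : ℕ) (p : ℝ × ℝ) (s : ℝ) : ℝ := (profileFlow k (0, p.1, 0, p.2) s).1

/-- The distance from the axis along the solution of `xSol`. -/
def rSol (k : ℕ) (p : ℝ × ℝ) (s : ℝ) : ℝ := (profileFlow k (0, p.1, 0, p.2) s).2.1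

/-- The tangent angle along the solution of `xSol`. -/
def θSol (k : ℕ) (p : ℝ × ℝ) (s : ℝ) : ℝ := (profileFlow k (0, p.1, 0, p.2) s).2.2.1

theorem profileFlow_zero (k : ℕ) (y : ℝ × ℝ × ℝ × ℝ) : profileFlow k y 0 = y :=
  (exists_profileFlow k y).choose_spec.1

theorem profileFlow_hasDerivAt (k : ℕ) (y : ℝ × ℝ × ℝ × ℝ) (t : ℝ) :
    HasDerivAt (profileFlow k y) (profileField k (profileFlow k y t)) t :=
  (exists_profileFlow k y).choose_spec.2 t

theorem profileFlow_lam (k : ℕ) (p : ℝ × ℝ) (s : ℝ) :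
    (profileFlow k (0, p.1, 0, p.2) s).2.2.2 = p.2 := by
  have h : ∀ t, HasDerivAt (fun t => (profileFlow k (0, p.1, 0, p.2) t).2.2.2) 0 t := fun t =>
    (((profileFlow_hasDerivAt k (0, p.1, 0, p.2) t).snd).snd).snd
  have := is_const_of_deriv_eq_zero (fun t => (h t).differentiableAt) (fun t => (h t).deriv) s 0
  simpa [profileFlow_zero] using this

theorem isProfile_sol (k : ℕ) (p : ℝ × ℝ) :
    IsProfile k p.2 (xSol k p) (rSol k p) (θSol k p) where
  hasDerivAt_x s := (profileFlow_hasDerivAt k (0, p.1, 0, p.2) s).fst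
  hasDerivAt_r s := (profileFlow_hasDerivAt k (0, p.1, 0, p.2) s).snd.fst
  hasDerivAt_θ s := by
    have := (profileFlow_hasDerivAt k (0, p.1, 0, p.2) s).snd.snd.fst
    simp only [profileField, profileFlow_lam] at this
    exact this

@[simp] theorem xSol_zero (k : ℕ) (p : ℝ × ℝ) : xSol k p 0 = 0 := by simp [xSol, profileFlow_zero]
@[simp] theorem rSol_zero (k : ℕ) (p : ℝ × ℝ) : rSol k p 0 = p.1 := by simp [rSol, profileFlow_zero]
@[simp] theorem θSol_zero (k : ℕ) (p : ℝ × ℝ) : θSol k p 0 = 0 := by simp [θSol, profileFlow_zero]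

theorem continuousOn_profileFlow (k : ℕ) :
    ContinuousOn (fun q : (ℝ × ℝ × ℝ × ℝ) × ℝ => profileFlow k q.1 q.2) (univ ×ˢ Ici 0) :=
  ode_continuous_flow (C := 4 * k + 3) (profileField_lipschitzOnWith k) (profileField_norm_le k)
    (by positivity) (profileFlow_zero k) (profileFlow_hasDerivAt k)

/-- Continuity of the flow is established for nonnegative times only. The absolute value turns it
into continuity on the whole space, which suits the tube lemma. -/
theorem continuous_sol_abs (k : ℕ) : Continuous
    (fun q : (ℝ × ℝ) × ℝ => (xSol k q.1 |q.2|, rSol k q.1 |q.2|, θSol k q.1 |q.2|)) := by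
  have h : Continuous (fun q : (ℝ × ℝ) × ℝ => profileFlow k (0, q.1.1, 0, q.1.2) |q.2|) :=
    (continuousOn_profileFlow k).comp_continuous
      (f := fun q : (ℝ × ℝ) × ℝ => (((0, q.1.1, 0, q.1.2) : ℝ × ℝ × ℝ × ℝ), |q.2|))
      (by fun_prop) (fun q => ⟨mem_univ _, abs_nonneg q.2⟩)
  exact (continuous_fst.comp h).prodMk ((continuous_fst.comp (continuous_snd.comp h)).prodMk
    (continuous_fst.comp (continuous_snd.comp (continuous_snd.comp h))))

end Profile

/-! ### Curvature identities along profile curves and transversality at the exit angles. -/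

section Profile

open Real

theorem HasDerivAt.eventually_lt_right {f : ℝ → ℝ} {f' a : ℝ} (h : HasDerivAt f f' a)
    (hf' : 0 < f') : ∀ᶠ s in 𝓝[>] a, f a < f s := by
  have h1 := (hasDerivAt_iff_tendsto_slope.1 h).mono_left
    (nhdsWithin_mono a (fun s (hs : a < s) => hs.ne'))
  filter_upwards [h1.eventually (lt_mem_nhds hf'), self_mem_nhdsWithin] with s hs has
  rw [slope_def_field, div_pos_iff_of_pos_right (sub_pos.2 has)] at hs
  linarith

theorem HasDerivAt.eventually_lt_left {f : ℝ → ℝ} {f' a : ℝ} (h : HasDerivAt f f' a)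
    (hf' : 0 < f') : ∀ᶠ s in 𝓝[<] a, f s < f a := by
  have h1 := (hasDerivAt_iff_tendsto_slope.1 h).mono_left
    (nhdsWithin_mono a (fun s (hs : s < a) => hs.ne))
  filter_upwards [h1.eventually (lt_mem_nhds hf'), self_mem_nhdsWithin] with s hs has
  have has : s < a := has
  rw [slope_def_field, ← neg_sub (f a), ← neg_sub a, neg_div_neg_eq,
    div_pos_iff_of_pos_right (sub_pos.2 has)] at hs
  linarith

/-- The curvature `θ'` of the profile curve. -/
def profileCurv (k : ℕ) (lam : ℝ) (x r θ : ℝ → ℝ) (s : ℝ) : ℝ :=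
  k * cos (θ s) * (r s)⁻¹ + x s * sin (θ s) - r s * cos (θ s) - lam

/-- The mean curvature of the hypersurface with the given profile curve. -/
def profileH (lam : ℝ) (x r θ : ℝ → ℝ) (s : ℝ) : ℝ :=
  lam + r s * cos (θ s) - x s * sin (θ s)

/-- The Gaussian weight. -/
def gaussWeight (x r : ℝ → ℝ) (s : ℝ) : ℝ := exp (-((x s) ^ 2 + (r s) ^ 2) / 2)

/-- `(|X|² / 2)'` along the profile curve. -/
def radialSpeed (x r θ : ℝ → ℝ) (s : ℝ) : ℝ := r s * sin (θ s) + x s * cos (θ s)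

theorem gaussWeight_pos (x r : ℝ → ℝ) (s : ℝ) : 0 < gaussWeight x r s := exp_pos _

theorem profileCurv_eq (k : ℕ) (lam : ℝ) (x r θ : ℝ → ℝ) (s : ℝ) :
    profileCurv k lam x r θ s = k * (cos (θ s) * (r s)⁻¹) - profileH lam x r θ s := by
  unfold profileCurv profileH; ring

namespace IsProfile

variable {k : ℕ} {lam : ℝ} {x r θ : ℝ → ℝ}

theorem continuous_x (h : IsProfile k lam x r θ) : Continuous x :=
  continuous_iff_continuousAt.2 fun s => (h.hasDerivAt_x s).continuousAt

theorem continuous_r (h : IsProfile k lam x r θ) : Continuous r :=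
  continuous_iff_continuousAt.2 fun s => (h.hasDerivAt_r s).continuousAt

theorem continuous_θ (h : IsProfile k lam x r θ) : Continuous θ :=
  continuous_iff_continuousAt.2 fun s => (h.hasDerivAt_θ s).continuousAt

theorem hasDerivAt_θ' (h : IsProfile k lam x r θ) {s : ℝ} (hr : 1 / 4 ≤ r s) :
    HasDerivAt θ (profileCurv k lam x r θ s) s := by
  have := h.hasDerivAt_θ s
  rwa [max_eq_left hr] at this

theorem hasDerivAt_H (h : IsProfile k lam x r θ) {s : ℝ} (hr : 1 / 4 ≤ r s) :
    HasDerivAt (profileH lam x r θ) (-profileCurv k lam x r θ s * radialSpeed x r θ s) s := by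
  have := (((h.hasDerivAt_r s).mul (h.hasDerivAt_θ' hr).cos).const_add lam).sub
    ((h.hasDerivAt_x s).mul (h.hasDerivAt_θ' hr).sin)
  refine (this.congr_deriv ?_)
  unfold radialSpeed
  ring

theorem hasDerivAt_gaussWeight (h : IsProfile k lam x r θ) (s : ℝ) :
    HasDerivAt (gaussWeight x r) (-radialSpeed x r θ s * gaussWeight x r s) s := by
  have := ((((h.hasDerivAt_x s).pow 2).add ((h.hasDerivAt_r s).pow 2)).neg.div_const 2).exp
  refine this.congr_deriv ?_
  simp only [gaussWeight, radialSpeed, Pi.add_apply, Pi.neg_apply, Pi.pow_apply]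
  push_cast
  ring

theorem hasDerivAt_curvTwo (h : IsProfile k lam x r θ) {s : ℝ} (hr : 1 / 4 ≤ r s) :
    HasDerivAt (fun s => cos (θ s) * (r s)⁻¹)
      (-(sin (θ s) * (r s)⁻¹) * (profileCurv k lam x r θ s + cos (θ s) * (r s)⁻¹)) s := by
  have hr0 : r s ≠ 0 := by linarith
  refine ((h.hasDerivAt_θ' hr).cos.mul ((h.hasDerivAt_r s).inv hr0)).congr_deriv ?_
  simp only [Pi.inv_apply]
  field_simp
  ring

theorem hasDerivAt_curv (h : IsProfile k lam x r θ) {s : ℝ} (hr : 1 / 4 ≤ r s) :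
    HasDerivAt (profileCurv k lam x r θ)
      (k * (-(sin (θ s) * (r s)⁻¹) * (profileCurv k lam x r θ s + cos (θ s) * (r s)⁻¹)) +
        profileCurv k lam x r θ s * radialSpeed x r θ s) s := by
  have e : profileCurv k lam x r θ =
      fun s => k * (cos (θ s) * (r s)⁻¹) - profileH lam x r θ s :=
    funext fun s => profileCurv_eq k lam x r θ s
  nth_rw 1 [e]
  refine (((h.hasDerivAt_curvTwo hr).const_mul (k:ℝ)).sub (h.hasDerivAt_H hr)).congr_deriv ?_
  ring

/-- Both H' and the derivative of the weight contain the radial speed as a factor, so they combine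
to -(θ' + H), and θ' + H = k cos θ / r. The sign is thus known on increasing pieces without knowing
that of H. -/
theorem hasDerivAt_H_mul_weight (h : IsProfile k lam x r θ) {s : ℝ} (hr : 1 / 4 ≤ r s) :
    HasDerivAt (fun s => profileH lam x r θ s * gaussWeight x r s)
      (-(k * (cos (θ s) * (r s)⁻¹) * radialSpeed x r θ s * gaussWeight x r s)) s := by
  refine ((h.hasDerivAt_H hr).mul (h.hasDerivAt_gaussWeight s)).congr_deriv ?_
  rw [profileCurv_eq]
  ring

/-- Replacing k cos θ / r by θ' + H turns the equation for the curvature into a linear one with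
source -H sin θ / r. Its integrating factor is r^(k+1) times the Gaussian weight. -/
theorem hasDerivAt_weighted_curv (h : IsProfile k lam x r θ) {s : ℝ} (hr : 1 / 4 ≤ r s) :
    HasDerivAt (fun s => r s ^ (k + 1) * gaussWeight x r s * profileCurv k lam x r θ s)
      (-(r s ^ k * gaussWeight x r s * profileH lam x r θ s * sin (θ s))) s := by
  have hr0 : r s ≠ 0 := by linarith
  refine ((((h.hasDerivAt_r s).pow (k + 1)).mul (h.hasDerivAt_gaussWeight s)).mul
    (h.hasDerivAt_curv hr)).congr_deriv ?_
  have e : profileH lam x r θ s = k * (cos (θ s) * (r s)⁻¹) - profileCurv k lam x r θ s := by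
    rw [profileCurv_eq]; ring
  rw [e]
  simp only [Pi.mul_apply, Pi.pow_apply]
  push_cast
  simp only [pow_succ]
  field_simp
  ring

/-- This solution and `plane` are the ones that uniqueness imposes on a curve whose angle meets 0 or
π/2 with zero curvature. -/
theorem cylinder (k : ℕ) {lam R : ℝ} (x₀ : ℝ) (hR : 1 / 4 ≤ R) (h : k * R⁻¹ - R - lam = 0) :
    IsProfile k lam (fun s => x₀ + s) (fun _ => R) (fun _ => 0) where
  hasDerivAt_x s := by simpa using (hasDerivAt_id s).const_add x₀
  hasDerivAt_r s := by simpa using hasDerivAt_const s R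
  hasDerivAt_θ s := by
    have : k * cos 0 * (max R (1 / 4))⁻¹ + (x₀ + s) * sin 0 - R * cos 0 - lam = 0 := by
      rw [max_eq_left hR]; simpa using h
    rw [this]; exact hasDerivAt_const s 0

theorem plane (k : ℕ) (lam r₀ : ℝ) :
    IsProfile k lam (fun _ => lam) (fun s => r₀ + s) (fun _ => π / 2) where
  hasDerivAt_x s := by simpa using hasDerivAt_const s lam
  hasDerivAt_r s := by simpa using (hasDerivAt_id s).const_add r₀
  hasDerivAt_θ s := by simpa using hasDerivAt_const s (π / 2)

theorem neg_symm (h : IsProfile k lam x r θ) :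
    IsProfile k lam (fun s => -x (-s)) (fun s => r (-s)) (fun s => -θ (-s)) where
  hasDerivAt_x s := by
    have := ((h.hasDerivAt_x (-s)).scomp s (hasDerivAt_neg s)).fun_neg
    simpa [Function.comp_def] using this
  hasDerivAt_r s := by
    have := ((h.hasDerivAt_r (-s)).scomp s (hasDerivAt_neg s))
    simpa [Function.comp_def] using this
  hasDerivAt_θ s := by
    have := ((h.hasDerivAt_θ (-s)).scomp s (hasDerivAt_neg s)).fun_neg
    simpa [Function.comp_def] using this

/-- The profile curve starts orthogonally to `x = 0`. -/
structure _root_.StartsAtNeck (x r θ : ℝ → ℝ) : Prop where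
  x_zero : x 0 = 0
  r_zero : 1 / 2 ≤ r 0
  θ_zero : θ 0 = 0

theorem mono_of_mem (h : IsProfile k lam x r θ) {T : ℝ}
    (hθ : ∀ s ∈ Ioo 0 T, θ s ∈ Ioo 0 (π / 2)) :
    MonotoneOn x (Icc 0 T) ∧ MonotoneOn r (Icc 0 T) := by
  constructor
  · refine monotoneOn_of_deriv_nonneg (convex_Icc 0 T) h.continuous_x.continuousOn
      (fun s _ => (h.hasDerivAt_x s).differentiableAt.differentiableWithinAt) fun s hs => ?_
    rw [interior_Icc] at hs
    rw [(h.hasDerivAt_x s).deriv]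
    exact cos_nonneg_of_mem_Icc ⟨by linarith [(hθ s hs).1, pi_pos], (hθ s hs).2.le⟩
  · refine monotoneOn_of_deriv_nonneg (convex_Icc 0 T) h.continuous_r.continuousOn
      (fun s _ => (h.hasDerivAt_r s).differentiableAt.differentiableWithinAt) fun s hs => ?_
    rw [interior_Icc] at hs
    rw [(h.hasDerivAt_r s).deriv]
    exact sin_nonneg_of_mem_Icc ⟨(hθ s hs).1.le, by linarith [(hθ s hs).2, pi_pos]⟩

theorem r_ge (h : IsProfile k lam x r θ) (h0 : StartsAtNeck x r θ) {T : ℝ}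
    (hθ : ∀ s ∈ Ioo 0 T, θ s ∈ Ioo 0 (π / 2)) {s : ℝ} (hs : s ∈ Icc 0 T) : 1 / 2 ≤ r s :=
  h0.r_zero.trans ((h.mono_of_mem hθ).2 ⟨le_rfl, hs.1.trans hs.2⟩ hs hs.1)

theorem x_nonneg (h : IsProfile k lam x r θ) (h0 : StartsAtNeck x r θ) {T : ℝ}
    (hθ : ∀ s ∈ Ioo 0 T, θ s ∈ Ioo 0 (π / 2)) {s : ℝ} (hs : s ∈ Icc 0 T) : 0 ≤ x s :=
  h0.x_zero ▸ ((h.mono_of_mem hθ).1 ⟨le_rfl, hs.1.trans hs.2⟩ hs hs.1)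

theorem curv_zero (h0 : StartsAtNeck x r θ) :
    profileCurv k lam x r θ 0 = k * (r 0)⁻¹ - r 0 - lam := by
  simp [profileCurv, h0.θ_zero]

theorem eventually_θ_mem (h : IsProfile k lam x r θ) (h0 : StartsAtNeck x r θ)
    (hκ : 0 < k * (r 0)⁻¹ - r 0 - lam) : ∃ ε > 0, ∀ s ∈ Ioo 0 ε, θ s ∈ Ioo 0 (π / 2) := by
  have hr : 1 / 4 ≤ r 0 := by linarith [h0.r_zero]
  have h1 := (h.hasDerivAt_θ' hr).eventually_lt_right (by rwa [curv_zero h0])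
  have h2 : ∀ᶠ s in 𝓝[>] (0:ℝ), θ s < π / 2 := nhdsWithin_le_nhds
    (h.continuous_θ.continuousAt.eventually (gt_mem_nhds (by rw [h0.θ_zero]; positivity)))
  obtain ⟨ε, hε, h3⟩ := mem_nhdsGT_iff_exists_Ioo_subset.1 (h1.and h2)
  refine ⟨ε, hε, fun s hs => ?_⟩
  have := h3 hs
  rw [h0.θ_zero] at this
  exact this

/-- The first time at which the tangent angle leaves `(0, π / 2)`. -/
theorem exists_exit (h : IsProfile k lam x r θ) (h0 : StartsAtNeck x r θ)
    (hκ : 0 < k * (r 0)⁻¹ - r 0 - lam) {s₁ : ℝ} (hs₁ : 0 < s₁) (hout : θ s₁ ∉ Ioo 0 (π / 2)) :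
    ∃ τ, 0 < τ ∧ τ ≤ s₁ ∧ (∀ s ∈ Ioo 0 τ, θ s ∈ Ioo 0 (π / 2)) ∧ (θ τ = 0 ∨ θ τ = π / 2) := by
  obtain ⟨ε, hε, hin⟩ := h.eventually_θ_mem h0 hκ
  -- Times below `ε` are removed because θ 0 = 0 already lies outside the open interval. The infimum
  -- of the closed set `S` is then attained and positive.
  set S : Set ℝ := Ici ε ∩ θ ⁻¹' (Ioo 0 (π / 2))ᶜ with hS
  have hcl : IsClosed S := isClosed_Ici.inter (isOpen_Ioo.isClosed_compl.preimage h.continuous_θ)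
  have hs₁S : s₁ ∈ S := ⟨by by_contra hlt; exact hout (hin s₁ ⟨hs₁, not_le.1 hlt⟩), hout⟩
  have hbdd : BddBelow S := ⟨ε, fun s hs => hs.1⟩
  have hmem := hcl.csInf_mem ⟨s₁, hs₁S⟩ hbdd
  have hτ : 0 < sInf S := lt_of_lt_of_le hε hmem.1
  have hins : ∀ s ∈ Ioo 0 (sInf S), θ s ∈ Ioo 0 (π / 2) := by
    intro s hs
    by_contra hc
    rcases lt_or_ge s ε with hlt | hge
    · exact hc (hin s ⟨hs.1, hlt⟩)
    · exact absurd (csInf_le hbdd ⟨hge, hc⟩) (not_le.2 hs.2)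
  refine ⟨sInf S, hτ, csInf_le hbdd hs₁S, hins, ?_⟩
  have hclos : θ (sInf S) ∈ Icc 0 (π / 2) := by
    have hc : sInf S ∈ closure (Ioo 0 (sInf S)) := by
      rw [closure_Ioo hτ.ne]; exact ⟨hτ.le, le_rfl⟩
    have := map_mem_closure h.continuous_θ hc hins
    rwa [closure_Ioo (by positivity)] at this
  have hnot := hmem.2
  simp only [mem_preimage, mem_compl_iff, mem_Ioo, not_and_or, not_lt] at hnot
  rcases hnot with hn | hn
  · exact Or.inl (le_antisymm hn hclos.1)
  · exact Or.inr (le_antisymm hclos.2 hn)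

/-- The tangent angle crosses `0` transversally. -/
theorem exists_neg_of_exit_zero (h : IsProfile k lam x r θ) (h0 : StartsAtNeck x r θ)
    (hκ : 0 < k * (r 0)⁻¹ - r 0 - lam) {τ : ℝ} (hτ : 0 < τ)
    (hin : ∀ s ∈ Ioo 0 τ, θ s ∈ Ioo 0 (π / 2)) (hτ0 : θ τ = 0) :
    ∃ s > 0, θ s < 0 ∧ ∀ t ∈ Icc 0 s, θ t < π / 2 := by
  have hr : 1 / 2 ≤ r τ := h.r_ge h0 hin ⟨hτ.le, le_rfl⟩
  have hd := h.hasDerivAt_θ' (s := τ) (by linarith)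
  have hle : ¬ 0 < profileCurv k lam x r θ τ := by
    intro hpos
    have h1 := hd.eventually_lt_left hpos
    have h2 : ∀ᶠ s in 𝓝[<] τ, s ∈ Ioo 0 τ := Ioo_mem_nhdsLT hτ
    obtain ⟨s, hs1, hs2⟩ := (h1.and h2).exists
    rw [hτ0] at hs1
    linarith [(hin s hs2).1]
  -- Otherwise the curve is a cylinder through its starting point, which contradicts the positive
  -- initial curvature `hκ`.
  have hne : profileCurv k lam x r θ τ ≠ 0 := by
    intro h0'
    have hcyl := cylinder k (lam := lam) (R := r τ) (x τ - τ) (by linarith)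
      (by simpa [profileCurv, hτ0] using h0')
    have := (h.unique hcyl (s₀ := τ) (by ring) rfl hτ0).2.1
    have e : r 0 = r τ := congrFun this 0
    rw [e] at hκ
    have : profileCurv k lam x r θ τ = k * (r τ)⁻¹ - r τ - lam := by simp [profileCurv, hτ0]
    linarith
  have hneg : 0 < -profileCurv k lam x r θ τ := by
    rcases lt_trichotomy (profileCurv k lam x r θ τ) 0 with h | h | h
    · linarith
    · exact absurd h hne
    · exact absurd h hle
  have h1 := hd.neg.eventually_lt_right hneg
  have h2 : ∀ᶠ s in 𝓝[>] τ, ∀ t ∈ Icc τ s, θ t < π / 2 := by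
    have : ∀ᶠ t in 𝓝 τ, θ t < π / 2 :=
      h.continuous_θ.continuousAt.eventually (gt_mem_nhds (by rw [hτ0]; positivity))
    obtain ⟨l, u, hlu, hsub⟩ := mem_nhds_iff_exists_Ioo_subset.1 this
    filter_upwards [Ioo_mem_nhdsGT hlu.2] with s hs t ht
    exact hsub ⟨hlu.1.trans_le ht.1, ht.2.trans_lt hs.2⟩
  obtain ⟨s, ⟨hs1, hs2⟩, hs3⟩ := ((h1.and h2).and self_mem_nhdsWithin).exists
  have hs3 : τ < s := hs3
  simp only [Pi.neg_apply, hτ0] at hs1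
  refine ⟨s, hτ.trans hs3, by linarith, fun t ht => ?_⟩
  rcases le_or_gt τ t with htt | htt
  · exact hs2 t ⟨htt, ht.2⟩
  · rcases ht.1.eq_or_lt with rfl | h0t
    · rw [h0.θ_zero]; positivity
    · exact (hin t ⟨h0t, htt⟩).2

/-- The tangent angle crosses `π / 2` transversally. -/
theorem exists_gt_of_exit_pi_div_two (h : IsProfile k lam x r θ) (h0 : StartsAtNeck x r θ)
    {τ : ℝ} (hτ : 0 < τ) (hin : ∀ s ∈ Ioo 0 τ, θ s ∈ Ioo 0 (π / 2)) (hτ0 : θ τ = π / 2) :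
    ∃ s > 0, π / 2 < θ s ∧ ∀ t ∈ Ioc 0 s, 0 < θ t := by
  have hr : 1 / 2 ≤ r τ := h.r_ge h0 hin ⟨hτ.le, le_rfl⟩
  have hd := h.hasDerivAt_θ' (s := τ) (by linarith)
  have hle : ¬ 0 < -profileCurv k lam x r θ τ := by
    intro hpos
    have h1 := hd.neg.eventually_lt_left hpos
    have h2 : ∀ᶠ s in 𝓝[<] τ, s ∈ Ioo 0 τ := Ioo_mem_nhdsLT hτ
    obtain ⟨s, hs1, hs2⟩ := (h1.and h2).exists
    simp only [Pi.neg_apply, hτ0] at hs1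
    linarith [(hin s hs2).2]
  -- Zero curvature at angle π/2 means x = `lam`, so the curve would be the vertical line with θ
  -- constantly π/2, against θ 0 = 0.
  have hne : profileCurv k lam x r θ τ ≠ 0 := by
    intro h0'
    have hx : x τ = lam := by simp [profileCurv, hτ0] at h0'; linarith
    have := (h.unique (plane k lam (r τ - τ)) (s₀ := τ) hx (by ring) hτ0).2.2
    have e : θ 0 = π / 2 := congrFun this 0
    rw [h0.θ_zero] at e
    linarith [pi_pos]
  have hpos : 0 < profileCurv k lam x r θ τ := by
    rcases lt_trichotomy (profileCurv k lam x r θ τ) 0 with h | h | h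
    · exact absurd (neg_pos.2 h) hle
    · exact absurd h hne
    · exact h
  have h1 := hd.eventually_lt_right hpos
  have h2 : ∀ᶠ s in 𝓝[>] τ, ∀ t ∈ Icc τ s, 0 < θ t := by
    have : ∀ᶠ t in 𝓝 τ, 0 < θ t :=
      h.continuous_θ.continuousAt.eventually (lt_mem_nhds (by rw [hτ0]; positivity))
    obtain ⟨l, u, hlu, hsub⟩ := mem_nhds_iff_exists_Ioo_subset.1 this
    filter_upwards [Ioo_mem_nhdsGT hlu.2] with s hs t ht
    exact hsub ⟨hlu.1.trans_le ht.1, ht.2.trans_lt hs.2⟩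
  obtain ⟨s, ⟨hs1, hs2⟩, hs3⟩ := ((h1.and h2).and self_mem_nhdsWithin).exists
  have hs3 : τ < s := hs3
  refine ⟨s, hτ.trans hs3, by rwa [hτ0] at hs1, fun t ht => ?_⟩
  rcases le_or_gt τ t with htt | htt
  · exact hs2 t ⟨htt, ht.2⟩
  · exact (hin t ⟨ht.1, htt⟩).1

end IsProfile

/-! ### The two competing sets of shooting parameters and their openness. -/

/-- The parameters `(r 0, lam)` for which the tangent angle becomes negative before reaching
`π / 2`. -/
def fallingSet (k : ℕ) : Set (ℝ × ℝ) :=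
  {p | ∃ s > 0, θSol k p s < 0 ∧ ∀ t ∈ Icc 0 s, θSol k p t < π / 2}

/-- The parameters `(r 0, lam)` for which the tangent angle exceeds `π / 2` before returning
to `0`. -/
def risingSet (k : ℕ) : Set (ℝ × ℝ) :=
  {p | ∃ s > 0, π / 2 < θSol k p s ∧ ∀ t ∈ Ioc 0 s, 0 < θSol k p t}

/-- The parameters for which the profile curve is initially curved away from the axis. -/
def upwardSet (k : ℕ) : Set (ℝ × ℝ) := {p | 0 < k * (max p.1 (1 / 4))⁻¹ - p.1 - p.2}

theorem falling_inter_rising (k : ℕ) (p : ℝ × ℝ) (h : p ∈ fallingSet k) (h' : p ∈ risingSet k) :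
    False := by
  obtain ⟨s, hs, h1, h2⟩ := h
  obtain ⟨t, ht, h3, h4⟩ := h'
  rcases le_total s t with hst | hst
  · linarith [h4 s ⟨hs, hst⟩]
  · linarith [h2 t ⟨ht.le, hst⟩]

theorem continuous_θSol_abs (k : ℕ) : Continuous (fun q : (ℝ × ℝ) × ℝ => θSol k q.1 |q.2|) :=
  continuous_snd.comp (continuous_snd.comp (continuous_sol_abs k))

theorem Continuous.eventually_forall_mem_Icc {α β : Type*} [TopologicalSpace α] [TopologicalSpace β]
    {f : α × ℝ → β} (hf : Continuous f) {U : Set β} (hU : IsOpen U) {a b : ℝ} {p : α}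
    (h : ∀ t ∈ Icc a b, f (p, t) ∈ U) : ∀ᶠ q in 𝓝 p, ∀ t ∈ Icc a b, f (q, t) ∈ U := by
  have hsub : {p} ×ˢ Icc a b ⊆ f ⁻¹' U := by
    rintro ⟨q, t⟩ ⟨rfl, ht⟩
    exact h t ht
  obtain ⟨V, W, hV, -, hpV, hW, hVW⟩ :=
    generalized_tube_lemma isCompact_singleton isCompact_Icc (hU.preimage hf) hsub
  filter_upwards [hV.mem_nhds (hpV rfl)] with q hq t ht
  exact hVW (mk_mem_prod hq (hW ht))

/-- An inequality for the tangent angle on a compact time interval is stable. -/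
theorem eventually_forall_θSol (k : ℕ) {U : Set ℝ} (hU : IsOpen U) {a b : ℝ} (ha : 0 ≤ a)
    {p : ℝ × ℝ} (h : ∀ t ∈ Icc a b, θSol k p t ∈ U) :
    ∀ᶠ q in 𝓝 p, ∀ t ∈ Icc a b, θSol k q t ∈ U := by
  filter_upwards [(continuous_θSol_abs k).eventually_forall_mem_Icc hU (a := a) (b := b) (p := p)
    fun t ht => by simpa [abs_of_nonneg (ha.trans ht.1)] using h t ht] with q hq t ht
  simpa [abs_of_nonneg (ha.trans ht.1)] using hq t ht

/-- The derivative of the tangent angle as a function of the parameters and of time. -/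
def profileAccel (k : ℕ) (q : (ℝ × ℝ) × ℝ) : ℝ :=
  k * cos (θSol k q.1 |q.2|) * (max (rSol k q.1 |q.2|) (1 / 4))⁻¹ +
    xSol k q.1 |q.2| * sin (θSol k q.1 |q.2|) - rSol k q.1 |q.2| * cos (θSol k q.1 |q.2|) - q.1.2

theorem continuous_rSol_abs (k : ℕ) : Continuous (fun q : (ℝ × ℝ) × ℝ => rSol k q.1 |q.2|) := by
  simpa only using (continuous_sol_abs k).snd.fst

theorem continuous_profileAccel (k : ℕ) : Continuous (profileAccel k) := by
  have hx : Continuous fun q : (ℝ × ℝ) × ℝ => xSol k q.1 |q.2| := by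
    simpa only using (continuous_sol_abs k).fst
  have hr := continuous_rSol_abs k
  have hθ := continuous_θSol_abs k
  have : ∀ q : (ℝ × ℝ) × ℝ, max (rSol k q.1 |q.2|) (1 / 4) ≠ 0 := fun p =>
    (lt_max_of_lt_right (by norm_num : (0:ℝ) < 1 / 4)).ne'
  unfold profileAccel
  fun_prop (disch := exact this _)

theorem isOpen_fallingSet (k : ℕ) : IsOpen (fallingSet k) := by
  rw [isOpen_iff_mem_nhds]
  rintro p ⟨s, hs, h1, h2⟩
  filter_upwards [eventually_forall_θSol k isOpen_Iio le_rfl h2,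
    eventually_forall_θSol k (isOpen_Iio (a := (0:ℝ))) hs.le (b := s)
      (fun t ht => by rwa [le_antisymm ht.2 ht.1])] with q hq1 hq2
  exact ⟨s, hs, hq2 s ⟨le_rfl, le_rfl⟩, hq1⟩

theorem isOpen_upwardSet (k : ℕ) : IsOpen (upwardSet k) := by
  refine isOpen_lt continuous_const ?_
  have : ∀ p : ℝ × ℝ, max p.1 (1 / 4) ≠ 0 := fun p =>
    (lt_max_of_lt_right (by norm_num : (0:ℝ) < 1 / 4)).ne'
  fun_prop (disch := exact this _)

/-- Positivity of the angle degenerates at time 0, where compactness gives nothing. The positive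
initial curvature provided by `upwardSet` is stable jointly in parameter and time, so nearby angles
increase strictly on a common interval [0, δ]. Compactness handles [δ, s]. -/
theorem isOpen_risingSet_inter (k : ℕ) : IsOpen (risingSet k ∩ upwardSet k) := by
  rw [isOpen_iff_mem_nhds]
  rintro p ⟨⟨s, hs, h1, h2⟩, hp⟩
  have hG0 : 0 < profileAccel k (p, 0) := by simpa [profileAccel, upwardSet] using hp
  have hnear : ∀ᶠ q : (ℝ × ℝ) × ℝ in 𝓝 p ×ˢ 𝓝 0, 0 < profileAccel k q := by
    rw [← nhds_prod_eq]; exact (continuous_profileAccel k).continuousAt.eventually (lt_mem_nhds hG0)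
  obtain ⟨P, hP, Q, hQ, hPQ⟩ := eventually_prod_iff.1 hnear
  obtain ⟨ε, hε, hball⟩ := Metric.eventually_nhds_iff.1 hQ
  set δ := min (ε / 2) s with hδ
  have hδ0 : 0 < δ := by positivity
  filter_upwards [hP, (isOpen_upwardSet k).mem_nhds hp,
    eventually_forall_θSol k (isOpen_Ioi (a := (0:ℝ))) hδ0.le (b := s)
      (fun t ht => h2 t ⟨hδ0.trans_le ht.1, ht.2⟩),
    eventually_forall_θSol k (isOpen_Ioi (a := π / 2)) hs.le (b := s)
      (fun t ht => by rwa [le_antisymm ht.2 ht.1])] with q hq1 hq2 hq3 hq4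
  refine ⟨⟨s, hs, hq4 s ⟨le_rfl, le_rfl⟩, fun t ht => ?_⟩, hq2⟩
  rcases le_total δ t with htδ | htδ
  · exact hq3 t ⟨htδ, ht.2⟩
  · have hprof := isProfile_sol k q
    have hmono : StrictMonoOn (θSol k q) (Icc 0 δ) := by
      refine strictMonoOn_of_deriv_pos (convex_Icc 0 δ) hprof.continuous_θ.continuousOn
        fun u hu => ?_
      rw [interior_Icc] at hu
      rw [(hprof.hasDerivAt_θ u).deriv]
      have := hPQ hq1 (hball (y := u) (by
        rw [Real.dist_eq, sub_zero, abs_of_pos hu.1]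
        have := min_le_left (ε / 2) s
        linarith [hu.2]))
      simpa [profileAccel, abs_of_pos hu.1] using this
    have := hmono ⟨le_rfl, hδ0.le⟩ ⟨ht.1.le, htδ⟩ ht.1
    simpa using this

end Profile

/-! ### Profile curves whose angle stays in (0, π/2): signs and asymptotics. -/

section Profile

open Real

theorem antitoneOn_of_hasDerivAt_nonpos {f f' : ℝ → ℝ} {s : Set ℝ} (hs : Convex ℝ s)
    (hf : ∀ t ∈ s, HasDerivAt f (f' t) t) (hf' : ∀ t ∈ interior s, f' t ≤ 0) : AntitoneOn f s :=
  antitoneOn_of_deriv_nonpos hs (fun t ht => (hf t ht).continuousAt.continuousWithinAt)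
    (fun t ht => (hf t (interior_subset ht)).differentiableAt.differentiableWithinAt)
    (fun t ht => by rw [(hf t (interior_subset ht)).deriv]; exact hf' t ht)

theorem monotoneOn_of_hasDerivAt_nonneg {f f' : ℝ → ℝ} {s : Set ℝ} (hs : Convex ℝ s)
    (hf : ∀ t ∈ s, HasDerivAt f (f' t) t) (hf' : ∀ t ∈ interior s, 0 ≤ f' t) : MonotoneOn f s :=
  monotoneOn_of_deriv_nonneg hs (fun t ht => (hf t ht).continuousAt.continuousWithinAt)
    (fun t ht => (hf t (interior_subset ht)).differentiableAt.differentiableWithinAt)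
    (fun t ht => by rw [(hf t (interior_subset ht)).deriv]; exact hf' t ht)

theorem add_mul_le_of_le_hasDerivAt {f f' : ℝ → ℝ} {a c : ℝ}
    (hf : ∀ t, a ≤ t → HasDerivAt f (f' t) t) (hc : ∀ t, a ≤ t → c ≤ f' t) {s : ℝ} (hs : a ≤ s) :
    f a + c * (s - a) ≤ f s := by
  have := monotoneOn_of_hasDerivAt_nonneg (f := fun t => f t - c * t) (f' := fun t => f' t - c)
    (convex_Ici a) (fun t ht => by
      simpa using (hf t ht).fun_sub ((hasDerivAt_id t).const_mul c))
    (fun t ht => sub_nonneg.2 (hc t (interior_subset ht))) self_mem_Ici hs hs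
  simp only at this
  linarith

theorem pow_mul_gauss_le (m : ℕ) {x r : ℝ} (hr : 0 ≤ r) :
    r ^ m * exp (-(x ^ 2 + r ^ 2) / 2) ≤ m.factorial * exp (1 / 2) := by
  have h1 : r ^ m ≤ m.factorial * exp r := by
    have := pow_div_factorial_le_exp r hr m
    rwa [div_le_iff₀' (by positivity)] at this
  calc _ ≤ m.factorial * exp r * exp (-(x ^ 2 + r ^ 2) / 2) := by gcongr
    _ = m.factorial * exp (r + -(x ^ 2 + r ^ 2) / 2) := by rw [mul_assoc, ← exp_add]
    _ ≤ _ := by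
      gcongr
      nlinarith [sq_nonneg (r - 1), sq_nonneg x]

namespace IsProfile

variable {k : ℕ} {lam : ℝ} {x r θ : ℝ → ℝ}

theorem θ_mem_Icc (h : IsProfile k lam x r θ) {T : ℝ}
    (hin : ∀ s ∈ Ioo 0 T, θ s ∈ Ioo 0 (π / 2)) {s : ℝ} (hT : 0 < T) (hs : s ∈ Icc 0 T) :
    θ s ∈ Icc 0 (π / 2) := by
  have hc : s ∈ closure (Ioo 0 T) := by rwa [closure_Ioo hT.ne]
  have := map_mem_closure h.continuous_θ hc hin
  rwa [closure_Ioo (by positivity)] at this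

/-- Signs of the quantities attached to an increasing piece of the profile curve. -/
theorem signs (h : IsProfile k lam x r θ) (h0 : StartsAtNeck x r θ) {T : ℝ}
    (hin : ∀ s ∈ Ioo 0 T, θ s ∈ Ioo 0 (π / 2)) {s : ℝ} (hT : 0 < T) (hs : s ∈ Icc 0 T) :
    1 / 2 ≤ r s ∧ 0 ≤ x s ∧ 0 ≤ sin (θ s) ∧ 0 ≤ cos (θ s) ∧ 0 ≤ radialSpeed x r θ s := by
  have h1 := h.r_ge h0 hin hs
  have h2 := h.x_nonneg h0 hin hs
  have hm := h.θ_mem_Icc hin hT hs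
  have h3 : 0 ≤ sin (θ s) := sin_nonneg_of_mem_Icc ⟨hm.1, by linarith [hm.2, pi_pos]⟩
  have h4 : 0 ≤ cos (θ s) := cos_nonneg_of_mem_Icc ⟨by linarith [hm.1, pi_pos], hm.2⟩
  refine ⟨h1, h2, h3, h4, ?_⟩
  unfold radialSpeed
  have : 0 ≤ r s := by linarith
  positivity

theorem antitoneOn_H_mul_weight (h : IsProfile k lam x r θ) (h0 : StartsAtNeck x r θ) {T : ℝ}
    (hin : ∀ s ∈ Ioo 0 T, θ s ∈ Ioo 0 (π / 2)) (hT : 0 < T) :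
    AntitoneOn (fun s => profileH lam x r θ s * gaussWeight x r s) (Icc 0 T) := by
  refine antitoneOn_of_hasDerivAt_nonpos (convex_Icc 0 T)
    (fun s hs => h.hasDerivAt_H_mul_weight (by linarith [(h.signs h0 hin hT hs).1])) fun s hs => ?_
  obtain ⟨h1, -, -, h4, h5⟩ := h.signs h0 hin hT (interior_subset hs)
  have h6 := gaussWeight_pos x r s
  have : 0 ≤ (r s)⁻¹ := inv_nonneg.2 (by linarith)
  rw [neg_nonpos]
  positivity


theorem signs_of_complete (h : IsProfile k lam x r θ)
    (h0 : StartsAtNeck x r θ) (hin : ∀ s, 0 < s → θ s ∈ Ioo 0 (π / 2)) {s : ℝ} (hs : 0 ≤ s) :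
    1 / 2 ≤ r s ∧ 0 ≤ x s ∧ 0 ≤ sin (θ s) ∧ 0 ≤ cos (θ s) ∧ 0 ≤ radialSpeed x r θ s :=
  h.signs h0 (T := s + 1) (fun t ht => hin t ht.1) (by linarith) ⟨hs, by linarith⟩

/-- If H = -δ < 0 at one time, then H ≤ -δ from then on, because H times the weight decreases and
the weight itself decreases. Then θ' = k cos θ / r - H ≥ δ, and θ gains π within time π/δ, which is
impossible. -/
theorem H_nonneg_of_complete (h : IsProfile k lam x r θ)
    (h0 : StartsAtNeck x r θ) (hin : ∀ s, 0 < s → θ s ∈ Ioo 0 (π / 2)) {s₁ : ℝ} (hs₁ : 0 ≤ s₁) :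
    0 ≤ profileH lam x r θ s₁ := by
  by_contra hneg
  rw [not_le] at hneg
  set δ := -profileH lam x r θ s₁ with hδ
  have hδ0 : 0 < δ := by linarith
  have hW : AntitoneOn (gaussWeight x r) (Ici 0) :=
    antitoneOn_of_hasDerivAt_nonpos (convex_Ici 0) (fun s _ => h.hasDerivAt_gaussWeight s)
      fun s hs => by
        have := (h.signs_of_complete h0 hin (s := s) (interior_subset hs)).2.2.2.2
        have h6 := gaussWeight_pos x r s
        rw [neg_mul, neg_nonpos]; positivity
  have hH : ∀ s, s₁ ≤ s → profileH lam x r θ s ≤ -δ := by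
    intro s hs
    have h1 := h.antitoneOn_H_mul_weight h0 (T := s + 1) (fun t ht => hin t ht.1) (by linarith)
      (a := s₁) ⟨hs₁, by linarith⟩ (b := s) ⟨by linarith, by linarith⟩ hs
    have h2 := hW (a := s₁) hs₁ (b := s) (mem_Ici.2 (by linarith)) hs
    have h3 := gaussWeight_pos x r s
    simp only at h1
    by_contra hc
    rw [not_le] at hc
    nlinarith
  have hs : s₁ ≤ s₁ + π / δ := by have := pi_pos; linarith [div_pos this hδ0]
  have := add_mul_le_of_le_hasDerivAt (f := θ) (a := s₁) (c := δ)
    (fun t ht => h.hasDerivAt_θ' (by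
      linarith [(h.signs_of_complete h0 hin (hs₁.trans ht)).1])) (fun t ht => by
      obtain ⟨h1, -, -, h4, -⟩ := h.signs_of_complete h0 hin (hs₁.trans ht)
      have h5 : 0 ≤ (r t)⁻¹ := inv_nonneg.2 (by linarith)
      have h6 : 0 ≤ k * (cos (θ t) * (r t)⁻¹) := by positivity
      rw [profileCurv_eq]
      linarith [hH t ht]) hs
  rw [add_sub_cancel_left, mul_div_cancel₀ _ hδ0.ne'] at this
  have h1 : 0 ≤ θ s₁ := by
    rcases hs₁.eq_or_lt with rfl | h'
    · exact h0.θ_zero.ge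
    · exact (hin s₁ h').1.le
  have h2 := (hin (s₁ + π / δ) (by have := div_pos pi_pos hδ0; linarith)).2
  linarith [pi_pos]

/-- As H ≥ 0, the weighted curvature decreases and stays below a negative constant once negative.
The factor r^(k+1) times the weight is bounded, so θ' itself is bounded above by a negative constant
and θ loses π in finite time. -/
theorem curv_nonneg_of_complete (h : IsProfile k lam x r θ)
    (h0 : StartsAtNeck x r θ) (hin : ∀ s, 0 < s → θ s ∈ Ioo 0 (π / 2)) {s₁ : ℝ} (hs₁ : 0 ≤ s₁) :
    0 ≤ profileCurv k lam x r θ s₁ := by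
  have hanti : AntitoneOn (fun s => r s ^ (k + 1) * gaussWeight x r s * profileCurv k lam x r θ s)
      (Ici 0) := by
    refine antitoneOn_of_hasDerivAt_nonpos (convex_Ici 0) (fun s hs => h.hasDerivAt_weighted_curv
      (by linarith [(h.signs_of_complete h0 hin (s := s) hs).1])) fun s hs => ?_
    have hs : 0 ≤ s := interior_subset hs
    obtain ⟨h1, -, h3, -, -⟩ := h.signs_of_complete h0 hin hs
    have h6 := gaussWeight_pos x r s
    have h7 := h.H_nonneg_of_complete h0 hin hs
    have h8 : 0 ≤ r s := by linarith
    rw [neg_nonpos]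
    positivity
  by_contra hneg
  rw [not_le] at hneg
  set C : ℝ := (k + 1).factorial * exp (1 / 2) with hC
  have hC0 : 0 < C := by positivity
  obtain ⟨hr1, -⟩ := h.signs_of_complete h0 hin hs₁
  set d := -(r s₁ ^ (k + 1) * gaussWeight x r s₁ * profileCurv k lam x r θ s₁) with hd
  have hd0 : 0 < d := by
    have : 0 < r s₁ ^ (k + 1) * gaussWeight x r s₁ :=
      mul_pos (pow_pos (by linarith) _) (gaussWeight_pos x r s₁)
    rw [hd, neg_pos]
    exact mul_neg_of_pos_of_neg this hneg
  have hle : ∀ t, s₁ ≤ t → d / C ≤ -profileCurv k lam x r θ t := by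
    intro t ht
    have ht0 : 0 ≤ t := hs₁.trans ht
    have h1 := hanti (a := s₁) hs₁ (b := t) ht0 ht
    simp only at h1
    have hrt := (h.signs_of_complete h0 hin ht0).1
    have h2 : r t ^ (k + 1) * gaussWeight x r t ≤ C := pow_mul_gauss_le (k + 1) (by linarith)
    have h3 : 0 < r t ^ (k + 1) * gaussWeight x r t :=
      mul_pos (pow_pos (by linarith) _) (gaussWeight_pos x r t)
    rw [div_le_iff₀ hC0]
    by_contra hc
    rw [not_le] at hc
    have h4 : 0 < -profileCurv k lam x r θ t := by
      by_contra h5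
      have : 0 ≤ r t ^ (k + 1) * gaussWeight x r t * profileCurv k lam x r θ t :=
        mul_nonneg h3.le (by linarith)
      linarith
    nlinarith
  have := add_mul_le_of_le_hasDerivAt (f := fun s => -θ s) (a := s₁) (c := d / C)
    (fun t ht => (h.hasDerivAt_θ' (by
      linarith [(h.signs_of_complete h0 hin (hs₁.trans ht)).1])).fun_neg) hle
    (s := s₁ + π / (d / C)) (by have := div_pos pi_pos (div_pos hd0 hC0); linarith)
  rw [add_sub_cancel_left, mul_div_cancel₀ _ (div_pos hd0 hC0).ne'] at this
  have h1 : θ s₁ ≤ π / 2 := by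
    rcases hs₁.eq_or_lt with rfl | h'
    · rw [h0.θ_zero]; positivity
    · exact (hin s₁ h').2.le
  have h2 := (hin (s₁ + π / (d / C)) (by have := div_pos pi_pos (div_pos hd0 hC0); linarith)).1
  linarith [pi_pos]

theorem monotoneOn_θ_of_complete (h : IsProfile k lam x r θ)
    (h0 : StartsAtNeck x r θ) (hin : ∀ s, 0 < s → θ s ∈ Ioo 0 (π / 2)) : MonotoneOn θ (Ici 0) :=
  monotoneOn_of_hasDerivAt_nonneg (convex_Ici 0) (fun s hs => h.hasDerivAt_θ' (by
    linarith [(h.signs_of_complete h0 hin (s := s) hs).1]))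
    fun _ hs => h.curv_nonneg_of_complete h0 hin (interior_subset hs)

theorem monotoneOn_sin_of_complete (h : IsProfile k lam x r θ)
    (h0 : StartsAtNeck x r θ) (hin : ∀ s, 0 < s → θ s ∈ Ioo 0 (π / 2)) :
    MonotoneOn (fun s => sin (θ s)) (Ici 0) := by
  have hm : ∀ s, 0 ≤ s → θ s ∈ Icc (-(π / 2)) (π / 2) := fun s hs => by
    rcases hs.eq_or_lt with rfl | h'
    · rw [h0.θ_zero]; constructor <;> linarith [pi_pos]
    · exact ⟨by linarith [(hin s h').1, pi_pos], (hin s h').2.le⟩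
  intro s hs t ht hst
  exact strictMonoOn_sin.monotoneOn (hm s hs) (hm t ht)
    (h.monotoneOn_θ_of_complete h0 hin hs ht hst)

theorem sin_pos_of_complete
    (hin : ∀ s, 0 < s → θ s ∈ Ioo 0 (π / 2)) {s : ℝ} (hs : 0 < s) : 0 < sin (θ s) :=
  sin_pos_of_pos_of_lt_pi (hin s hs).1 (by linarith [(hin s hs).2, pi_pos])

theorem cos_pos_of_complete (h0 : StartsAtNeck x r θ)
    (hin : ∀ s, 0 < s → θ s ∈ Ioo 0 (π / 2)) {s : ℝ} (hs : 0 ≤ s) : 0 < cos (θ s) := by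
  rcases hs.eq_or_lt with rfl | h'
  · rw [h0.θ_zero, cos_zero]; exact one_pos
  · exact cos_pos_of_mem_Ioo ⟨by linarith [(hin s h').1, pi_pos], (hin s h').2⟩

theorem tendsto_r_of_complete (h : IsProfile k lam x r θ)
    (h0 : StartsAtNeck x r θ) (hin : ∀ s, 0 < s → θ s ∈ Ioo 0 (π / 2)) : Tendsto r atTop atTop := by
  have h1 := sin_pos_of_complete hin one_pos
  refine tendsto_atTop_mono' atTop (f₁ := fun s => r 1 + sin (θ 1) * (s - 1)) ?_ ?_
  · filter_upwards [eventually_ge_atTop 1] with s hs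
    exact add_mul_le_of_le_hasDerivAt (fun t _ => h.hasDerivAt_r t) (fun t ht =>
      h.monotoneOn_sin_of_complete h0 hin (mem_Ici.2 zero_le_one)
        (mem_Ici.2 (by linarith)) ht) hs
  · exact tendsto_atTop_add_const_left _ _ ((tendsto_atTop_add_const_right _ (-1)
      tendsto_id).const_mul_atTop h1)

theorem monotoneOn_x_of_complete (h : IsProfile k lam x r θ)
    (h0 : StartsAtNeck x r θ) (hin : ∀ s, 0 < s → θ s ∈ Ioo 0 (π / 2)) : MonotoneOn x (Ici 0) :=
  monotoneOn_of_hasDerivAt_nonneg (convex_Ici 0) (fun s _ => h.hasDerivAt_x s)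
    fun _ hs => (h.signs_of_complete h0 hin (interior_subset hs)).2.2.2.1

/-- Once r > k + 1, the inequality θ' ≥ 0 forces x sin θ - λ to be some δ > 0, and this quantity
does not decrease afterwards. Then H ≥ 0 gives r cos θ ≥ δ. As r grows at most linearly, x' = cos θ
is at least δ / (r 0 + t), whose integral diverges logarithmically. -/
theorem tendsto_x_of_complete (h : IsProfile k lam x r θ)
    (h0 : StartsAtNeck x r θ) (hin : ∀ s, 0 < s → θ s ∈ Ioo 0 (π / 2)) : Tendsto x atTop atTop := by
  obtain ⟨s₁, hs₁, hr₁⟩ := ((eventually_ge_atTop 1).and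
    ((h.tendsto_r_of_complete h0 hin).eventually_gt_atTop (k + 1 : ℝ))).exists
  have hs₁0 : 0 ≤ s₁ := by linarith
  set δ := x s₁ * sin (θ s₁) - lam with hδ
  have hδ0 : 0 < δ := by
    have h1 := h.curv_nonneg_of_complete h0 hin hs₁0
    have h2 := cos_pos_of_complete h0 hin hs₁0
    have hk : (0:ℝ) ≤ k := k.cast_nonneg
    have h3 : k * (r s₁)⁻¹ < r s₁ := by
      rw [← div_eq_mul_inv, div_lt_iff₀ (by linarith)]
      nlinarith
    unfold profileCurv at h1
    nlinarith
  have hx : ∀ t, s₁ ≤ t → δ / (r 0 + t) ≤ cos (θ t) := by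
    intro t ht
    have ht0 : 0 ≤ t := by linarith
    have h1 := h.H_nonneg_of_complete h0 hin ht0
    have h2 := h.monotoneOn_x_of_complete h0 hin (mem_Ici.2 hs₁0) (mem_Ici.2 ht0) ht
    have h3 := h.monotoneOn_sin_of_complete h0 hin (mem_Ici.2 hs₁0) (mem_Ici.2 ht0) ht
    obtain ⟨hr, hx0, hs0, hc0, -⟩ := h.signs_of_complete h0 hin ht0
    obtain ⟨-, hx0', hs0', -⟩ := h.signs_of_complete h0 hin hs₁0
    have h4 : x s₁ * sin (θ s₁) ≤ x t * sin (θ t) := mul_le_mul h2 h3 hs0' hx0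
    have h5 : r t ≤ r 0 + t := by
      have := add_mul_le_of_le_hasDerivAt (f := fun s => -r s) (a := 0) (c := -1)
        (fun t _ => (h.hasDerivAt_r t).fun_neg) (fun t _ => neg_le_neg (sin_le_one _)) ht0
      linarith
    have h6 : r t * cos (θ t) ≤ (r 0 + t) * cos (θ t) := by gcongr
    rw [div_le_iff₀ (by linarith [h0.r_zero])]
    unfold profileH at h1
    linarith
  have hlog : ∀ t, s₁ ≤ t → HasDerivAt (fun t => x t - δ * log (r 0 + t))
      (cos (θ t) - δ / (r 0 + t)) t := by
    intro t ht
    have hne : r 0 + t ≠ 0 := by linarith [h0.r_zero]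
    refine ((h.hasDerivAt_x t).sub ((((hasDerivAt_id t).const_add (r 0)).log hne).const_mul
      δ)).congr_deriv ?_
    simp [div_eq_mul_inv]
  refine tendsto_atTop_mono' atTop (f₁ := fun t => (x s₁ - δ * log (r 0 + s₁)) +
    δ * log (r 0 + t)) ?_ ?_
  · filter_upwards [eventually_ge_atTop s₁] with t ht
    have := add_mul_le_of_le_hasDerivAt (c := 0) hlog (fun t ht => sub_nonneg.2 (hx t ht)) ht
    linarith
  · exact tendsto_atTop_add_const_left _ _ ((tendsto_log_atTop.comp
      (tendsto_atTop_add_const_left _ _ tendsto_id)).const_mul_atTop hδ0)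

end IsProfile

end Profile

/-! ### The case λ = 0 with r₀ = 1/2: pinching drives the angle past π/2. -/

section Profile

open Real

namespace IsProfile

variable {k : ℕ} {lam : ℝ} {x r θ : ℝ → ℝ}

/-- The numerator of the derivative of the quotient of the rotational principal curvature and the
mean curvature. -/
def pinching (k : ℕ) (lam : ℝ) (x r θ : ℝ → ℝ) (s : ℝ) : ℝ :=
  -(sin (θ s) * (r s)⁻¹) * (profileCurv k lam x r θ s + cos (θ s) * (r s)⁻¹) *
    profileH lam x r θ s + cos (θ s) * (r s)⁻¹ * (profileCurv k lam x r θ s * radialSpeed x r θ s)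

theorem hasDerivAt_radialSpeed (h : IsProfile k lam x r θ) {s : ℝ} (hr : 1 / 4 ≤ r s) :
    HasDerivAt (radialSpeed x r θ)
      (1 + profileCurv k lam x r θ s * (r s * cos (θ s) - x s * sin (θ s))) s := by
  refine (((h.hasDerivAt_r s).mul (h.hasDerivAt_θ' hr).sin).add
    ((h.hasDerivAt_x s).mul (h.hasDerivAt_θ' hr).cos)).congr_deriv ?_
  linear_combination sin_sq_add_cos_sq (θ s)

/-- The weight r^k exp(-|X|²/2) is the integrating factor of the equation for `pinching`. What
remains is nonnegative when H, θ' and cos θ are. -/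
theorem hasDerivAt_weighted_pinching (h : IsProfile k 0 x r θ) {s : ℝ} (hr : 1 / 4 ≤ r s) :
    HasDerivAt (fun s => r s ^ k * gaussWeight x r s * pinching k 0 x r θ s)
      (2 * (r s ^ k * gaussWeight x r s) * profileH 0 x r θ s * (sin (θ s) * (r s)⁻¹) ^ 2 *
        (profileCurv k 0 x r θ s + cos (θ s) * (r s)⁻¹)) s := by
  have hr0 : r s ≠ 0 := by linarith
  have hk2 := h.hasDerivAt_curvTwo hr
  have hsr : HasDerivAt (fun s => sin (θ s) * (r s)⁻¹)
      (cos (θ s) * profileCurv k 0 x r θ s * (r s)⁻¹ + sin (θ s) * (-sin (θ s) / (r s) ^ 2)) s :=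
    (h.hasDerivAt_θ' hr).sin.mul ((h.hasDerivAt_r s).inv hr0)
  have hG := ((hsr.fun_neg.mul ((h.hasDerivAt_curv hr).add hk2)).mul (h.hasDerivAt_H hr)).add
    (hk2.mul ((h.hasDerivAt_curv hr).mul (h.hasDerivAt_radialSpeed hr)))
  refine ((((h.hasDerivAt_r s).pow k).mul (h.hasDerivAt_gaussWeight s)).mul hG).congr_deriv ?_
  simp only [Pi.mul_apply, Pi.pow_apply, Pi.add_apply]
  have hrk : (k : ℝ) * r s ^ (k - 1) = k * (r s ^ k * (r s)⁻¹) := by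
    rcases k with _ | k
    · simp
    · simp only [add_tsub_cancel_right, pow_succ]; field_simp
  have e : profileCurv k 0 x r θ s = k * (cos (θ s) * (r s)⁻¹) - profileH 0 x r θ s :=
    profileCurv_eq ..
  have e2 : r s * cos (θ s) - x s * sin (θ s) = profileH 0 x r θ s := by
    unfold profileH; ring
  -- Expresses cos² + sin² = 1 through H and the radial speed. This uses λ = 0, and it cancels the
  -- constant term in the derivative of the radial speed.
  have h1 : 1 = cos (θ s) * (r s)⁻¹ * profileH 0 x r θ s +
      sin (θ s) * (r s)⁻¹ * radialSpeed x r θ s := by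
    unfold profileH radialSpeed
    field_simp
    linear_combination -(r s) * sin_sq_add_cos_sq (θ s)
  simp only [hrk, e2, e, div_eq_mul_inv, ← inv_pow]
  linear_combination (r s ^ k * gaussWeight x r s) * (cos (θ s) * (r s)⁻¹) *
    (k * (cos (θ s) * (r s)⁻¹) - profileH 0 x r θ s) * h1

/-- `pinching` vanishes at the neck and its weighted version increases, so it is nonnegative and the
quotient of cos θ / r by H is nondecreasing. That quotient starts at 2 / (1/2) = 4. -/
theorem curvTwo_ge (h : IsProfile k 0 x r θ) (h0 : StartsAtNeck x r θ) (hr0 : r 0 = 1 / 2) {T : ℝ}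
    (hT : 0 < T) (hin : ∀ s ∈ Ioo 0 T, θ s ∈ Ioo 0 (π / 2))
    (hH : ∀ s ∈ Icc 0 T, 0 < profileH 0 x r θ s)
    (hK : ∀ s ∈ Ioo 0 T, 0 ≤ profileCurv k 0 x r θ s) :
    4 * profileH 0 x r θ T ≤ cos (θ T) * (r T)⁻¹ := by
  have hP : MonotoneOn (fun s => r s ^ k * gaussWeight x r s * pinching k 0 x r θ s) (Icc 0 T) := by
    refine monotoneOn_of_hasDerivAt_nonneg (convex_Icc 0 T) (fun s hs =>
      h.hasDerivAt_weighted_pinching (by linarith [(h.signs h0 hin hT hs).1])) fun s hs => ?_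
    have hs' := interior_subset hs
    rw [interior_Icc] at hs
    obtain ⟨h1, -, h3, h4, -⟩ := h.signs h0 hin hT hs'
    have h5 := hH s hs'
    have h6 := hK s hs
    have h7 := gaussWeight_pos x r s
    have h8 : 0 < r s := by linarith
    positivity
  have hP0 : ∀ s ∈ Icc 0 T, 0 ≤ pinching k 0 x r θ s := by
    intro s hs
    have h1 := hP ⟨le_rfl, hT.le⟩ hs hs.1
    have h2 : pinching k 0 x r θ 0 = 0 := by
      simp [pinching, radialSpeed, h0.θ_zero, h0.x_zero]
    simp only [h2, mul_zero] at h1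
    have h3 : 0 < r s ^ k * gaussWeight x r s :=
      mul_pos (pow_pos (by linarith [(h.signs h0 hin hT hs).1]) _) (gaussWeight_pos x r s)
    exact nonneg_of_mul_nonneg_right h1 h3
  have hQ : MonotoneOn (fun s => cos (θ s) * (r s)⁻¹ / profileH 0 x r θ s) (Icc 0 T) := by
    refine monotoneOn_of_hasDerivAt_nonneg (convex_Icc 0 T) (fun s hs => by
      have hr : 1 / 4 ≤ r s := by linarith [(h.signs h0 hin hT hs).1]
      exact (h.hasDerivAt_curvTwo hr).div (h.hasDerivAt_H hr) (hH s hs).ne') fun s hs => ?_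
    have h1 := hP0 s (interior_subset hs)
    refine div_nonneg ?_ (sq_nonneg _)
    unfold pinching at h1
    linarith
  have h1 := hQ ⟨le_rfl, hT.le⟩ ⟨hT.le, le_rfl⟩ hT.le
  simp only at h1
  rw [le_div_iff₀ (hH T ⟨hT.le, le_rfl⟩)] at h1
  have h2 : cos (θ 0) * (r 0)⁻¹ / profileH 0 x r θ 0 = 4 := by
    rw [profileH, h0.θ_zero, h0.x_zero, hr0]; norm_num
  rwa [h2] at h1

theorem curvTwo_ge_of_H_pos (h : IsProfile k 0 x r θ) (h0 : StartsAtNeck x r θ)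
    (hr0 : r 0 = 1 / 2) {T : ℝ}
    (hT : 0 < T) (hin : ∀ s ∈ Ioo 0 T, θ s ∈ Ioo 0 (π / 2))
    (hH : 0 < profileH 0 x r θ T) (hK : ∀ s ∈ Ioo 0 T, 0 ≤ profileCurv k 0 x r θ s) :
    4 * profileH 0 x r θ T ≤ cos (θ T) * (r T)⁻¹ := by
  refine h.curvTwo_ge h0 hr0 hT hin (fun s hs => ?_) hK
  have h1 := h.antitoneOn_H_mul_weight h0 hin hT hs ⟨hT.le, le_rfl⟩ hs.2
  exact pos_of_mul_pos_left ((mul_pos hH (gaussWeight_pos x r T)).trans_le h1)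
    (gaussWeight_pos x r s).le

/-- At a first time with θ' ≤ 0 one would have H ≥ k cos θ / r > 0. The pinching applies up to that
time and gives H ≤ (cos θ / r) / 4, contradicting k ≥ 1. -/
theorem curv_pos_of_lam_zero (h : IsProfile k 0 x r θ) (h0 : StartsAtNeck x r θ) (hk : 1 ≤ k)
    (hr0 : r 0 = 1 / 2) {T : ℝ} (hT : 0 < T) (hin : ∀ s ∈ Ioo 0 T, θ s ∈ Ioo 0 (π / 2))
    (hT' : θ T < π / 2) : ∀ s ∈ Icc 0 T, 0 < profileCurv k 0 x r θ s := by
  have hk1 : (1:ℝ) ≤ k := by exact_mod_cast hk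
  have hpos0 : 0 < profileCurv k 0 x r θ 0 := by
    rw [curv_zero h0, hr0]; norm_num; linarith
  by_contra! hc
  obtain ⟨s', hs', hs'K⟩ := hc
  have hcont : ContinuousOn (profileCurv k 0 x r θ) (Icc 0 T) := fun s hs =>
    (h.hasDerivAt_curv (by linarith [(h.signs h0 hin hT hs).1])).continuousAt.continuousWithinAt
  have hcomp : IsCompact (Icc 0 T ∩ profileCurv k 0 x r θ ⁻¹' Iic 0) :=
    isCompact_Icc.of_isClosed_subset (hcont.preimage_isClosed_of_isClosed isClosed_Icc isClosed_Iic)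
      inter_subset_left
  obtain ⟨s₁, ⟨hs₁, hs₁K⟩, hleast⟩ := hcomp.exists_isLeast ⟨s', hs', hs'K⟩
  have hs₁K : profileCurv k 0 x r θ s₁ ≤ 0 := hs₁K
  have hs₁0 : 0 < s₁ := hs₁.1.lt_of_ne (by rintro rfl; linarith)
  have hin₁ : ∀ s ∈ Ioo 0 s₁, θ s ∈ Ioo 0 (π / 2) := fun s hs => hin s ⟨hs.1, hs.2.trans_le hs₁.2⟩
  have hK : ∀ s ∈ Ioo 0 s₁, 0 ≤ profileCurv k 0 x r θ s := by
    intro s hs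
    by_contra hneg
    exact absurd (hleast ⟨⟨hs.1.le, hs.2.le.trans hs₁.2⟩, (not_le.1 hneg).le⟩) (not_le.2 hs.2)
  have hm := h.θ_mem_Icc hin hT hs₁
  have hlt : θ s₁ < π / 2 := by
    rcases hs₁.2.eq_or_lt with rfl | h'
    · exact hT'
    · exact (hin s₁ ⟨hs₁0, h'⟩).2
  have hc0 : 0 < cos (θ s₁) := cos_pos_of_mem_Ioo ⟨by linarith [hm.1, pi_pos], hlt⟩
  have hr1 := (h.signs h0 hin hT hs₁).1
  have hq : 0 < cos (θ s₁) * (r s₁)⁻¹ := mul_pos hc0 (inv_pos.2 (by linarith))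
  have e := profileCurv_eq k 0 x r θ s₁
  have hH : 0 < profileH 0 x r θ s₁ := by nlinarith
  have := h.curvTwo_ge_of_H_pos h0 hr0 hs₁0 hin₁ hH hK
  nlinarith

/-- Pinching gives θ' ≥ (3/4) cos θ / r, and the radial speed is at least r sin(θ 1) after time 1.
Hence H' ≤ -c cos θ = -c x', so H + c x does not increase. This is incompatible with H ≥ 0 and x →
∞. -/
theorem not_complete_of_lam_zero (h : IsProfile k 0 x r θ) (h0 : StartsAtNeck x r θ) (hk : 1 ≤ k)
    (hr0 : r 0 = 1 / 2) : ¬ ∀ s, 0 < s → θ s ∈ Ioo 0 (π / 2) := by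
  intro hin
  have hk1 : (1:ℝ) ≤ k := by exact_mod_cast hk
  set c := 3 / 4 * sin (θ 1) with hc
  have hc0 : 0 < c := mul_pos (by norm_num) (sin_pos_of_complete hin one_pos)
  have hq : ∀ s, 0 < s → 4 * profileH 0 x r θ s ≤ cos (θ s) * (r s)⁻¹ := by
    intro s hs
    have hq0 : 0 ≤ cos (θ s) * (r s)⁻¹ := by
      obtain ⟨h1, -, -, h4, -⟩ := h.signs_of_complete h0 hin hs.le
      exact mul_nonneg h4 (inv_nonneg.2 (by linarith))
    rcases le_or_gt (profileH 0 x r θ s) 0 with h' | h'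
    · linarith
    · exact h.curvTwo_ge_of_H_pos h0 hr0 hs (fun t ht => hin t ht.1) h'
        fun t ht => h.curv_nonneg_of_complete h0 hin ht.1.le
  have hanti : AntitoneOn (fun s => profileH 0 x r θ s + c * x s) (Ici 1) := by
    refine antitoneOn_of_hasDerivAt_nonpos (convex_Ici 1) (fun s hs =>
      (h.hasDerivAt_H ?_).add ((h.hasDerivAt_x s).const_mul c)) fun s hs => ?_
    · have hs : (1:ℝ) ≤ s := hs
      linarith [(h.signs_of_complete h0 hin (s := s) (by linarith)).1]
    · have hs : (1:ℝ) ≤ s := interior_subset hs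
      obtain ⟨h1, h2, h3, h4, h5⟩ := h.signs_of_complete h0 hin (s := s) (by linarith)
      have h6 := hq s (by linarith)
      have hr : 0 < r s := by linarith
      have h7 : 3 / 4 * (cos (θ s) * (r s)⁻¹) ≤ profileCurv k 0 x r θ s := by
        rw [profileCurv_eq]
        have : 0 ≤ cos (θ s) * (r s)⁻¹ := by positivity
        nlinarith
      have h8 : r s * sin (θ 1) ≤ radialSpeed x r θ s := by
        have := h.monotoneOn_sin_of_complete h0 hin (mem_Ici.2 zero_le_one)
          (mem_Ici.2 (show (0:ℝ) ≤ s by linarith)) hs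
        have h9 : r s * sin (θ 1) ≤ r s * sin (θ s) := by gcongr
        unfold radialSpeed
        nlinarith [mul_nonneg h2 h4]
      have h9 : 3 / 4 * (cos (θ s) * (r s)⁻¹) * (r s * sin (θ 1)) ≤
          profileCurv k 0 x r θ s * radialSpeed x r θ s := by
        have := (sin_pos_of_complete hin one_pos).le
        have h10 : 0 ≤ 3 / 4 * (cos (θ s) * (r s)⁻¹) := by positivity
        exact mul_le_mul h7 h8 (by positivity) (h10.trans h7)
      have h10 : 3 / 4 * (cos (θ s) * (r s)⁻¹) * (r s * sin (θ 1)) = c * cos (θ s) := by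
        rw [hc]; field_simp
      linarith
  obtain ⟨s, hs1, hs2⟩ := ((eventually_ge_atTop 1).and
    ((h.tendsto_x_of_complete h0 hin).eventually_gt_atTop
      ((profileH 0 x r θ 1 + c * x 1) / c))).exists
  have h1 := hanti self_mem_Ici hs1 hs1
  have h2 := h.H_nonneg_of_complete h0 hin (s₁ := s) (by linarith)
  rw [div_lt_iff₀ hc0] at hs2
  simp only at h1
  linarith

end IsProfile

theorem half_zero_mem_risingSet {k : ℕ} (hk : 1 ≤ k) : ((1 / 2, 0) : ℝ × ℝ) ∈ risingSet k := by
  have hk1 : (1:ℝ) ≤ k := by exact_mod_cast hk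
  have h := isProfile_sol k (1 / 2, 0)
  have h0 : StartsAtNeck (xSol k (1 / 2, 0)) (rSol k (1 / 2, 0)) (θSol k (1 / 2, 0)) :=
    ⟨by simp, by simp, by simp⟩
  have hout := h.not_complete_of_lam_zero h0 hk (by simp)
  push Not at hout
  obtain ⟨s, hs, hs'⟩ := hout
  obtain ⟨τ, hτ, -, hin, hex⟩ := h.exists_exit h0 (by norm_num; linarith) hs hs'
  rcases hex with hex | hex
  · exfalso
    have hpos := h.curv_pos_of_lam_zero h0 hk (by simp) hτ hin (by rw [hex]; positivity)
    have := monotoneOn_of_hasDerivAt_nonneg (convex_Icc 0 τ) (fun s hs => h.hasDerivAt_θ' (by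
      linarith [(h.signs h0 hin hτ hs).1])) (fun s hs => (hpos s (interior_subset hs)).le)
      (a := τ / 2) ⟨by linarith, by linarith⟩ (b := τ) ⟨hτ.le, le_rfl⟩ (by linarith)
    linarith [(hin (τ / 2) ⟨by linarith, by linarith⟩).1]
  · exact h.exists_gt_of_exit_pi_div_two h0 hτ hin hex

end Profile

/-! ### Sturm comparison near the cylinder, and the shooting argument. -/

section Profile

open Real

theorem one_sub_sq_mul_le_sin_mul_cos {t : ℝ} (h0 : 0 ≤ t) (h1 : t ≤ 1) :
    (1 - t ^ 2) * t ≤ sin t * cos t := by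
  have hs : t - t ^ 3 / 4 ≤ sin t := by
    rcases h0.eq_or_lt with rfl | h
    · simp
    · have := sin_gt_sub_cube h
      have := pow_pos h 3
      linarith
  have hc := one_sub_sq_div_two_le_cos (x := t)
  have h2 : 0 ≤ 1 - t ^ 2 / 2 := by nlinarith
  have h3 : 0 ≤ t - t ^ 3 / 4 := by nlinarith [pow_nonneg h0 2, mul_nonneg h0 (pow_nonneg h0 2)]
  calc (1 - t ^ 2) * t ≤ (t - t ^ 3 / 4) * (1 - t ^ 2 / 2) := by
        nlinarith [pow_nonneg h0 3, pow_nonneg h0 5]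
    _ ≤ _ := mul_le_mul hs hc h2 (h3.trans hs)

namespace IsProfile

variable {k : ℕ} {lam : ℝ} {x r θ : ℝ → ℝ}

/-- Sturm comparison with `s - δ s³`: a profile curve close to a cylinder has a horizontal tangent
at some positive time. -/
theorem exists_θ_nonpos (h : IsProfile k lam x r θ) (h0 : StartsAtNeck x r θ) {b δ X ε : ℝ}
    (hb : b = 1 + 12 * δ) (hδ : 0 < δ) (hb3 : b ≤ 3) (hX : 0 < X) (hXδ : δ * X ^ 2 = 1)
    (hε : 0 < ε) (hε1 : ε ≤ 1) {R : ℝ} (hR : ε * (R + 3 + 2 * k) ≤ 3 * δ)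
    (hr : ∀ s ∈ Icc 0 X, 1 / 2 ≤ r s ∧ r s ≤ R) (hrb : ∀ s ∈ Icc 0 X,
      b ≤ k * ((r s)⁻¹) ^ 2 * (1 - ε ^ 2))
    (hθ : ∀ s ∈ Icc 0 X, θ s ≤ ε)
    (hK : ∀ s ∈ Icc 0 X, profileCurv k lam x r θ s ≤ ε) : ∃ s ∈ Ioc 0 X, θ s ≤ 0 := by
  by_contra! hpos
  have hpos' : ∀ s ∈ Icc 0 X, 0 ≤ θ s := fun s hs => by
    rcases hs.1.eq_or_lt with rfl | h'
    · exact h0.θ_zero.ge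
    · exact (hpos s ⟨h', hs.2⟩).le
  have hk0 : (0:ℝ) ≤ k := k.cast_nonneg
  -- The angle satisfies θ'' = a θ' - k r⁻² sin θ cos θ. Near the cylinder `a` is close to s,
  -- because the radial speed is close to x and x is close to s.
  set a : ℝ → ℝ := fun s => radialSpeed x r θ s - k * (sin (θ s) * (r s)⁻¹) with ha
  have hR0 : 0 ≤ R := by linarith [hr 0 ⟨le_rfl, hX.le⟩]
  have hθs : ∀ s ∈ Icc 0 X, θ s ≤ ε * s := by
    intro s hs
    have := antitoneOn_of_hasDerivAt_nonpos (f := fun t => θ t - ε * t) (convex_Icc 0 X)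
      (fun t ht => (h.hasDerivAt_θ' (by linarith [(hr t ht).1])).fun_sub
        ((hasDerivAt_id t).const_mul ε)) (fun t ht => by
          have := hK t (interior_subset ht); simpa using this) ⟨le_rfl, hX.le⟩ hs hs.1
    simp only [h0.θ_zero] at this
    linarith
  have hcos : ∀ s ∈ Icc 0 X, 1 - ε ≤ cos (θ s) := by
    intro s hs
    have h1 := one_sub_sq_div_two_le_cos (x := θ s)
    have h2 := hpos' s hs
    have h3 := hθ s hs
    nlinarith
  have hxs : ∀ s ∈ Icc 0 X, (1 - ε) * s ≤ x s ∧ x s ≤ s := by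
    intro s hs
    have h1 := antitoneOn_of_hasDerivAt_nonpos (f := fun t => (1 - ε) * t - x t) (convex_Icc 0 X)
      (fun t _ => ((hasDerivAt_id t).const_mul (1 - ε)).fun_sub (h.hasDerivAt_x t)) (fun t ht => by
          have := hcos t (interior_subset ht); simpa using this) ⟨le_rfl, hX.le⟩ hs hs.1
    have h2 := antitoneOn_of_hasDerivAt_nonpos (f := fun t => x t - t) (convex_Icc 0 X)
      (fun t _ => (h.hasDerivAt_x t).fun_sub (hasDerivAt_id t)) (fun t ht => by
          have := cos_le_one (θ t); simpa using this) ⟨le_rfl, hX.le⟩ hs hs.1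
    simp only [h0.x_zero] at h1 h2
    constructor <;> linarith
  have has : ∀ s ∈ Icc 0 X, |a s - s| ≤ 3 * δ * s := by
    intro s hs
    obtain ⟨hr1, hr2⟩ := hr s hs
    have hs0 := hs.1
    have h1 := hcos s hs
    have h2 := cos_le_one (θ s)
    obtain ⟨h3, h4⟩ := hxs s hs
    have h5 := hθs s hs
    have h6 : sin (θ s) ≤ ε * s := (sin_le (hpos' s hs)).trans h5
    have h7 : 0 ≤ sin (θ s) := sin_nonneg_of_nonneg_of_le_pi (hpos' s hs)
      (by linarith [hθ s hs, pi_gt_three])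
    have h8 : (r s)⁻¹ ≤ 2 := by
      rw [inv_le_comm₀ (by linarith) (by norm_num)]; linarith
    have h9 : 0 ≤ (r s)⁻¹ := inv_nonneg.2 (by linarith)
    have hes : 0 ≤ ε * s := by positivity
    have h10 : r s * sin (θ s) ≤ R * (ε * s) := by gcongr
    have h11 : 0 ≤ r s * sin (θ s) := mul_nonneg (by linarith) h7
    have h12 : k * (sin (θ s) * (r s)⁻¹) ≤ k * (ε * s * 2) := by gcongr
    have h13 : 0 ≤ k * (sin (θ s) * (r s)⁻¹) := by positivity
    have h14 : 0 ≤ x s := (mul_nonneg (by linarith) hs0).trans h3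
    have h15 : x s * cos (θ s) ≤ s := by nlinarith
    have h16 : (1 - 2 * ε) * s ≤ x s * cos (θ s) := by
      have : (1 - ε) * s * (1 - ε) ≤ x s * cos (θ s) :=
        mul_le_mul h3 h1 (by linarith) h14
      nlinarith [mul_nonneg hs0 (sq_nonneg ε)]
    have h17 : ε * (R + 3 + 2 * k) * s ≤ 3 * δ * s := by gcongr
    simp only [ha, radialSpeed]
    rw [abs_le]
    have hRe : 0 ≤ R * (ε * s) := by positivity
    have hke : 0 ≤ k * (ε * s * 2) := by positivity
    constructor <;> nlinarith
  set g : ℝ → ℝ := fun s => r s ^ k * gaussWeight x r s with hg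
  have hg0 : ∀ s ∈ Icc 0 X, 0 < g s := fun s hs =>
    mul_pos (pow_pos (by linarith [(hr s hs).1]) _) (gaussWeight_pos x r s)
  have hgd : ∀ s ∈ Icc 0 X, HasDerivAt g (-a s * g s) s := by
    intro s hs
    have hr0 : r s ≠ 0 := by linarith [(hr s hs).1]
    refine (((h.hasDerivAt_r s).pow k).mul (h.hasDerivAt_gaussWeight s)).congr_deriv ?_
    simp only [Pi.pow_apply, ha, hg]
    rcases k with _ | k
    · simp
    · simp only [add_tsub_cancel_right, pow_succ]; push_cast; field_simp; ring
  -- The Wronskian φθ' - φ'θ for the comparison function φ = s - δs³; `g` is the integrating factor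
  -- that removes the term a w.
  set w : ℝ → ℝ := fun s => (s - δ * s ^ 3) * profileCurv k lam x r θ s -
    (1 - 3 * δ * s ^ 2) * θ s with hw
  have hwd : ∀ s ∈ Icc 0 X, HasDerivAt w ((s - δ * s ^ 3) *
      (a s * profileCurv k lam x r θ s - k * ((r s)⁻¹) ^ 2 * (sin (θ s) * cos (θ s))) +
      6 * δ * s * θ s) s := by
    intro s hs
    have hr4 : 1 / 4 ≤ r s := by linarith [(hr s hs).1]
    have p1 : HasDerivAt (fun s : ℝ => s - δ * s ^ 3) (1 - 3 * δ * s ^ 2) s := by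
      refine ((hasDerivAt_id s).sub (((hasDerivAt_id s).pow 3).const_mul δ)).congr_deriv ?_
      simp; ring
    have p2 : HasDerivAt (fun s : ℝ => 1 - 3 * δ * s ^ 2) (-(6 * δ * s)) s := by
      refine ((((hasDerivAt_id s).pow 2).const_mul (3 * δ)).const_sub 1).congr_deriv ?_
      simp; ring
    refine ((p1.mul (h.hasDerivAt_curv hr4)).sub (p2.mul (h.hasDerivAt_θ' hr4))).congr_deriv ?_
    simp only [ha]
    ring
  have hanti : AntitoneOn (fun s => w s * g s) (Icc 0 X) := by
    refine antitoneOn_of_hasDerivAt_nonpos (convex_Icc 0 X)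
      (fun s hs => (hwd s hs).mul (hgd s hs)) fun s hs => ?_
    have hs := interior_subset hs
    have h1 := hg0 s hs
    have h2 := hpos' s hs
    have h3 := has s hs
    have hs0 := hs.1
    have hsX : δ * s ^ 2 ≤ 1 := by
      rw [← hXδ]; have := hs.2; gcongr
    have hk1 : 0 ≤ s - δ * s ^ 3 := by nlinarith
    have h4 : b * θ s ≤ k * ((r s)⁻¹) ^ 2 * (sin (θ s) * cos (θ s)) := by
      have h5 := one_sub_sq_mul_le_sin_mul_cos h2 ((hθ s hs).trans hε1)
      have h6 : θ s ^ 2 ≤ ε ^ 2 := by have := hθ s hs; gcongr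
      have h7 : (1 - ε ^ 2) * θ s ≤ sin (θ s) * cos (θ s) := by nlinarith
      calc b * θ s ≤ k * ((r s)⁻¹) ^ 2 * (1 - ε ^ 2) * θ s := by
            have := hrb s hs; gcongr
        _ = k * ((r s)⁻¹) ^ 2 * ((1 - ε ^ 2) * θ s) := by ring
        _ ≤ _ := by gcongr
    have h5 : (a s - s) * (1 - 3 * δ * s ^ 2) ≤ 6 * δ * s := by
      have h6 : |1 - 3 * δ * s ^ 2| ≤ 2 := by
        have : 0 ≤ δ * s ^ 2 := by positivity
        rw [abs_le]; constructor <;> linarith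
      calc _ ≤ |(a s - s) * (1 - 3 * δ * s ^ 2)| := le_abs_self _
        _ = |a s - s| * |1 - 3 * δ * s ^ 2| := abs_mul _ _
        _ ≤ 3 * δ * s * 2 := by gcongr
        _ = _ := by ring
    have h6 : (s - δ * s ^ 3) * (b * θ s) ≤ (s - δ * s ^ 3) *
        (k * ((r s)⁻¹) ^ 2 * (sin (θ s) * cos (θ s))) := by gcongr
    have h7 : (a s - s) * (1 - 3 * δ * s ^ 2) * θ s ≤ 6 * δ * s * θ s := by gcongr
    have h8 : 0 ≤ (3 - b) * (δ * s ^ 3 * θ s) := by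
      have : 0 ≤ 3 - b := by linarith
      positivity
    -- For φ one has φ'' - sφ' + bφ = (b - 1 - 6δ)s + (3 - b)δs³. With b = 1 + 12δ ≤ 3 the cubic
    -- term is nonnegative and the linear term leaves 6δs, exactly enough to absorb the error (a -
    -- s)φ'.
    have key : (s - δ * s ^ 3) *
      (a s * profileCurv k lam x r θ s - k * ((r s)⁻¹) ^ 2 * (sin (θ s) * cos (θ s))) +
      6 * δ * s * θ s - a s * w s ≤ 0 := by
      simp only [hw]
      subst hb
      nlinarith
    have : ((s - δ * s ^ 3) *
      (a s * profileCurv k lam x r θ s - k * ((r s)⁻¹) ^ 2 * (sin (θ s) * cos (θ s))) +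
      6 * δ * s * θ s) * g s + w s * (-a s * g s) = ((s - δ * s ^ 3) *
      (a s * profileCurv k lam x r θ s - k * ((r s)⁻¹) ^ 2 * (sin (θ s) * cos (θ s))) +
      6 * δ * s * θ s - a s * w s) * g s := by ring
    rw [this]
    exact mul_nonpos_of_nonpos_of_nonneg key h1.le
  -- At X = δ^(-1/2) one has φ = 0 and φ' = -2, so w X = 2θ X > 0, while w g is nonincreasing from
  -- 0.
  have hfin := hanti ⟨le_rfl, hX.le⟩ ⟨hX.le, le_rfl⟩ hX.le
  have hw0 : w 0 = 0 := by simp [hw, h0.θ_zero]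
  have hwX : w X = 2 * θ X := by
    simp only [hw]
    have : X - δ * X ^ 3 = 0 := by linear_combination (-X) * hXδ
    rw [this]
    linear_combination 3 * θ X * hXδ
  simp only [hw0, zero_mul, hwX] at hfin
  have h1 := hpos X ⟨hX, le_rfl⟩
  have h2 := hg0 X ⟨hX.le, le_rfl⟩
  nlinarith [mul_pos h1 h2]

end IsProfile

/-- Profile curves starting slightly below the cylinder. -/
theorem exists_mem_fallingSet {k : ℕ} {lam R : ℝ} (hlam : 0 < lam) (hR : 1 / 2 < R)
    (hRk : k * R⁻¹ - R - lam = 0) (hlt : ∀ r, 1 / 2 ≤ r → r < R → 0 < k * r⁻¹ - r - lam) :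
    ∃ r₀ ∈ Ico (1 / 2) R, (r₀, lam) ∈ fallingSet k := by
  have hR0 : 0 < R := by linarith
  have hcyl := (isProfile_sol k (R, lam)).unique (IsProfile.cylinder k 0 (by linarith) hRk)
    (s₀ := 0) (by simp) (by simp) (by simp)
  set β := k * (R⁻¹) ^ 2 with hβ
  -- The cylinder equation gives β = (R + λ)/R, so this is where λ > 0 enters.
  have hβ1 : 1 < β := by
    have : k * (R⁻¹) ^ 2 = (R + lam) * R⁻¹ := by linear_combination R⁻¹ * hRk
    rw [hβ, this, ← div_eq_mul_inv, one_lt_div hR0]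
    linarith
  -- Now 1 + 12δ is at most the midpoint of 1 and β, which leaves room to perturb r and θ, and it is
  -- at most 2, below the bound 3 of the comparison.
  set δ := min ((β - 1) / 24) (1 / 12) with hδ
  have hδ0 : 0 < δ := lt_min (by linarith) (by norm_num)
  have hδ1 : δ ≤ (β - 1) / 24 := min_le_left _ _
  have hδ2 : δ ≤ 1 / 12 := min_le_right _ _
  set X := (√δ)⁻¹ with hX
  have hX0 : 0 < X := inv_pos.2 (sqrt_pos.2 hδ0)
  have hXδ : δ * X ^ 2 = 1 := by
    rw [hX, inv_pow, sq_sqrt hδ0.le, mul_inv_cancel₀ hδ0.ne']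
  -- choice of `ε`
  have hlim : ∀ᶠ ε in 𝓝 (0:ℝ), 1 + 12 * δ < k * ((R + ε)⁻¹) ^ 2 * (1 - ε ^ 2) ∧
      ε * (R + 1 + 3 + 2 * k) < 3 * δ ∧ ε < 1 ∧ ε < R - 1 / 2 := by
    refine Eventually.and ?_ (Eventually.and ?_ (Eventually.and ?_ ?_))
    · have hc : ContinuousAt (fun ε : ℝ => k * ((R + ε)⁻¹) ^ 2 * (1 - ε ^ 2)) 0 := by
        have : R + 0 ≠ 0 := by simpa using hR0.ne'
        fun_prop (disch := exact this)
      exact hc.eventually (lt_mem_nhds (by simp only [add_zero]; rw [← hβ]; linarith))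
    · have hc : ContinuousAt (fun ε : ℝ => ε * (R + 1 + 3 + 2 * k)) 0 := by fun_prop
      exact hc.eventually (gt_mem_nhds (by linarith))
    · exact gt_mem_nhds one_pos
    · exact gt_mem_nhds (by linarith)
  obtain ⟨ε₀, hε₀, hball⟩ := Metric.eventually_nhds_iff.1 hlim
  set ε := ε₀ / 2 with hε
  have hε0 : 0 < ε := by positivity
  obtain ⟨e1, e2, e3, e4⟩ := hball (y := ε)
    (by rw [Real.dist_eq, sub_zero, abs_of_pos hε0]; linarith)
  -- The solution at `(R, lam)` is the cylinder, with constant radius, zero angle and zero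
  -- curvature. The comparison hypotheses thus hold on the compact interval [0, X] for nearby
  -- parameters.
  have n1 : ∀ᶠ q in 𝓝 (R, lam), ∀ t ∈ Icc 0 X, rSol k q |t| ∈ Ioo (R - ε) (R + ε) :=
    (continuous_rSol_abs k).eventually_forall_mem_Icc isOpen_Ioo fun t _ => by
      simp only [hcyl.2.1]; constructor <;> linarith
  have n2 : ∀ᶠ q in 𝓝 (R, lam), ∀ t ∈ Icc 0 X, θSol k q t ∈ Iio ε :=
    eventually_forall_θSol k isOpen_Iio le_rfl fun t _ => by simpa [hcyl.2.2] using hε0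
  have n3 : ∀ᶠ q in 𝓝 (R, lam), ∀ t ∈ Icc 0 X, profileAccel k (q, t) ∈ Iio ε :=
    (continuous_profileAccel k).eventually_forall_mem_Icc isOpen_Iio fun t _ => by
      have : profileAccel k ((R, lam), t) = 0 := by
        simp only [profileAccel, hcyl.1, hcyl.2.1, hcyl.2.2]
        rw [max_eq_left (by linarith)]
        simpa using hRk
      rw [this]; exact hε0
  have n4 : ∀ᶠ r₀ in 𝓝[<] R, r₀ ∈ Ioo (1 / 2) R := Ioo_mem_nhdsLT hR
  have ht : Tendsto (fun r₀ : ℝ => (r₀, lam)) (𝓝[<] R) (𝓝 (R, lam)) := by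
    have : Continuous (fun r₀ : ℝ => (r₀, lam)) := by fun_prop
    exact (this.tendsto R).mono_left nhdsWithin_le_nhds
  obtain ⟨r₀, ⟨⟨⟨m1, m2⟩, m3⟩, m4⟩⟩ :=
    (((ht.eventually n1).and (ht.eventually n2)).and (ht.eventually n3)).and n4 |>.exists
  refine ⟨r₀, ⟨m4.1.le, m4.2⟩, ?_⟩
  have h := isProfile_sol k (r₀, lam)
  have h0 : StartsAtNeck (xSol k (r₀, lam)) (rSol k (r₀, lam)) (θSol k (r₀, lam)) :=
    ⟨by simp, by simpa using m4.1.le, by simp⟩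
  have mr : ∀ s ∈ Icc 0 X, R - ε < rSol k (r₀, lam) s ∧ rSol k (r₀, lam) s < R + ε := by
    intro s hs
    have := m1 s hs
    rwa [abs_of_nonneg hs.1] at this
  obtain ⟨s, hs, hθs⟩ := h.exists_θ_nonpos h0 (b := 1 + 12 * δ) (R := R + 1) rfl hδ0 (by linarith)
    hX0 hXδ hε0 e3.le e2.le (fun s hs => by
      obtain ⟨h1, h2⟩ := mr s hs; constructor <;> linarith)
    (fun s hs => by
      obtain ⟨h1, h2⟩ := mr s hs
      refine e1.le.trans ?_
      have h3 : 0 ≤ 1 - ε ^ 2 := by nlinarith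
      have h4 : 0 < rSol k (r₀, lam) s := by linarith
      gcongr)
    (fun s hs => (m2 s hs).le)
    (fun s hs => by
      have h1 : profileAccel k ((r₀, lam), s) < ε := m3 s hs
      have h2 := (mr s hs).1
      simp only [profileAccel, abs_of_nonneg hs.1] at h1
      rw [max_eq_left (by linarith)] at h1
      exact h1.le)
  have hκ : 0 < k * (rSol k (r₀, lam) 0)⁻¹ - rSol k (r₀, lam) 0 - lam := by
    simpa using hlt r₀ m4.1.le m4.2
  obtain ⟨τ, hτ, hτs, hin, hex⟩ := h.exists_exit h0 hκ hs.1 (fun hc => absurd hc.1 (not_lt.2 hθs))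
  rcases hex with hex | hex
  · exact h.exists_neg_of_exit_zero h0 hκ hτ hin hex
  -- Up to time X the angle is below ε < 1 < π/2, so the exit cannot be at π/2.
  · have := m2 τ ⟨hτ.le, hτs.trans hs.2⟩
    rw [hex] at this
    have := this.trans e3
    linarith [pi_gt_three]

/-- Shooting: there is a profile curve along which both coordinates increase forever. -/
theorem exists_complete_profile {k : ℕ} (hk : 1 ≤ k) : ∃ c₁ : ℝ, 0 < c₁ ∧ ∀ lam : ℝ, 0 < lam →
    lam < c₁ → ∃ x r θ : ℝ → ℝ, IsProfile k lam x r θ ∧ StartsAtNeck x r θ ∧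
      0 < k * (r 0)⁻¹ - r 0 - lam ∧ ∀ s, 0 < s → θ s ∈ Ioo 0 (π / 2) := by
  have hk1 : (1:ℝ) ≤ k := by exact_mod_cast hk
  have hhalf : ((1 / 2, 0) : ℝ × ℝ) ∈ risingSet k ∩ upwardSet k :=
    ⟨half_zero_mem_risingSet hk, by unfold upwardSet; norm_num; linarith⟩
  have hopen := (isOpen_risingSet_inter k).mem_nhds hhalf
  have hc : Continuous (fun l : ℝ => ((1 / 2, l) : ℝ × ℝ)) := by fun_prop
  obtain ⟨c, hc0, hc⟩ := Metric.eventually_nhds_iff.1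
    ((hc.continuousAt (x := 0)).preimage_mem_nhds hopen)
  -- The bound by 1 ensures R > 1/2: the required inequality (1 + λ)² < λ² + 4k reduces to 1 + 2λ <
  -- 4k.
  refine ⟨min c 1, lt_min hc0 one_pos, fun lam hlam hlamc => ?_⟩
  have hlam1 : lam < 1 := hlamc.trans_le (min_le_right _ _)
  have hrise : ((1 / 2, lam) : ℝ × ℝ) ∈ risingSet k ∩ upwardSet k :=
    hc (y := lam) (by
      rw [Real.dist_eq, sub_zero, abs_of_pos hlam]; exact hlamc.trans_le (min_le_left _ _))
  set R := (-lam + √(lam ^ 2 + 4 * k)) / 2 with hR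
  have hsq : √(lam ^ 2 + 4 * k) ^ 2 = lam ^ 2 + 4 * k := sq_sqrt (by positivity)
  have hRsq : R ^ 2 + lam * R - k = 0 := by rw [hR]; linear_combination hsq / 4
  have hRhalf : 1 / 2 < R := by
    have : 1 + lam < √(lam ^ 2 + 4 * k) := by
      refine lt_sqrt_of_sq_lt ?_
      nlinarith
    rw [hR]; linarith
  have hR0 : 0 < R := by linarith
  have hRk : k * R⁻¹ - R - lam = 0 := by
    field_simp; linarith
  have hlt : ∀ r, 1 / 2 ≤ r → r < R → 0 < k * r⁻¹ - r - lam := by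
    intro r hr hrR
    have hr0 : 0 < r := by linarith
    have : k * R⁻¹ < k * r⁻¹ := by gcongr
    linarith
  obtain ⟨r₁, hr₁, hfall⟩ := exists_mem_fallingSet hlam hRhalf hRk hlt
  by_contra hno
  have hcl : Continuous (fun r₀ : ℝ => (r₀, lam)) := by fun_prop
  have hcover : Ico (1 / 2) R ⊆ (fun r₀ : ℝ => (r₀, lam)) ⁻¹' fallingSet k ∪
      (fun r₀ : ℝ => (r₀, lam)) ⁻¹' (risingSet k ∩ upwardSet k) := by
    intro r₀ hr₀
    have h := isProfile_sol k (r₀, lam)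
    have h0 : StartsAtNeck (xSol k (r₀, lam)) (rSol k (r₀, lam)) (θSol k (r₀, lam)) :=
      ⟨by simp, by simpa using hr₀.1, by simp⟩
    have hκ := hlt r₀ hr₀.1 hr₀.2
    have hκ' : 0 < k * (rSol k (r₀, lam) 0)⁻¹ - rSol k (r₀, lam) 0 - lam := by simpa using hκ
    have hout : ¬ ∀ s, 0 < s → θSol k (r₀, lam) s ∈ Ioo 0 (π / 2) := fun hin =>
      hno ⟨_, _, _, h, h0, hκ', hin⟩
    push Not at hout
    obtain ⟨s, hs, hs'⟩ := hout
    obtain ⟨τ, hτ, -, hin, hex⟩ := h.exists_exit h0 hκ' hs hs'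
    rcases hex with hex | hex
    · exact Or.inl (h.exists_neg_of_exit_zero h0 hκ' hτ hin hex)
    · refine Or.inr ⟨h.exists_gt_of_exit_pi_div_two h0 hτ hin hex, ?_⟩
      have : max r₀ (1 / 4) = r₀ := max_eq_left (by linarith [hr₀.1])
      simp only [upwardSet, mem_ofPred_eq, this]
      exact hκ
  -- If no complete profile existed, the interval [1/2, R) would be covered by two open sets that
  -- both meet it, hence meet each other; but falling and rising exclude one another.
  obtain ⟨r₀, -, h1, h2⟩ := isPreconnected_Ico _ _ ((isOpen_fallingSet k).preimage hcl)
    ((isOpen_risingSet_inter k).preimage hcl) hcover ⟨r₁, hr₁, hfall⟩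
    ⟨1 / 2, ⟨le_rfl, hRhalf⟩, hrise⟩
  exact falling_inter_rising k _ h1 h2.1

end Profile

/-! ### Smoothness and reflection of the complete profile. -/

section Profile

open Real

/-- The profile curve of a complete rotational `lam`-hypersurface with a neck. -/
structure IsNeckProfile (k : ℕ) (lam : ℝ) (x r θ : ℝ → ℝ) : Prop where
  contDiff_x : ContDiff ℝ ∞ x
  contDiff_r : ContDiff ℝ ∞ r
  contDiff_θ : ContDiff ℝ ∞ θ
  hasDerivAt_x : ∀ s, HasDerivAt x (cos (θ s)) s
  hasDerivAt_r : ∀ s, HasDerivAt r (sin (θ s)) s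
  hasDerivAt_θ : ∀ s, HasDerivAt θ (profileCurv k lam x r θ s) s
  r_pos : ∀ s, 0 < r s
  cos_pos : ∀ s, 0 < cos (θ s)
  r_even : ∀ s, r (-s) = r s
  x_odd : ∀ s, x (-s) = -x s
  sin_nonneg : ∀ s, 0 ≤ s → 0 ≤ sin (θ s)
  sin_nonpos : ∀ s, s ≤ 0 → sin (θ s) ≤ 0
  tendsto_r : Tendsto r atTop atTop
  tendsto_x : Tendsto x atTop atTop
  curv_zero_pos : 0 < profileCurv k lam x r θ 0

/-- Bootstrapping: the right-hand sides are as regular as x, r and θ, so each pass gains one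
derivative. -/
theorem contDiff_infty_of_hasDerivAt {x r θ : ℝ → ℝ} {k : ℕ} {lam : ℝ}
    (hx : ∀ s, HasDerivAt x (cos (θ s)) s) (hr : ∀ s, HasDerivAt r (sin (θ s)) s)
    (hθ : ∀ s, HasDerivAt θ (profileCurv k lam x r θ s) s) (hr0 : ∀ s, r s ≠ 0) :
    ContDiff ℝ ∞ x ∧ ContDiff ℝ ∞ r ∧ ContDiff ℝ ∞ θ := by
  have step : ∀ (n : ℕ) {f f' : ℝ → ℝ}, (∀ s, HasDerivAt f (f' s) s) → ContDiff ℝ n f' →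
      ContDiff ℝ (n + 1 : ℕ) f := by
    intro n f f' hf hf'
    have e : deriv f = f' := funext fun s => (hf s).deriv
    push_cast
    rw [contDiff_succ_iff_deriv]
    exact ⟨fun s => (hf s).differentiableAt, by simp, e ▸ hf'⟩
  have cont : ∀ {f f' : ℝ → ℝ}, (∀ s, HasDerivAt f (f' s) s) → ContDiff ℝ (0:ℕ) f := fun hf =>
    contDiff_zero.2 (continuous_iff_continuousAt.2 fun s => (hf s).continuousAt)
  have all : ∀ n : ℕ, ContDiff ℝ n x ∧ ContDiff ℝ n r ∧ ContDiff ℝ n θ := by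
    intro n
    induction n with
    | zero => exact ⟨cont hx, cont hr, cont hθ⟩
    | succ n ih =>
      obtain ⟨h1, h2, h3⟩ := ih
      refine ⟨step n hx h3.cos, step n hr h3.sin, step n hθ ?_⟩
      unfold profileCurv
      exact ((((contDiff_const.mul h3.cos).mul (h2.inv hr0)).add (h1.mul h3.sin)).sub
        (h2.mul h3.cos)).sub contDiff_const
  exact ⟨contDiff_infty.2 fun n => (all n).1, contDiff_infty.2 fun n => (all n).2.1,
    contDiff_infty.2 fun n => (all n).2.2⟩

/-- The reflected curve solves the same equation with the same initial data, so uniqueness makes x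
and θ odd and r even. All properties for negative times follow, including r ≥ 1/2, which removes the
cutoff. -/
theorem IsProfile.isNeckProfile {k : ℕ} {lam : ℝ} {x r θ : ℝ → ℝ} (h : IsProfile k lam x r θ)
    (h0 : StartsAtNeck x r θ) (hκ : 0 < k * (r 0)⁻¹ - r 0 - lam)
    (hin : ∀ s, 0 < s → θ s ∈ Ioo 0 (π / 2)) : IsNeckProfile k lam x r θ := by
  obtain ⟨ex, er, eθ⟩ := h.unique h.neg_symm (s₀ := 0) (by simp [h0.x_zero]) (by simp)
    (by simp [h0.θ_zero])
  have hxodd : ∀ s, x (-s) = -x s := fun s => by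
    have : x s = -x (-s) := congrFun ex s
    linarith
  have hreven : ∀ s, r (-s) = r s := fun s => (congrFun er s).symm
  have hθodd : ∀ s, θ (-s) = -θ s := fun s => by
    have : θ s = -θ (-s) := congrFun eθ s
    linarith
  have hr : ∀ s, 1 / 2 ≤ r s := fun s => by
    rcases le_total 0 s with hs | hs
    · exact (h.signs_of_complete h0 hin hs).1
    · rw [← hreven]; exact (h.signs_of_complete h0 hin (by linarith)).1
  have hθ : ∀ s, HasDerivAt θ (profileCurv k lam x r θ s) s := fun s =>
    h.hasDerivAt_θ' (by linarith [hr s])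
  obtain ⟨c1, c2, c3⟩ := contDiff_infty_of_hasDerivAt h.hasDerivAt_x h.hasDerivAt_r hθ
    fun s => by linarith [hr s]
  refine ⟨c1, c2, c3, h.hasDerivAt_x, h.hasDerivAt_r, hθ, fun s => by linarith [hr s], fun s => ?_,
    hreven, hxodd, fun s hs => (h.signs_of_complete h0 hin hs).2.2.1, fun s hs => ?_,
    h.tendsto_r_of_complete h0 hin, h.tendsto_x_of_complete h0 hin, by rwa [IsProfile.curv_zero h0]⟩
  · rcases le_total 0 s with hs | hs
    · exact IsProfile.cos_pos_of_complete h0 hin hs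
    · rw [← cos_neg, ← hθodd]
      exact IsProfile.cos_pos_of_complete h0 hin (by linarith)
  · have := (h.signs_of_complete h0 hin (s := -s) (by linarith)).2.2.1
    rw [hθodd, sin_neg] at this
    linarith

theorem exists_isNeckProfile {k : ℕ} (hk : 1 ≤ k) : ∃ c₁ : ℝ, 0 < c₁ ∧ ∀ lam : ℝ, 0 < lam →
    lam < c₁ → ∃ x r θ : ℝ → ℝ, IsNeckProfile k lam x r θ := by
  obtain ⟨c, hc, hall⟩ := exists_complete_profile hk
  refine ⟨c, hc, fun lam hl hlc => ?_⟩
  obtain ⟨x, r, θ, h, h0, hκ, hin⟩ := hall lam hl hlc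
  exact ⟨x, r, θ, h.isNeckProfile h0 hκ hin⟩

end Profile

/-! ### Hypersurfaces of revolution and their differentials. -/

section Revolution

variable {n : ℕ}

/-- The isomorphism `ℝ × ℝⁿ → ℝⁿ⁺¹` which separates off the axis. -/
def axisProd (n : ℕ) : (ℝ × EuclideanSpace ℝ (Fin n)) →L[ℝ] EuclideanSpace ℝ (Fin (n + 1)) :=
  LinearMap.toContinuousLinearMap
    { toFun := fun p => WithLp.toLp 2 (Fin.cons p.1 (fun i => p.2 i))
      map_add' := fun p q => by
        ext i
        refine Fin.cases ?_ (fun i => ?_) i <;> simp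
      map_smul' := fun c p => by
        ext i
        refine Fin.cases ?_ (fun i => ?_) i <;> simp }

@[simp] theorem axisProd_apply_zero (p : ℝ × EuclideanSpace ℝ (Fin n)) : axisProd n p 0 = p.1 := rfl

@[simp] theorem axisProd_apply_succ (p : ℝ × EuclideanSpace ℝ (Fin n)) (i : Fin n) :
    axisProd n p i.succ = p.2 i := rfl

theorem inner_axisProd (p q : ℝ × EuclideanSpace ℝ (Fin n)) :
    inner ℝ (axisProd n p) (axisProd n q) = p.1 * q.1 + inner ℝ p.2 q.2 := by
  simp only [PiLp.inner_apply, Fin.sum_univ_succ, axisProd_apply_zero, axisProd_apply_succ]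
  simp [mul_comm]

theorem norm_axisProd_sq (p : ℝ × EuclideanSpace ℝ (Fin n)) :
    ‖axisProd n p‖ ^ 2 = p.1 ^ 2 + ‖p.2‖ ^ 2 := by
  rw [← real_inner_self_eq_norm_sq, inner_axisProd, real_inner_self_eq_norm_sq]; ring

/-- The component of a vector orthogonal to the axis. -/
def orthPart (n : ℕ) (v : EuclideanSpace ℝ (Fin (n + 1))) : EuclideanSpace ℝ (Fin n) :=
  WithLp.toLp 2 (fun i => v i.succ)

theorem continuous_orthPart (n : ℕ) : Continuous (orthPart n) := by
  unfold orthPart; fun_prop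

@[simp] theorem orthPart_axisProd (p : ℝ × EuclideanSpace ℝ (Fin n)) :
    orthPart n (axisProd n p) = p.2 := rfl

@[simp] theorem axisProd_orthPart (v : EuclideanSpace ℝ (Fin (n + 1))) :
    axisProd n (v 0, orthPart n v) = v := by
  ext i
  refine Fin.cases ?_ (fun i => ?_) i <;> simp [orthPart]

theorem axisProd_injective (n : ℕ) : Function.Injective (axisProd n) := by
  intro p q h
  refine Prod.ext ?_ ?_
  · simpa using congrArg (fun v : EuclideanSpace ℝ (Fin (n + 1)) => v 0) h
  · simpa using congrArg (orthPart n) h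

theorem axisVector_eq (n : ℕ) : axisVector n = axisProd n (1, 0) := by
  ext i
  refine Fin.cases ?_ (fun i => ?_) i <;> simp [axisVector]

theorem smul_axisVector (n : ℕ) (t : ℝ) : t • axisVector n = axisProd n (t, 0) := by
  rw [axisVector_eq, ← map_smul]; simp

/-- The hypersurface of revolution with profile curve `(f, g)`. -/
def revolve (n : ℕ) (f g : ℝ → ℝ) : Cylinder n → EuclideanSpace ℝ (Fin (n + 1)) :=
  fun p => axisProd n (f p.1, g p.1 • (p.2 : EuclideanSpace ℝ (Fin n)))

theorem norm_smul_sphere (α : Metric.sphere (0 : EuclideanSpace ℝ (Fin n)) 1) {c : ℝ}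
    (hc : 0 ≤ c) : ‖c • (α : EuclideanSpace ℝ (Fin n))‖ = c := by
  rw [norm_smul, norm_eq_of_mem_sphere, mul_one, Real.norm_eq_abs, abs_of_nonneg hc]

theorem continuous_coord_zero : Continuous (fun v : EuclideanSpace ℝ (Fin (n + 1)) => v 0) := by
  fun_prop

theorem coord_zero_eq_inner (v : EuclideanSpace ℝ (Fin (n + 1))) :
    v 0 = inner ℝ (axisVector n) v := by
  conv_rhs => rw [axisVector_eq, ← axisProd_orthPart v, inner_axisProd]
  simp

theorem norm_sq_orthPart (v : EuclideanSpace ℝ (Fin (n + 1))) :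
    ‖orthPart n v‖ ^ 2 = ‖v‖ ^ 2 - (v 0) ^ 2 := by
  conv_rhs => rw [← axisProd_orthPart v, norm_axisProd_sq]
  simp

theorem continuous_revolve {f g : ℝ → ℝ} (hf : Continuous f) (hg : Continuous g) :
    Continuous (revolve n f g) :=
  (axisProd n).continuous.comp ((hf.comp continuous_fst).prodMk
    ((hg.comp continuous_fst).smul (continuous_subtype_val.comp continuous_snd)))

theorem roundCylinder_eq (n : ℕ) (ρ : ℝ) : roundCylinder n ρ = revolve n id (fun _ => ρ) := rfl

variable [NeZero n]

theorem contMDiff_revolve {f g : ℝ → ℝ} (hf : ContDiff ℝ ∞ f) (hg : ContDiff ℝ ∞ g) :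
    ContMDiff (cylinderModel n) 𝓘(ℝ, EuclideanSpace ℝ (Fin (n + 1))) ∞ (revolve n f g) := by
  have h1 : ContMDiff (cylinderModel n) 𝓘(ℝ, ℝ) ∞ (fun p : Cylinder n => f p.1) :=
    hf.contMDiff.comp contMDiff_fst
  have h2 : ContMDiff (cylinderModel n) 𝓘(ℝ, ℝ) ∞ (fun p : Cylinder n => g p.1) :=
    hg.contMDiff.comp contMDiff_fst
  have h3 : ContMDiff (cylinderModel n) 𝓘(ℝ, EuclideanSpace ℝ (Fin n)) ∞
      (fun p : Cylinder n => (p.2 : EuclideanSpace ℝ (Fin n))) :=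
    contMDiff_coe_sphere.comp contMDiff_snd
  exact (axisProd n).contDiff.contMDiff.comp (h1.prodMk_space (h2.smul h3))

/-- The differential of the inclusion of the unit sphere. -/
def sphereDiff (α : Metric.sphere (0 : EuclideanSpace ℝ (Fin n)) 1) :
    EuclideanSpace ℝ (Fin (n - 1)) →L[ℝ] EuclideanSpace ℝ (Fin n) :=
  mvfderiv (𝓡 (n - 1)) ((↑) : Metric.sphere (0 : EuclideanSpace ℝ (Fin n)) 1 → _) α

theorem sphereDiff_injective (α : Metric.sphere (0 : EuclideanSpace ℝ (Fin n)) 1) :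
    Function.Injective (sphereDiff α) := injective_mvfderiv_subtypeVal_sphere α

theorem inner_sphereDiff (α : Metric.sphere (0 : EuclideanSpace ℝ (Fin n)) 1)
    (w : EuclideanSpace ℝ (Fin (n - 1))) :
    inner ℝ (α : EuclideanSpace ℝ (Fin n)) (sphereDiff α w) = 0 := by
  have h : sphereDiff α w ∈ (mvfderiv (𝓡 (n - 1))
      ((↑) : Metric.sphere (0 : EuclideanSpace ℝ (Fin n)) 1 → EuclideanSpace ℝ (Fin n)) α).range :=
    ⟨w, rfl⟩
  rw [range_mvfderiv_subtypeVal α] at h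
  exact Submodule.mem_orthogonal_singleton_iff_inner_right.1 h

/-- The map factors through ℝ × ℝⁿ, so the manifold structure enters only through the inclusion of
the sphere; the rest is a Fréchet derivative. -/
theorem mvfderiv_revolve {f g : ℝ → ℝ} {f' g' : ℝ} {p : Cylinder n} (hf : HasDerivAt f f' p.1)
    (hg : HasDerivAt g g' p.1) (v : ℝ × EuclideanSpace ℝ (Fin (n - 1))) :
    mvfderiv (cylinderModel n) (revolve n f g) p v =
      axisProd n (f' * v.1, (g' * v.1) • (p.2 : EuclideanSpace ℝ (Fin n)) +
        g p.1 • sphereDiff p.2 v.2) := by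
  have d1 : HasMFDerivAt (cylinderModel n) 𝓘(ℝ, ℝ) (fun p : Cylinder n => p.1) p
      (ContinuousLinearMap.fst ℝ ℝ (EuclideanSpace ℝ (Fin (n - 1)))) := hasMFDerivAt_fst p
  have d2 : HasMFDerivAt (cylinderModel n) 𝓘(ℝ, EuclideanSpace ℝ (Fin n))
      (fun p : Cylinder n => (p.2 : EuclideanSpace ℝ (Fin n))) p
      ((sphereDiff p.2).comp (ContinuousLinearMap.snd ℝ ℝ (EuclideanSpace ℝ (Fin (n - 1))))) :=
    (((contMDiff_coe_sphere (m := 1)) p.2).mdifferentiableAt one_ne_zero).hasMFDerivAt.comp p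
      (hasMFDerivAt_snd p)
  have d4 : HasFDerivAt (fun q : ℝ × EuclideanSpace ℝ (Fin n) => axisProd n (f q.1, g q.1 • q.2))
      ((axisProd n).comp (((ContinuousLinearMap.toSpanSingleton ℝ f').comp
        (ContinuousLinearMap.fst ℝ ℝ _)).prod (g p.1 • ContinuousLinearMap.snd ℝ ℝ _ +
          ((ContinuousLinearMap.toSpanSingleton ℝ g').comp
            (ContinuousLinearMap.fst ℝ ℝ _)).smulRight (p.2 : EuclideanSpace ℝ (Fin n)))))
      (p.1, (p.2 : EuclideanSpace ℝ (Fin n))) := by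
    have df : HasFDerivAt (fun q : ℝ × EuclideanSpace ℝ (Fin n) => f q.1) _
        (p.1, (p.2 : EuclideanSpace ℝ (Fin n))) :=
      hf.hasFDerivAt.comp (p.1, (p.2 : EuclideanSpace ℝ (Fin n))) hasFDerivAt_fst
    have dg : HasFDerivAt (fun q : ℝ × EuclideanSpace ℝ (Fin n) => g q.1) _
        (p.1, (p.2 : EuclideanSpace ℝ (Fin n))) :=
      hg.hasFDerivAt.comp (p.1, (p.2 : EuclideanSpace ℝ (Fin n))) hasFDerivAt_fst
    exact (axisProd n).hasFDerivAt.comp (p.1, (p.2 : EuclideanSpace ℝ (Fin n)))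
      (df.prodMk (dg.fun_smul hasFDerivAt_snd))
  have d3 : HasMFDerivAt (cylinderModel n) 𝓘(ℝ, ℝ × EuclideanSpace ℝ (Fin n))
      (fun p : Cylinder n => (p.1, (p.2 : EuclideanSpace ℝ (Fin n)))) p
      ((ContinuousLinearMap.fst ℝ ℝ (EuclideanSpace ℝ (Fin (n - 1)))).prod
        ((sphereDiff p.2).comp (ContinuousLinearMap.snd ℝ ℝ _))) :=
    ⟨d1.1.prodMk d2.1, d1.2.prodMk d2.2⟩
  have d5 := d4.hasMFDerivAt.comp p d3
  have d6 : mvfderiv (cylinderModel n) (revolve n f g) p = _ := d5.mfderiv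
  rw [d6]
  refine congrArg (axisProd n) (Prod.ext ?_ ?_)
  · exact mul_comm _ _
  · change g p.1 • sphereDiff p.2 v.2 + (v.1 * g') • (p.2 : EuclideanSpace ℝ (Fin n)) = _
    rw [add_comm, mul_comm]

end Revolution

/-! ### Embeddedness, orientation and curvature of the rotated curve. -/

section NeckHypersurface

variable {n : ℕ} {k : ℕ} {lam : ℝ} {x r θ : ℝ → ℝ}

namespace IsNeckProfile

/-- The unit normal of a hypersurface of revolution whose profile curve has tangent angle `θ`. -/
def normal (n : ℕ) (θ : ℝ → ℝ) : Cylinder n → EuclideanSpace ℝ (Fin (n + 1)) :=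
  revolve n (fun s => Real.sin (θ s)) (fun s => -Real.cos (θ s))

theorem strictMono_x (h : IsNeckProfile k lam x r θ) : StrictMono x :=
  strictMono_of_deriv_pos fun s => by rw [(h.hasDerivAt_x s).deriv]; exact h.cos_pos s

theorem surjective_x (h : IsNeckProfile k lam x r θ) : Function.Surjective x := by
  refine h.contDiff_x.continuous.surjective h.tendsto_x ?_
  have : Tendsto (fun s => -x (-s)) atBot atBot :=
    tendsto_neg_atTop_atBot.comp (h.tendsto_x.comp tendsto_neg_atBot_atTop)
  simpa [h.x_odd] using this

/-- The inverse function of the axial coordinate. -/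
def xInv (h : IsNeckProfile k lam x r θ) : ℝ → ℝ :=
  (h.strictMono_x.orderIsoOfSurjective x h.surjective_x).symm

theorem continuous_xInv (h : IsNeckProfile k lam x r θ) : Continuous h.xInv :=
  OrderIso.continuous _

theorem x_xInv (h : IsNeckProfile k lam x r θ) (y : ℝ) : x (h.xInv y) = y :=
  (h.strictMono_x.orderIsoOfSurjective x h.surjective_x).apply_symm_apply y

theorem xInv_x (h : IsNeckProfile k lam x r θ) (s : ℝ) : h.xInv (x s) = s :=
  (h.strictMono_x.orderIsoOfSurjective x h.surjective_x).symm_apply_apply s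

theorem strictMono_xInv (h : IsNeckProfile k lam x r θ) : StrictMono h.xInv :=
  OrderIso.strictMono _

/-- The profile curve as a graph over the axis. -/
def graph (h : IsNeckProfile k lam x r θ) (y : ℝ) : ℝ := r (h.xInv y)

theorem continuous_graph (h : IsNeckProfile k lam x r θ) : Continuous h.graph :=
  h.contDiff_r.continuous.comp h.continuous_xInv

theorem graph_pos (h : IsNeckProfile k lam x r θ) (y : ℝ) : 0 < h.graph y := h.r_pos _

theorem graph_x (h : IsNeckProfile k lam x r θ) (s : ℝ) : h.graph (x s) = r s := by
  rw [graph, xInv_x]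

/-- Since x is a bijection of ℝ, the curve is a graph over the axis. Closedness, symmetry and the
complementary components are all read off from this description. -/
theorem mem_range_iff (h : IsNeckProfile k lam x r θ) (v : EuclideanSpace ℝ (Fin (n + 1))) :
    v ∈ range (revolve n x r) ↔ ‖orthPart n v‖ = h.graph (v 0) := by
  constructor
  · rintro ⟨p, rfl⟩
    simp only [revolve, orthPart_axisProd, axisProd_apply_zero, h.graph_x]
    exact norm_smul_sphere p.2 (h.r_pos _).le
  · intro hv
    have hg := h.graph_pos (v 0)
    refine ⟨(h.xInv (v 0), ⟨(h.graph (v 0))⁻¹ • orthPart n v, ?_⟩), ?_⟩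
    · rw [mem_sphere_zero_iff_norm, norm_smul, hv, norm_inv, Real.norm_eq_abs, abs_of_pos hg,
        inv_mul_cancel₀ hg.ne']
    · simp only [revolve, h.x_xInv]
      rw [smul_smul, show r (h.xInv (v 0)) = h.graph (v 0) from rfl, mul_inv_cancel₀ hg.ne',
        one_smul, axisProd_orthPart]

theorem isClosed_range (h : IsNeckProfile k lam x r θ) : IsClosed (range (revolve n x r)) := by
  have : range (revolve n x r) = {v | ‖orthPart n v‖ = h.graph (v 0)} :=
    Set.ext fun v => h.mem_range_iff v
  rw [this]
  exact isClosed_eq (continuous_orthPart n).norm (h.continuous_graph.comp continuous_coord_zero)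

theorem isEmbedding (h : IsNeckProfile k lam x r θ) : IsEmbedding (revolve n x r) := by
  set g : EuclideanSpace ℝ (Fin (n + 1)) → ℝ × EuclideanSpace ℝ (Fin n) :=
    fun v => (h.xInv (v 0), (h.graph (v 0))⁻¹ • orthPart n v) with hg
  have hgc : Continuous g := by
    have h1 : Continuous fun v : EuclideanSpace ℝ (Fin (n + 1)) => h.graph (v 0) :=
      h.continuous_graph.comp continuous_coord_zero
    exact (h.continuous_xInv.comp continuous_coord_zero).prodMk
      ((h1.inv₀ fun v => (h.graph_pos _).ne').smul (continuous_orthPart n))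
  refine IsEmbedding.of_comp (continuous_revolve h.contDiff_x.continuous
    h.contDiff_r.continuous) hgc ?_
  have : g ∘ revolve n x r = Prod.map id Subtype.val := by
    ext1 p
    refine Prod.ext ?_ ?_
    · simp [hg, revolve, h.xInv_x]
    · simp only [hg, revolve, Function.comp_apply, orthPart_axisProd, axisProd_apply_zero,
        h.graph_x]
      rw [smul_smul, inv_mul_cancel₀ (h.r_pos _).ne', one_smul]
      rfl
  rw [this]
  exact IsEmbedding.id.prodMap IsEmbedding.subtypeVal

theorem isRotationallySymmetric (h : IsNeckProfile k lam x r θ) :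
    IsRotationallySymmetric (range (revolve n x r)) := by
  intro R hR
  have h0 : ∀ v, R v 0 = v 0 := fun v => by
    rw [coord_zero_eq_inner, coord_zero_eq_inner, ← R.inner_map_map (axisVector n) v, hR]
  have h1 : ∀ v, ‖orthPart n (R v)‖ = ‖orthPart n v‖ := fun v => by
    rw [← sq_eq_sq₀ (norm_nonneg _) (norm_nonneg _), norm_sq_orthPart, norm_sq_orthPart, h0,
      R.norm_map]
  have key : ∀ v, R v ∈ range (revolve n x r) ↔ v ∈ range (revolve n x r) := fun v => by
    rw [h.mem_range_iff, h.mem_range_iff, h0, h1]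
  ext w
  constructor
  · rintro ⟨v, hv, rfl⟩
    exact (key v).2 hv
  · intro hw
    refine ⟨R.symm w, ?_, R.apply_symm_apply w⟩
    rw [← key, R.apply_symm_apply]
    exact hw

theorem graph_le (h : IsNeckProfile k lam x r θ) {s y : ℝ} (hs : 0 ≤ s) (hy : x s ≤ y) :
    r s ≤ h.graph y := by
  have h1 : s ≤ h.xInv y := by rw [← h.xInv_x s]; exact h.strictMono_xInv.monotone hy
  exact monotoneOn_of_hasDerivAt_nonneg (convex_Ici 0) (fun s _ => h.hasDerivAt_r s)
    (fun s hs => h.sin_nonneg s (interior_subset hs)) hs (hs.trans h1) h1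

theorem graph_neg (h : IsNeckProfile k lam x r θ) (y : ℝ) : h.graph (-y) = h.graph y := by
  have : h.xInv (-y) = -h.xInv y := h.strictMono_x.injective (by
    rw [h.x_xInv, h.x_odd, h.x_xInv])
  rw [graph, graph, this, h.r_even]

theorem le_graph_of_abs_le (h : IsNeckProfile k lam x r θ) {y z : ℝ} (hyz : |y| ≤ |z|) :
    h.graph y ≤ h.graph z := by
  have habs : ∀ y, h.graph |y| = h.graph y := fun y => by
    rcases abs_cases y with ⟨e, -⟩ | ⟨e, -⟩ <;> rw [e]
    exact h.graph_neg y
  have hx0 : x 0 = 0 := by have := h.x_odd 0; simp at this; linarith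
  rw [← habs y, ← habs z]
  refine h.graph_le (s := h.xInv |y|) ?_ (by rwa [h.x_xInv])
  rw [← h.xInv_x 0, hx0]
  exact h.strictMono_xInv.monotone (abs_nonneg y)

/-- The component of the complement containing the axis. -/
theorem connectedComponentIn_eq (h : IsNeckProfile k lam x r θ) :
    connectedComponentIn (range (revolve n x r))ᶜ 0 = {v | ‖orthPart n v‖ < h.graph (v 0)} := by
  set Ω : Set (EuclideanSpace ℝ (Fin (n + 1))) := {v | ‖orthPart n v‖ < h.graph (v 0)} with hΩ
  have c1 : Continuous fun v : EuclideanSpace ℝ (Fin (n + 1)) => ‖orthPart n v‖ :=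
    (continuous_orthPart n).norm
  have c2 : Continuous fun v : EuclideanSpace ℝ (Fin (n + 1)) => h.graph (v 0) :=
    h.continuous_graph.comp continuous_coord_zero
  have h00 : (0 : EuclideanSpace ℝ (Fin (n + 1))) ∈ Ω := by
    have : orthPart n (0 : EuclideanSpace ℝ (Fin (n + 1))) = 0 := by ext; simp [orthPart]
    simpa [hΩ, this] using h.graph_pos 0
  have hsub : Ω ⊆ (range (revolve n x r))ᶜ := fun v hv hv' =>
    (lt_irrefl _ ((((h.mem_range_iff v).1 hv').symm.trans_lt hv)))
  -- Rescaling each slice by the graph function exhibits Ω as a continuous image of ℝ times the unit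
  -- ball. The strict reverse inequality then separates Ω from the rest of the complement.
  have hpre : IsPreconnected Ω := by
    have himg : Ω = (fun q : ℝ × EuclideanSpace ℝ (Fin n) =>
        axisProd n (q.1, h.graph q.1 • q.2)) '' (univ ×ˢ Metric.ball 0 1) := by
      ext v
      constructor
      · intro hv
        have hg := h.graph_pos (v 0)
        refine ⟨(v 0, (h.graph (v 0))⁻¹ • orthPart n v), ⟨mem_univ _, ?_⟩, ?_⟩
        · rw [mem_ball_zero_iff, norm_smul, norm_inv, Real.norm_eq_abs, abs_of_pos hg,
            inv_mul_lt_one₀ hg]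
          exact hv
        · simp only [smul_smul, mul_inv_cancel₀ hg.ne', one_smul, axisProd_orthPart]
      · rintro ⟨⟨y, w⟩, ⟨-, hw⟩, rfl⟩
        have hg := h.graph_pos y
        rw [mem_ball_zero_iff] at hw
        change ‖h.graph y • w‖ < h.graph y
        rw [norm_smul, Real.norm_eq_abs, abs_of_pos hg]
        nlinarith
    rw [himg]
    refine ((isPreconnected_univ).prod (convex_ball _ _).isPreconnected).image _
      (Continuous.continuousOn ?_)
    exact (axisProd n).continuous.comp (continuous_fst.prodMk
      ((h.continuous_graph.comp continuous_fst).smul continuous_snd))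
  refine Subset.antisymm ?_ (hpre.subset_connectedComponentIn h00 hsub)
  refine IsPreconnected.subset_left_of_subset_union (isOpen_lt c1 c2)
    (isOpen_lt c2 c1) (disjoint_left.2 fun v hv hv' => lt_asymm
      (show ‖orthPart n v‖ < h.graph (v 0) from hv) hv') ?_
    ⟨0, mem_connectedComponentIn (hsub h00), h00⟩ isPreconnected_connectedComponentIn
  intro v hv
  have := connectedComponentIn_subset _ _ hv
  rw [mem_compl_iff, h.mem_range_iff] at this
  exact lt_or_gt_of_ne this

/-- The graph function is nondecreasing in |x|. A short move along N does not decrease |x| and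
decreases the radius, so it ends below the graph; a short move along -N does the opposite. -/
theorem isInwardNormal (h : IsNeckProfile k lam x r θ) :
    IsInwardNormal (revolve n x r) (normal n θ) := by
  constructor
  · intro t ht
    rw [h.mem_range_iff, smul_axisVector] at ht
    have := h.graph_pos t
    simp at ht
    linarith
  · intro p
    have hr := h.r_pos p.1
    have hc := h.cos_pos p.1
    have hx0 : x 0 = 0 := by have := h.x_odd 0; simp at this; linarith
    -- moving along `sin θ` increases the distance to the neck
    obtain ⟨ε, hε, hε'⟩ : ∃ ε > 0, ∀ t, 0 < t → t < ε →
        |x p.1| ≤ |x p.1 + t * Real.sin (θ p.1)| ∧ |x p.1 - t * Real.sin (θ p.1)| ≤ |x p.1| := by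
      rcases lt_trichotomy p.1 0 with hs | hs | hs
      · have hx : x p.1 < 0 := hx0 ▸ h.strictMono_x hs
        have hsin := h.sin_nonpos p.1 hs.le
        have hsin1 := Real.neg_one_le_sin (θ p.1)
        refine ⟨-x p.1, by linarith, fun t ht htε => ?_⟩
        rw [abs_of_neg hx, abs_of_nonpos (by nlinarith), abs_of_nonpos (by nlinarith)]
        constructor <;> nlinarith
      · have : Real.sin (θ p.1) = 0 :=
          le_antisymm (h.sin_nonpos p.1 hs.le) (h.sin_nonneg p.1 hs.ge)
        exact ⟨1, one_pos, fun t _ _ => by simp [this]⟩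
      · have hx : 0 < x p.1 := hx0 ▸ h.strictMono_x hs
        have hsin := h.sin_nonneg p.1 hs.le
        have hsin1 := Real.sin_le_one (θ p.1)
        refine ⟨x p.1, hx, fun t ht htε => ?_⟩
        rw [abs_of_pos hx, abs_of_nonneg (by nlinarith), abs_of_nonneg (by nlinarith)]
        constructor <;> nlinarith
    refine ⟨min ε (r p.1), lt_min hε hr, fun t ht htε => ?_⟩
    obtain ⟨h1, h2⟩ := hε' t ht (htε.trans_le (min_le_left _ _))
    have htr : t < r p.1 := htε.trans_le (min_le_right _ _)
    have hc1 := Real.cos_le_one (θ p.1)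
    have e1 : revolve n x r p + t • normal n θ p = axisProd n (x p.1 + t * Real.sin (θ p.1),
        (r p.1 - t * Real.cos (θ p.1)) • (p.2 : EuclideanSpace ℝ (Fin n))) := by
      rw [revolve, normal, revolve, ← map_smul, ← map_add]
      refine congrArg (axisProd n) (Prod.ext rfl ?_)
      simp only [Prod.smul_mk, Prod.mk_add_mk, smul_smul, ← add_smul]
      congr 1; ring
    have e2 : revolve n x r p - t • normal n θ p = axisProd n (x p.1 - t * Real.sin (θ p.1),
        (r p.1 + t * Real.cos (θ p.1)) • (p.2 : EuclideanSpace ℝ (Fin n))) := by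
      rw [revolve, normal, revolve, ← map_smul, ← map_sub]
      refine congrArg (axisProd n) (Prod.ext rfl ?_)
      simp only [Prod.smul_mk, Prod.mk_sub_mk, smul_smul, ← sub_smul]
      congr 1; ring
    rw [h.connectedComponentIn_eq, e1, e2]
    have g1 := h.le_graph_of_abs_le h1
    have g2 := h.le_graph_of_abs_le h2
    rw [h.graph_x] at g1 g2
    constructor
    · change ‖(r p.1 - t * Real.cos (θ p.1)) • (p.2 : EuclideanSpace ℝ (Fin n))‖ <
        h.graph (x p.1 + t * Real.sin (θ p.1))
      rw [norm_smul_sphere _ (by nlinarith)]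
      nlinarith
    · change ¬ ‖(r p.1 + t * Real.cos (θ p.1)) • (p.2 : EuclideanSpace ℝ (Fin n))‖ <
        h.graph (x p.1 - t * Real.sin (θ p.1))
      rw [norm_smul_sphere _ (by positivity)]
      nlinarith

end IsNeckProfile

variable [NeZero n]

theorem inner_tangent (α : Metric.sphere (0 : EuclideanSpace ℝ (Fin n)) 1) (a b c a' b' c' : ℝ)
    (w w' : EuclideanSpace ℝ (Fin (n - 1))) :
    inner ℝ (axisProd n (a, b • (α : EuclideanSpace ℝ (Fin n)) + c • sphereDiff α w))
      (axisProd n (a', b' • (α : EuclideanSpace ℝ (Fin n)) + c' • sphereDiff α w')) =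
      a * a' + b * b' + c * c' * inner ℝ (sphereDiff α w) (sphereDiff α w') := by
  have h1 : inner ℝ (α : EuclideanSpace ℝ (Fin n)) (α : EuclideanSpace ℝ (Fin n)) = (1:ℝ) := by
    rw [real_inner_self_eq_norm_sq, norm_eq_of_mem_sphere]; norm_num
  rw [inner_axisProd]
  simp only [inner_add_left, inner_add_right, real_inner_smul_left, real_inner_smul_right,
    inner_sphereDiff, h1, real_inner_comm (α : EuclideanSpace ℝ (Fin n)) (sphereDiff α w)]
  ring

theorem inner_revolve (α : Metric.sphere (0 : EuclideanSpace ℝ (Fin n)) 1) (a b a' b' : ℝ) :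
    inner ℝ (axisProd n (a, b • (α : EuclideanSpace ℝ (Fin n))))
      (axisProd n (a', b' • (α : EuclideanSpace ℝ (Fin n)))) = a * a' + b * b' := by
  simpa using inner_tangent α a b 0 a' b' 0 0 0

namespace IsNeckProfile

theorem mvfderiv_F (h : IsNeckProfile k lam x r θ) (p : Cylinder n)
    (v : ℝ × EuclideanSpace ℝ (Fin (n - 1))) :
    mvfderiv (cylinderModel n) (revolve n x r) p v =
      axisProd n (Real.cos (θ p.1) * v.1, (Real.sin (θ p.1) * v.1) •
        (p.2 : EuclideanSpace ℝ (Fin n)) + r p.1 • sphereDiff p.2 v.2) :=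
  mvfderiv_revolve (h.hasDerivAt_x _) (h.hasDerivAt_r _) v

theorem mvfderiv_normal (h : IsNeckProfile k lam x r θ) (p : Cylinder n)
    (v : ℝ × EuclideanSpace ℝ (Fin (n - 1))) :
    mvfderiv (cylinderModel n) (normal n θ) p v =
      axisProd n (Real.cos (θ p.1) * profileCurv k lam x r θ p.1 * v.1,
        (Real.sin (θ p.1) * profileCurv k lam x r θ p.1 * v.1) •
          (p.2 : EuclideanSpace ℝ (Fin n)) + (-Real.cos (θ p.1)) • sphereDiff p.2 v.2) := by
  refine mvfderiv_revolve (h.hasDerivAt_θ _).sin ?_ v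
  simpa using (h.hasDerivAt_θ p.1).cos.fun_neg

theorem isEmbeddedSubmanifold (h : IsNeckProfile k lam x r θ) :
    IsEmbeddedSubmanifold (cylinderModel n) (revolve n x r) := by
  refine ⟨contMDiff_revolve h.contDiff_x h.contDiff_r, fun p => ?_, h.isEmbedding⟩
  rw [injective_iff_map_eq_zero]
  intro (v : ℝ × EuclideanSpace ℝ (Fin (n - 1))) hv
  rw [h.mvfderiv_F p v, map_eq_zero_iff _ (axisProd_injective n), Prod.mk_eq_zero] at hv
  obtain ⟨h1, h2⟩ := hv
  have hv1 : v.1 = 0 := (mul_eq_zero.1 h1).resolve_left (h.cos_pos _).ne'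
  rw [hv1, mul_zero, zero_smul, zero_add, smul_eq_zero,
    map_eq_zero_iff _ (sphereDiff_injective p.2)] at h2
  exact Prod.ext hv1 (h2.resolve_left (h.r_pos _).ne')

theorem isUnitNormalField (h : IsNeckProfile k lam x r θ) :
    IsUnitNormalField (cylinderModel n) (revolve n x r) (normal n θ) := by
  refine ⟨contMDiff_revolve h.contDiff_θ.sin h.contDiff_θ.cos.neg, fun p => ?_, fun p => ?_⟩
  · have : ‖normal n θ p‖ ^ 2 = 1 := by
      rw [← real_inner_self_eq_norm_sq, normal, revolve, inner_revolve]
      linear_combination Real.sin_sq_add_cos_sq (θ p.1)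
    exact (pow_eq_one_iff_of_nonneg (norm_nonneg _) two_ne_zero).1 this
  · intro (v : ℝ × EuclideanSpace ℝ (Fin (n - 1)))
    rw [h.mvfderiv_F p v]
    have := inner_tangent p.2 (Real.sin (θ p.1)) (-Real.cos (θ p.1)) 0
      (Real.cos (θ p.1) * v.1) (Real.sin (θ p.1) * v.1) (r p.1) 0 v.2
    rw [zero_smul, add_zero] at this
    refine this.trans ?_
    ring

/-- The shape operator is diagonal in the splitting ℝ × ℝ^(n-1), with value -θ' along the profile
and cos θ / r on the rotational directions. Its trace, inserted in the profile equation, gives λ. -/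
theorem isLambdaHypersurface (h : IsNeckProfile (n - 1) lam x r θ) :
    IsLambdaHypersurface (cylinderModel n) (revolve n x r) (normal n θ) lam := by
  intro p
  have hr := (h.r_pos p.1).ne'
  let A : (ℝ × EuclideanSpace ℝ (Fin (n - 1))) →ₗ[ℝ] (ℝ × EuclideanSpace ℝ (Fin (n - 1))) :=
    LinearMap.prodMap ((-profileCurv (n - 1) lam x r θ p.1) • LinearMap.id)
      ((Real.cos (θ p.1) * (r p.1)⁻¹) • LinearMap.id)
  refine ⟨A, ?_, ?_⟩
  · intro (v : ℝ × EuclideanSpace ℝ (Fin (n - 1)))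
    refine (h.mvfderiv_F p (A v)).trans ?_
    rw [h.mvfderiv_normal p v, ← map_neg]
    refine congrArg (axisProd n) (Prod.ext ?_ ?_)
    · simp [A]; ring
    · simp only [A, LinearMap.prodMap_apply, LinearMap.smul_apply, LinearMap.id_apply, map_smul,
        smul_smul, Prod.neg_mk, neg_add, neg_smul, neg_neg, smul_eq_mul]
      rw [show r p.1 * (Real.cos (θ p.1) * (r p.1)⁻¹) = Real.cos (θ p.1) by field_simp]
      congr 1
      rw [← neg_smul]
      congr 1
      ring
  · change LinearMap.trace ℝ (ℝ × EuclideanSpace ℝ (Fin (n - 1))) A +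
      inner ℝ (axisProd n (x p.1, r p.1 • (p.2 : EuclideanSpace ℝ (Fin n))))
        (axisProd n (Real.sin (θ p.1), (-Real.cos (θ p.1)) • (p.2 : EuclideanSpace ℝ (Fin n)))) =
        lam
    rw [inner_revolve, LinearMap.trace_prodMap', map_smul, map_smul, LinearMap.trace_id,
      LinearMap.trace_id, finrank_euclideanSpace_fin]
    simp only [profileCurv, Module.finrank_self, smul_eq_mul, Nat.cast_one]
    ring

/-- At the neck the profile direction has curvature -θ' < 0, and a rotational direction, which
exists because n ≥ 2, has positive curvature. -/
theorem not_isConvexHypersurface (hn : 2 ≤ n) (h : IsNeckProfile k lam x r θ) :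
    ¬ IsConvexHypersurface (cylinderModel n) (revolve n x r) (normal n θ) := by
  have key : ∀ (p : Cylinder n) (v : ℝ × EuclideanSpace ℝ (Fin (n - 1))),
      secondFundamentalForm (cylinderModel n) (revolve n x r) (normal n θ) p v v =
      -(profileCurv k lam x r θ p.1) * v.1 ^ 2 +
        Real.cos (θ p.1) * r p.1 * ‖sphereDiff p.2 v.2‖ ^ 2 := by
    intro p v
    unfold secondFundamentalForm
    rw [h.mvfderiv_F p v, h.mvfderiv_normal p v]
    refine (congrArg Neg.neg (inner_tangent ..)).trans ?_
    rw [real_inner_self_eq_norm_sq]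
    linear_combination (-profileCurv k lam x r θ p.1 * v.1 ^ 2) * Real.sin_sq_add_cos_sq (θ p.1)
  have : Nontrivial (EuclideanSpace ℝ (Fin n)) := by
    have : Nontrivial (Fin n) := Fin.nontrivial_iff_two_le.2 hn
    infer_instance
  obtain ⟨α₀, hα₀⟩ :=
    NormedSpace.sphere_nonempty (x := (0 : EuclideanSpace ℝ (Fin n))) (r := 1) |>.2
    zero_le_one
  let α : Metric.sphere (0 : EuclideanSpace ℝ (Fin n)) 1 := ⟨α₀, hα₀⟩
  have : Nonempty (Fin (n - 1)) := ⟨⟨0, by omega⟩⟩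
  obtain ⟨w, hw⟩ := exists_ne (0 : EuclideanSpace ℝ (Fin (n - 1)))
  rintro (hc | hc)
  · have h1 := hc (0, α) ((1, 0) : ℝ × EuclideanSpace ℝ (Fin (n - 1)))
    rw [key] at h1
    have := h.curv_zero_pos
    simp at h1
    linarith
  · have h1 := hc (0, α) ((0, w) : ℝ × EuclideanSpace ℝ (Fin (n - 1)))
    rw [key] at h1
    have h2 : 0 < ‖sphereDiff α w‖ :=
      norm_pos_iff.2 ((map_ne_zero_iff _ (sphereDiff_injective α)).2 hw)
    have h3 : 0 < Real.cos (θ 0) * r 0 * ‖sphereDiff α w‖ ^ 2 :=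
      mul_pos (mul_pos (h.cos_pos 0) (h.r_pos 0)) (by positivity)
    simp only at h1
    linarith

end IsNeckProfile

end NeckHypersurface

/-! ### The induced distance: lengths of paths, chords and isometries. -/

section InducedDistance

open Manifold MeasureTheory

variable {E H M : Type*} [NormedAddCommGroup E] [NormedSpace ℝ E] [TopologicalSpace H]
  {I : ModelWithCorners ℝ E H} [TopologicalSpace M] [ChartedSpace H M]
  {V : Type*} [NormedAddCommGroup V] [InnerProductSpace ℝ V]

/-- The induced length of the velocity of a path `γ` is the speed of `F ∘ γ`. -/
theorem mvfderiv_apply_mfderiv_one {F : M → V} {γ : ℝ → M} {t : ℝ}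
    (hF : MDifferentiableAt I 𝓘(ℝ, V) F (γ t)) (hγ : MDifferentiableAt 𝓘(ℝ, ℝ) I γ t) :
    mvfderiv I F (γ t) (mfderiv 𝓘(ℝ, ℝ) I γ t (1 : ℝ)) = deriv (F ∘ γ) t := by
  have h := hF.hasMFDerivAt.comp t hγ.hasMFDerivAt
  have h' : HasFDerivAt (F ∘ γ) ((show E →L[ℝ] V from mvfderiv I F (γ t)).comp
    (show ℝ →L[ℝ] E from mfderiv 𝓘(ℝ, ℝ) I γ t)) t := hasMFDerivAt_iff_hasFDerivAt.1 h
  exact h'.hasDerivAt.deriv.symm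

/-- The length of a path for the metric induced by `F`. -/
def inducedLength (I : ModelWithCorners ℝ E H) (F : M → V) (γ : ℝ → M) (a b : ℝ) : ℝ≥0∞ :=
  @pathELength E _ _ H _ I M _ _ (fun x => ⟨fun v => ‖mvfderiv I F x v‖ₑ⟩) γ a b

theorem inducedLength_eq {F : M → V} {γ : ℝ → M} {a b : ℝ}
    (hF : ContMDiff I 𝓘(ℝ, V) 1 F) (hγ : ContMDiffOn 𝓘(ℝ, ℝ) I 1 γ (Icc a b)) :
    inducedLength I F γ a b = ∫⁻ t in Icc a b, ‖deriv (F ∘ γ) t‖ₑ := by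
  rw [inducedLength, @pathELength_eq_lintegral_mfderiv_Ioo E _ _ H _ I M _ _
    (fun x => ⟨fun v => ‖mvfderiv I F x v‖ₑ⟩), ← restrict_Ioo_eq_restrict_Icc]
  refine setLIntegral_congr_fun measurableSet_Ioo fun t ht => ?_
  have h1 : MDifferentiableAt 𝓘(ℝ, ℝ) I γ t :=
    (hγ.contMDiffAt (Icc_mem_nhds ht.1 ht.2)).mdifferentiableAt one_ne_zero
  exact congrArg (fun v : V => ‖v‖ₑ)
    (mvfderiv_apply_mfderiv_one (hF.mdifferentiable one_ne_zero _) h1)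

theorem inducedEDist_le_inducedLength {F : M → V} {γ : ℝ → M} {a b : ℝ}
    (hγ : ContMDiffOn 𝓘(ℝ, ℝ) I 1 γ (Icc a b)) (hab : a ≤ b) :
    inducedEDist I F (γ a) (γ b) ≤ inducedLength I F γ a b := by
  -- This instance is the norm built into `inducedEDist`; its homogeneity, needed for
  -- reparametrizing paths, follows from linearity of the differential.
  let _ : ∀ x : M, ENorm (TangentSpace I x) := fun x => ⟨fun v => ‖mvfderiv I F x v‖ₑ⟩
  have : ∀ x : M, ENormSMulClass ℝ (TangentSpace I x) := fun x => ⟨fun c v => by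
    change ‖mvfderiv I F x (c • v)‖ₑ = ‖c‖ₑ * ‖mvfderiv I F x v‖ₑ
    rw [map_smul, enorm_smul]⟩
  exact riemannianEDist_le_pathELength hγ rfl rfl hab

theorem inducedEDist_triangle (F : M → V) (p q q' : M) :
    inducedEDist I F p q' ≤ inducedEDist I F p q + inducedEDist I F q q' := by
  let _ : ∀ x : M, ENorm (TangentSpace I x) := fun x => ⟨fun v => ‖mvfderiv I F x v‖ₑ⟩
  have : ∀ x : M, ENormSMulClass ℝ (TangentSpace I x) := fun x => ⟨fun c v => by
    change ‖mvfderiv I F x (c • v)‖ₑ = ‖c‖ₑ * ‖mvfderiv I F x v‖ₑ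
    rw [map_smul, enorm_smul]⟩
  exact riemannianEDist_triangle

theorem exists_inducedLength_lt {F : M → V} {p q : M} {L : ℝ≥0∞} (h : inducedEDist I F p q < L) :
    ∃ γ : ℝ → M, γ 0 = p ∧ γ 1 = q ∧ ContMDiffOn 𝓘(ℝ, ℝ) I 1 γ (Icc 0 1) ∧
      inducedLength I F γ 0 1 < L := by
  let _ : ∀ x : M, ENorm (TangentSpace I x) := fun x => ⟨fun v => ‖mvfderiv I F x v‖ₑ⟩
  exact exists_lt_of_riemannianEDist_lt h

theorem inducedEDist_le_of_norm_deriv_le {F : M → V} {γ : ℝ → M} {C : ℝ}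
    (hF : ContMDiff I 𝓘(ℝ, V) 1 F) (hγ : ContMDiff 𝓘(ℝ, ℝ) I 1 γ)
    (hC : ∀ t ∈ Icc (0 : ℝ) 1, ‖deriv (F ∘ γ) t‖ ≤ C) :
    inducedEDist I F (γ 0) (γ 1) ≤ ENNReal.ofReal C := by
  refine (inducedEDist_le_inducedLength hγ.contMDiffOn zero_le_one).trans ?_
  rw [inducedLength_eq hF hγ.contMDiffOn]
  refine (setLIntegral_mono' (g := fun _ => ENNReal.ofReal C) measurableSet_Icc
    fun t ht => ?_).trans (by simp)
  rw [← ofReal_norm]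
  exact ENNReal.ofReal_le_ofReal (hC t ht)

/-- A chord is no longer than the image of any path joining its ends. This is the lower bound used
both for completeness and for non-isometry. -/
theorem enorm_sub_le_inducedEDist {F : M → V} (hF : ContMDiff I 𝓘(ℝ, V) 1 F) (p q : M) :
    ‖F q - F p‖ₑ ≤ inducedEDist I F p q := by
  refine le_of_forall_gt fun L hL => ?_
  obtain ⟨γ, rfl, rfl, hγ, hlt⟩ := exists_inducedLength_lt hL
  rw [inducedLength_eq hF hγ] at hlt
  have hc : ContDiffOn ℝ 1 (F ∘ γ) (Icc 0 1) :=
    contMDiffOn_iff_contDiffOn.1 (hF.comp_contMDiffOn hγ)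
  exact (enorm_sub_le_lintegral_deriv_of_contDiffOn_Icc hc zero_le_one).trans_lt hlt

/-- An isometry does not increase the induced distance. -/
theorem inducedEDist_map_le {E' H' M' V' : Type*} [NormedAddCommGroup E'] [NormedSpace ℝ E']
    [TopologicalSpace H'] {I' : ModelWithCorners ℝ E' H'} [TopologicalSpace M']
    [ChartedSpace H' M'] [NormedAddCommGroup V'] [InnerProductSpace ℝ V'] {F : M → V}
    {F' : M' → V'} {Φ : M → M'} (hF : ContMDiff I 𝓘(ℝ, V) 1 F) (hF' : ContMDiff I' 𝓘(ℝ, V') 1 F')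
    (hΦ : ContMDiff I I' 1 Φ)
    (h : ∀ p (v : TangentSpace I p),
      ‖mvfderiv I' F' (Φ p) (mfderiv I I' Φ p v)‖ = ‖mvfderiv I F p v‖) (p q : M) :
    inducedEDist I' F' (Φ p) (Φ q) ≤ inducedEDist I F p q := by
  refine le_of_forall_gt fun L hL => ?_
  obtain ⟨γ, rfl, rfl, hγ, hlt⟩ := exists_inducedLength_lt hL
  refine (inducedEDist_le_inducedLength (γ := Φ ∘ γ) (hΦ.comp_contMDiffOn hγ)
    zero_le_one).trans_lt (lt_of_eq_of_lt ?_ hlt)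
  rw [inducedLength_eq hF hγ, inducedLength_eq hF' (hΦ.comp_contMDiffOn hγ),
    ← restrict_Ioo_eq_restrict_Icc]
  refine setLIntegral_congr_fun measurableSet_Ioo fun t ht => ?_
  have h1 : MDifferentiableAt 𝓘(ℝ, ℝ) I γ t :=
    (hγ.contMDiffAt (Icc_mem_nhds ht.1 ht.2)).mdifferentiableAt one_ne_zero
  have h2 : MDifferentiableAt I I' Φ (γ t) := hΦ.mdifferentiable one_ne_zero _
  have e1 := mvfderiv_apply_mfderiv_one (hF.mdifferentiable one_ne_zero (γ t)) h1
  have e2 := mvfderiv_apply_mfderiv_one (F := F') (γ := Φ ∘ γ)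
    (hF'.mdifferentiable one_ne_zero _) (h2.comp t h1)
  have e3 := h (γ t) (mfderiv 𝓘(ℝ, ℝ) I γ t (1 : ℝ))
  have e4 : mfderiv 𝓘(ℝ, ℝ) I' (Φ ∘ γ) t (1 : ℝ) =
    mfderiv I I' Φ (γ t) (mfderiv 𝓘(ℝ, ℝ) I γ t (1 : ℝ)) := by
    rw [mfderiv_comp t h2 h1]; rfl
  rw [e4] at e2
  change ‖deriv (F' ∘ Φ ∘ γ) t‖ₑ = ‖deriv (F ∘ γ) t‖ₑ
  rw [← e1, ← e2, ← ofReal_norm, ← ofReal_norm]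
  exact congrArg _ e3

/-- An infinitesimal isometry and its inverse both preserve lengths of paths, so each is distance
nonincreasing. -/
theorem AreIsometric.exists_inducedEDist_eq {E' H' M' V' : Type*} [NormedAddCommGroup E']
    [NormedSpace ℝ E'] [TopologicalSpace H'] {I' : ModelWithCorners ℝ E' H'} [TopologicalSpace M']
    [ChartedSpace H' M'] [NormedAddCommGroup V'] [InnerProductSpace ℝ V'] {F : M → V}
    {F' : M' → V'} (hF : ContMDiff I 𝓘(ℝ, V) 1 F) (hF' : ContMDiff I' 𝓘(ℝ, V') 1 F')
    (h : AreIsometric I I' F F') :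
    ∃ Φ : M → M', ∀ p q, inducedEDist I' F' (Φ p) (Φ q) = inducedEDist I F p q := by
  obtain ⟨Φ, hΦ⟩ := h
  have hΦ1 : ContMDiff I I' 1 Φ := Φ.contMDiff.of_le (by simp)
  have hΦ2 : ContMDiff I' I 1 Φ.symm := Φ.symm.contMDiff.of_le (by simp)
  have key : ∀ p (v : TangentSpace I p),
      ‖mvfderiv I' F' (Φ p) (mfderiv I I' Φ p v)‖ = ‖mvfderiv I F p v‖ := fun p v => by
    rw [← sq_eq_sq₀ (norm_nonneg _) (norm_nonneg _), ← real_inner_self_eq_norm_sq,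
      ← real_inner_self_eq_norm_sq, hΦ]
  have key' : ∀ p (v : TangentSpace I' p),
      ‖mvfderiv I F (Φ.symm p) (mfderiv I' I Φ.symm p v)‖ = ‖mvfderiv I' F' p v‖ := by
    intro p v
    rw [← key]
    have e : mfderiv I I' Φ (Φ.symm p) (mfderiv I' I Φ.symm p v) = v := by
      have := mfderiv_comp p (hΦ1.mdifferentiable one_ne_zero (Φ.symm p))
        (hΦ2.mdifferentiable one_ne_zero p)
      have e2 : (Φ ∘ Φ.symm : M' → M') = id := funext fun q => Φ.apply_symm_apply q
      rw [e2, mfderiv_id] at this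
      exact (congrArg (fun f => f v) this).symm
    rw [e]
    exact congrArg (fun q => ‖mvfderiv I' F' q v‖) (Φ.apply_symm_apply p)
  refine ⟨Φ, fun p q => le_antisymm (inducedEDist_map_le hF hF' hΦ1 key p q) ?_⟩
  simpa using inducedEDist_map_le hF' hF hΦ2 key' (Φ p) (Φ q)

end InducedDistance

/-! ### Distance estimates, completeness and comparison with round cylinders. -/

section RevolutionDistance

variable {n : ℕ}

theorem norm_axisProd_smul_le (a : ℝ) (w : EuclideanSpace ℝ (Fin n)) :
    |a| ≤ ‖axisProd n (a, w)‖ := by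
  refine abs_le_of_sq_le_sq ?_ (norm_nonneg _)
  rw [norm_axisProd_sq]
  exact le_add_of_nonneg_right (sq_nonneg _)

theorem norm_axisProd_zero (w : EuclideanSpace ℝ (Fin n)) : ‖axisProd n (0, w)‖ = ‖w‖ := by
  rw [← sq_eq_sq₀ (norm_nonneg _) (norm_nonneg _), norm_axisProd_sq]
  simp

theorem exists_orthogonal_decomposition (hn : 2 ≤ n)
    {α β : EuclideanSpace ℝ (Fin n)} (hα : ‖α‖ = 1) (hβ : ‖β‖ = 1) :
    ∃ γ : EuclideanSpace ℝ (Fin n), ‖γ‖ = 1 ∧ inner ℝ α γ = 0 ∧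
      β = inner ℝ α β • α + Real.sin (Real.arccos (inner ℝ α β)) • γ := by
  have hab := abs_real_inner_le_norm α β
  rw [hα, hβ, one_mul, abs_le] at hab
  set w := β - inner ℝ α β • α with hw
  have hαα : inner ℝ α α = (1 : ℝ) := by rw [real_inner_self_eq_norm_sq, hα, one_pow]
  have hββ : inner ℝ β β = (1 : ℝ) := by rw [real_inner_self_eq_norm_sq, hβ, one_pow]
  have hαw : inner ℝ α w = 0 := by
    rw [hw, inner_sub_right, real_inner_smul_right, hαα, mul_one, sub_self]
  have hnw : ‖w‖ = Real.sin (Real.arccos (inner ℝ α β)) := by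
    rw [Real.sin_arccos, eq_comm, Real.sqrt_eq_iff_mul_self_eq (by nlinarith) (norm_nonneg _),
      ← sq, ← real_inner_self_eq_norm_sq]
    simp only [hw, inner_sub_left, inner_sub_right, real_inner_smul_left, real_inner_smul_right,
      hαα, hββ, real_inner_comm α β]
    ring
  rw [← hnw]
  -- Here β = ±α and any unit vector orthogonal to α serves; one exists because n ≥ 2.
  by_cases h0 : w = 0
  · have : Fact (Module.finrank ℝ (EuclideanSpace ℝ (Fin n)) = (n - 1) + 1) :=
      ⟨by rw [finrank_euclideanSpace_fin]; omega⟩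
    have hfin := Submodule.finrank_orthogonal_span_singleton (𝕜 := ℝ) (n := n - 1)
      (norm_ne_zero_iff.1 (hα.trans_ne one_ne_zero))
    have : Nontrivial (ℝ ∙ α)ᗮ := Module.nontrivial_of_finrank_pos (R := ℝ) (by omega)
    obtain ⟨⟨γ, hγ⟩, hne⟩ := exists_ne (0 : (ℝ ∙ α)ᗮ)
    have hne' : γ ≠ 0 := fun h => hne (Subtype.ext h)
    refine ⟨‖γ‖⁻¹ • γ, norm_smul_inv_norm (𝕜 := ℝ) hne', ?_, ?_⟩
    · rw [real_inner_smul_right, Submodule.mem_orthogonal_singleton_iff_inner_right.1 hγ, mul_zero]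
    · rw [h0, norm_zero, zero_smul, add_zero]
      exact sub_eq_zero.1 h0
  · refine ⟨‖w‖⁻¹ • w, norm_smul_inv_norm (𝕜 := ℝ) h0, ?_, ?_⟩
    · rw [real_inner_smul_right, hαw, mul_zero]
    · rw [smul_smul, mul_inv_cancel₀ (norm_ne_zero_iff.2 h0), one_smul, hw]
      abel

variable [NeZero n]

/-- Two points of the sphere are joined by an arc of a great circle. -/
theorem exists_great_circle (hn : 2 ≤ n) (α β : Metric.sphere (0 : EuclideanSpace ℝ (Fin n)) 1) :
    ∃ c : ℝ → Metric.sphere (0 : EuclideanSpace ℝ (Fin n)) 1,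
      ContMDiff 𝓘(ℝ, ℝ) (𝓡 (n - 1)) 1 c ∧ c 0 = α ∧ c 1 = β ∧
      ∀ t, ∃ d : EuclideanSpace ℝ (Fin n),
        HasDerivAt (fun t => (c t : EuclideanSpace ℝ (Fin n))) d t ∧
        ‖d‖ = Real.arccos (inner ℝ (α : EuclideanSpace ℝ (Fin n)) β) := by
  have hα : ‖(α : EuclideanSpace ℝ (Fin n))‖ = 1 := norm_eq_of_mem_sphere α
  have hβ : ‖(β : EuclideanSpace ℝ (Fin n))‖ = 1 := norm_eq_of_mem_sphere β
  obtain ⟨γ, hγ, hαγ, hdec⟩ := exists_orthogonal_decomposition hn hα hβ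
  have hab := abs_real_inner_le_norm (α : EuclideanSpace ℝ (Fin n)) β
  rw [hα, hβ, one_mul, abs_le] at hab
  set φ := Real.arccos (inner ℝ (α : EuclideanSpace ℝ (Fin n)) β) with hφ
  have hnorm : ∀ a b : ℝ, ‖a • (α : EuclideanSpace ℝ (Fin n)) + b • γ‖ ^ 2 = a ^ 2 + b ^ 2 := by
    intro a b
    rw [norm_add_sq_real, real_inner_smul_left, real_inner_smul_right, hαγ, norm_smul, norm_smul,
      hα, hγ, Real.norm_eq_abs, Real.norm_eq_abs]
    simp
  let f : ℝ → EuclideanSpace ℝ (Fin n) := fun t =>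
    Real.cos (φ * t) • (α : EuclideanSpace ℝ (Fin n)) + Real.sin (φ * t) • γ
  have hf : ∀ t, f t ∈ Metric.sphere (0 : EuclideanSpace ℝ (Fin n)) 1 := by
    intro t
    rw [mem_sphere_zero_iff_norm, ← pow_eq_one_iff_of_nonneg (norm_nonneg _) two_ne_zero, hnorm,
      Real.cos_sq_add_sin_sq]
  have hfs : ContDiff ℝ 1 f := by fun_prop
  refine ⟨Set.codRestrict f _ hf, hfs.contMDiff.codRestrict_sphere hf, Subtype.ext ?_,
    Subtype.ext ?_, fun t => ?_⟩
  · simp [f]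
  · change f 1 = β
    simp only [f, mul_one]
    rw [hdec, hφ, Real.cos_arccos hab.1 hab.2, ← hdec]
  · refine ⟨(-(φ * Real.sin (φ * t))) • (α : EuclideanSpace ℝ (Fin n)) +
      (φ * Real.cos (φ * t)) • γ, ?_, ?_⟩
    · have h1 : HasDerivAt (fun t : ℝ => φ * t) φ t := by
        simpa using (hasDerivAt_id t).const_mul φ
      have h2 := (h1.cos.smul_const (α : EuclideanSpace ℝ (Fin n))).fun_add (h1.sin.smul_const γ)
      refine h2.congr_deriv ?_
      congr 2 <;> ring
    · rw [← sq_eq_sq₀ (norm_nonneg _) (Real.arccos_nonneg _), hnorm]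
      linear_combination φ ^ 2 * Real.sin_sq_add_cos_sq (φ * t)

theorem inducedEDist_revolve_rotate_le (hn : 2 ≤ n) {f g : ℝ → ℝ} (hf : ContDiff ℝ ∞ f)
    (hg : ContDiff ℝ ∞ g) (s : ℝ) (α β : Metric.sphere (0 : EuclideanSpace ℝ (Fin n)) 1) :
    inducedEDist (cylinderModel n) (revolve n f g) (s, α) (s, β) ≤
      ENNReal.ofReal (|g s| * Real.arccos (inner ℝ (α : EuclideanSpace ℝ (Fin n)) β)) := by
  obtain ⟨c, hc, h0, h1, hd⟩ := exists_great_circle hn α β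
  have := inducedEDist_le_of_norm_deriv_le (γ := fun t => ((s, c t) : Cylinder n))
    (C := |g s| * Real.arccos (inner ℝ (α : EuclideanSpace ℝ (Fin n)) β))
    ((contMDiff_revolve (n := n) hf hg).of_le (by simp)) (contMDiff_const.prodMk hc) ?_
  · rwa [h0, h1] at this
  · intro t _
    obtain ⟨d, hd, hdn⟩ := hd t
    have : HasDerivAt (revolve n f g ∘ fun t => ((s, c t) : Cylinder n))
        (axisProd n (0, g s • d)) t :=
      (axisProd n).hasFDerivAt.comp_hasDerivAt t
        ((hasDerivAt_const t (f s)).prodMk (hd.const_smul (g s)))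
    rw [this.deriv, norm_axisProd_zero, norm_smul, hdn, Real.norm_eq_abs]

theorem inducedEDist_revolve_translate_le {f g f' g' : ℝ → ℝ} (hf : ContDiff ℝ ∞ f)
    (hg : ContDiff ℝ ∞ g) (hf' : ∀ s, HasDerivAt f (f' s) s) (hg' : ∀ s, HasDerivAt g (g' s) s)
    (hfg : ∀ s, f' s ^ 2 + g' s ^ 2 = 1) (s t : ℝ)
    (α : Metric.sphere (0 : EuclideanSpace ℝ (Fin n)) 1) :
    inducedEDist (cylinderModel n) (revolve n f g) (s, α) (t, α) ≤ ENNReal.ofReal |t - s| := by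
  have hl : ∀ τ : ℝ, HasDerivAt (fun τ => s + τ * (t - s)) (t - s) τ := fun τ => by
    simpa using ((hasDerivAt_id τ).mul_const (t - s)).const_add s
  have hls : ContDiff ℝ 1 (fun τ : ℝ => s + τ * (t - s)) := by fun_prop
  have := inducedEDist_le_of_norm_deriv_le
    (γ := fun τ => ((s + τ * (t - s), α) : Cylinder n)) (C := |t - s|)
    ((contMDiff_revolve (n := n) hf hg).of_le (by simp))
    (hls.contMDiff.prodMk contMDiff_const) ?_
  · simpa using this
  · intro τ _
    have h1 : HasDerivAt (revolve n f g ∘ fun τ => ((s + τ * (t - s), α) : Cylinder n))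
        (axisProd n (f' (s + τ * (t - s)) * (t - s),
          (g' (s + τ * (t - s)) * (t - s)) • (α : EuclideanSpace ℝ (Fin n)))) τ :=
      (axisProd n).hasFDerivAt.comp_hasDerivAt τ
        (((hf' _).comp τ (hl τ)).prodMk (((hg' _).comp τ (hl τ)).smul_const
          (α : EuclideanSpace ℝ (Fin n))))
    rw [h1.deriv]
    refine le_of_eq ?_
    rw [← sq_eq_sq₀ (norm_nonneg _) (abs_nonneg _), norm_axisProd_sq, norm_smul,
      norm_eq_of_mem_sphere, mul_one, Real.norm_eq_abs, sq_abs, sq_abs]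
    linear_combination (t - s) ^ 2 * hfg (s + τ * (t - s))

/-- Moves along the meridian of p to the latitude of q, then along a great circle of that latitude
sphere. -/
theorem inducedEDist_revolve_le (hn : 2 ≤ n) {f g f' g' : ℝ → ℝ} (hf : ContDiff ℝ ∞ f)
    (hg : ContDiff ℝ ∞ g) (hf' : ∀ s, HasDerivAt f (f' s) s) (hg' : ∀ s, HasDerivAt g (g' s) s)
    (hfg : ∀ s, f' s ^ 2 + g' s ^ 2 = 1) (p q : Cylinder n) :
    inducedEDist (cylinderModel n) (revolve n f g) p q ≤
      ENNReal.ofReal (|q.1 - p.1| +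
        |g q.1| * Real.arccos (inner ℝ (p.2 : EuclideanSpace ℝ (Fin n)) q.2)) := by
  rw [ENNReal.ofReal_add (abs_nonneg _) (mul_nonneg (abs_nonneg _) (Real.arccos_nonneg _))]
  exact (inducedEDist_triangle _ p (q.1, p.2) q).trans (add_le_add
    (inducedEDist_revolve_translate_le hf hg hf' hg' hfg p.1 q.1 p.2)
    (inducedEDist_revolve_rotate_le hn hf hg q.1 p.2 q.2))

/-- A Cauchy sequence for the induced distance is Cauchy in ℝⁿ⁺¹. As the image is closed and
embedded, it converges to a point of the manifold, and the explicit upper bound for the distance to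
that point tends to 0. -/
theorem IsNeckProfile.isCompleteHypersurface {k : ℕ} {lam : ℝ} {x r θ : ℝ → ℝ} (hn : 2 ≤ n)
    (h : IsNeckProfile k lam x r θ) :
    IsCompleteHypersurface (cylinderModel n) (revolve n x r) := by
  have hF : ContMDiff (cylinderModel n) 𝓘(ℝ, EuclideanSpace ℝ (Fin (n + 1))) 1
      (revolve n x r) := (contMDiff_revolve h.contDiff_x h.contDiff_r).of_le (by simp)
  intro u hu
  have hc : CauchySeq (fun i => revolve n x r (u i)) := by
    rw [EMetric.cauchySeq_iff]
    intro ε hε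
    obtain ⟨k, hk⟩ := hu ε hε
    refine ⟨k, fun i hi j hj => ?_⟩
    rw [edist_eq_enorm_sub]
    exact (enorm_sub_le_inducedEDist hF (u j) (u i)).trans_lt (hk j hj i hi)
  obtain ⟨v, hv⟩ := cauchySeq_tendsto_of_complete hc
  obtain ⟨p, rfl⟩ := h.isClosed_range.mem_of_tendsto hv (Eventually.of_forall fun i =>
    mem_range_self (u i))
  have hup : Tendsto u atTop (𝓝 p) := h.isEmbedding.tendsto_nhds_iff.2 hv
  refine ⟨p, tendsto_of_tendsto_of_tendsto_of_le_of_le tendsto_const_nhds ?_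
    (fun _ => zero_le) fun i => inducedEDist_revolve_le hn h.contDiff_x h.contDiff_r
      h.hasDerivAt_x h.hasDerivAt_r (fun s => Real.cos_sq_add_sin_sq _) (u i) p⟩
  have hcont : Continuous (fun q : Cylinder n => ENNReal.ofReal (|p.1 - q.1| +
      |r p.1| * Real.arccos (inner ℝ (q.2 : EuclideanSpace ℝ (Fin n)) p.2))) := by
    refine ENNReal.continuous_ofReal.comp (Continuous.add (by fun_prop) (continuous_const.mul
      (Real.continuous_arccos.comp (Continuous.inner (by fun_prop) continuous_const))))
  have := (hcont.tendsto p).comp hup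
  simpa [Function.comp_def, real_inner_self_eq_norm_sq, norm_eq_of_mem_sphere] using this

/-- Four points of the line cannot be nearly equidistant. -/
theorem three_mul_le_of_le_abs_sub {m D : ℝ} {y : Fin 4 → ℝ}
    (hm : ∀ i j, i ≠ j → m ≤ |y i - y j|) (hD : ∀ i j, i ≠ j → |y i - y j| ≤ D) :
    3 * m ≤ D := by
  have h01 := hm 0 1 (by decide)
  have h02 := hm 0 2 (by decide)
  have h03 := hm 0 3 (by decide)
  have h12 := hm 1 2 (by decide)
  have h13 := hm 1 3 (by decide)
  have h23 := hm 2 3 (by decide)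
  have g01 := abs_le.1 (hD 0 1 (by decide))
  have g02 := abs_le.1 (hD 0 2 (by decide))
  have g03 := abs_le.1 (hD 0 3 (by decide))
  have g12 := abs_le.1 (hD 1 2 (by decide))
  have g13 := abs_le.1 (hD 1 3 (by decide))
  have g23 := abs_le.1 (hD 2 3 (by decide))
  rcases le_abs.1 h01 with h01 | h01 <;> rcases le_abs.1 h12 with h12 | h12 <;>
  rcases le_abs.1 h23 with h23 | h23 <;> rcases le_abs.1 h02 with h02 | h02 <;>
  rcases le_abs.1 h13 with h13 | h13 <;> rcases le_abs.1 h03 with h03 | h03 <;> linarith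

theorem exists_four_unit_vectors (hn : 2 ≤ n) :
    ∃ α : Fin 4 → Metric.sphere (0 : EuclideanSpace ℝ (Fin n)) 1, ∀ i j, i ≠ j →
      2 ≤ ‖(α i : EuclideanSpace ℝ (Fin n)) - α j‖ ^ 2 := by
  let e : Fin n → EuclideanSpace ℝ (Fin n) := fun i => EuclideanSpace.single i 1
  have he : ∀ i, ‖e i‖ = 1 := fun i => by simp [e]
  let i₀ : Fin n := ⟨0, by omega⟩
  let i₁ : Fin n := ⟨1, by omega⟩
  have h01 : inner ℝ (e i₀) (e i₁) = 0 := by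
    rw [EuclideanSpace.inner_single_left, PiLp.single_apply, if_neg (by simp [i₀, i₁])]
    simp
  have h10 : inner ℝ (e i₁) (e i₀) = 0 := by rw [real_inner_comm, h01]
  refine ⟨![⟨e i₀, by simp [he]⟩, ⟨-e i₀, by simp [he]⟩, ⟨e i₁, by simp [he]⟩,
    ⟨-e i₁, by simp [he]⟩], fun i j hij => ?_⟩
  fin_cases i <;> fin_cases j <;> first | exact absurd rfl hij |
    (simp only [norm_sub_sq_real]
     simp [he, h01, h10, inner_neg_left, inner_neg_right]
     try norm_num)

/-- Four points on a latitude of radius r have mutual distances between √2 r and πr. On the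
cylinder, distances differ from differences of axial coordinates by at most πρ. Among four reals the
largest gap is at least three times the smallest, and 3√2 > π. Three points would not suffice, since
2√2 < π. -/
theorem IsNeckProfile.not_areIsometric_roundCylinder {k : ℕ} {lam : ℝ} {x r θ : ℝ → ℝ}
    (hn : 2 ≤ n) (h : IsNeckProfile k lam x r θ) {ρ : ℝ} (hρ : 0 < ρ) :
    ¬ AreIsometric (cylinderModel n) (cylinderModel n) (revolve n x r) (roundCylinder n ρ) := by
  intro hiso
  rw [roundCylinder_eq] at hiso
  have hF : ContMDiff (cylinderModel n) 𝓘(ℝ, EuclideanSpace ℝ (Fin (n + 1))) 1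
      (revolve n x r) := (contMDiff_revolve h.contDiff_x h.contDiff_r).of_le (by simp)
  have hF' : ContMDiff (cylinderModel n) 𝓘(ℝ, EuclideanSpace ℝ (Fin (n + 1))) 1
      (revolve n id (fun _ => ρ)) :=
    (contMDiff_revolve contDiff_id contDiff_const).of_le (by simp)
  obtain ⟨Φ, hΦ⟩ := hiso.exists_inducedEDist_eq hF hF'
  obtain ⟨α, hα⟩ := exists_four_unit_vectors hn
  -- The gap estimate reads 3(1.4 r - πρ) ≤ πr; with π < 3.15 it gives 1.05 r < 9.45 ρ, that is r <
  -- 9ρ.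
  obtain ⟨s, hs⟩ := (h.tendsto_r.eventually_gt_atTop (9 * ρ)).exists
  have hr := h.r_pos s
  have hpi := Real.pi_lt_d2
  have key := three_mul_le_of_le_abs_sub (y := fun i => (Φ (s, α i)).1)
    (m := 1.4 * r s - Real.pi * ρ) (D := Real.pi * r s) ?_ ?_
  · nlinarith
  · intro i j hij
    have h1 := enorm_sub_le_inducedEDist hF (s, α i) (s, α j)
    have h2 := inducedEDist_revolve_le hn contDiff_id (contDiff_const (c := ρ))
      (fun s => hasDerivAt_id s) (fun s => hasDerivAt_const s ρ) (by simp)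
      (Φ (s, α i)) (Φ (s, α j))
    rw [hΦ] at h2
    have h3 := h1.trans h2
    rw [← ofReal_norm, ENNReal.ofReal_le_ofReal_iff (add_nonneg (abs_nonneg _)
        (mul_nonneg (abs_nonneg _) (Real.arccos_nonneg _))),
      revolve, revolve, ← map_sub, Prod.mk_sub_mk, sub_self, norm_axisProd_zero, ← smul_sub,
      norm_smul, Real.norm_eq_abs, abs_of_pos hr, abs_sub_comm, abs_of_pos hρ] at h3
    have h4 := mul_le_mul_of_nonneg_left (Real.arccos_le_pi (inner ℝ
      ((Φ (s, α i)).2 : EuclideanSpace ℝ (Fin n)) (Φ (s, α j)).2)) hρ.le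
    have h5 : 1.4 ≤ ‖(α j : EuclideanSpace ℝ (Fin n)) - α i‖ := by
      nlinarith [hα j i hij.symm, norm_nonneg ((α j : EuclideanSpace ℝ (Fin n)) - α i)]
    nlinarith
  · intro i j hij
    have h1 := enorm_sub_le_inducedEDist hF' (Φ (s, α i)) (Φ (s, α j))
    rw [hΦ] at h1
    have h3 := h1.trans (inducedEDist_revolve_rotate_le hn h.contDiff_x h.contDiff_r s (α i) (α j))
    rw [← ofReal_norm, ENNReal.ofReal_le_ofReal_iff
      (mul_nonneg (abs_nonneg _) (Real.arccos_nonneg _)), revolve, revolve, ← map_sub,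
      Prod.mk_sub_mk, abs_of_pos hr] at h3
    have h4 := mul_le_mul_of_nonneg_left (Real.arccos_le_pi (inner ℝ
      (α i : EuclideanSpace ℝ (Fin n)) (α j))) hr.le
    have h5 := (norm_axisProd_smul_le _ _).trans h3
    rw [abs_sub_comm]
    simp only [id] at h5
    linarith

end RevolutionDistance

end

/-- The hypersurface is the image of `F`; it is diffeomorphic to `ℝ × S^{n-1}` because `F` is a
smooth embedding of that manifold. -/
theorem theorem1p1 (n : ℕ) [NeZero n] (hn : 2 ≤ n) :
    ∃ c₁ : ℝ, 0 < c₁ ∧ ∀ lam : ℝ, 0 < lam → lam < c₁ →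
      ∃ F N : Cylinder n → EuclideanSpace ℝ (Fin (n + 1)),
        IsEmbeddedSubmanifold (cylinderModel n) F ∧
        IsCompleteHypersurface (cylinderModel n) F ∧
        IsRotationallySymmetric (range F) ∧
        IsUnitNormalField (cylinderModel n) F N ∧
        IsInwardNormal F N ∧
        IsLambdaHypersurface (cylinderModel n) F N lam ∧
        ¬ IsConvexHypersurface (cylinderModel n) F N ∧
        ∀ ρ : ℝ, 0 < ρ →
          ¬ AreIsometric (cylinderModel n) (cylinderModel n) F (roundCylinder n ρ) := by
  -- The rotational curvature has multiplicity n - 1, and n ≥ 2 supplies the bound k ≥ 1 required by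
  -- the shooting.
  obtain ⟨c₁, hc₁, h⟩ := exists_isNeckProfile (k := n - 1) (by omega)
  refine ⟨c₁, hc₁, fun lam h0 h1 => ?_⟩
  obtain ⟨x, r, θ, h⟩ := h lam h0 h1
  exact ⟨revolve n x r, IsNeckProfile.normal n θ, h.isEmbeddedSubmanifold,
    h.isCompleteHypersurface hn, h.isRotationallySymmetric, h.isUnitNormalField,
    h.isInwardNormal, h.isLambdaHypersurface, h.not_isConvexHypersurface hn,
    fun ρ hρ => h.not_areIsometric_roundCylinder hn hρ⟩
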